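/- Let $n\ge 1$, $s\in(0,1)$, $b\in\mathbb R^n$, and let $K\in L^1_{\rm loc}(\mathbb R^n\setminus\{0\})$ be nonnegative and positively homogeneous of degree $-n-2s$ (that is, $K(ty)=t^{-n-2s}K(y)$ for all $t>0$, $y\ne0$), with, for some $\Lambda\ge\lambda>0$, $$\lambda\le\inf_{\nu\in S^{n-1}}\int_{S^{n-1}}|\nu\cdot\theta|^{2s}K(\theta)\,d\theta,\qquad \int_{S^{n-1}}K(\theta)\,d\theta\le\Lambda,$$ where $d\theta$ is the surface measure (the counting measure on $\{\pm1\}$ if $n=1$). If $s=\frac12$, assume in addition $\int_{S^{n-1}}\theta K(\theta)\,d\theta=0$ and $|b|\le\Lambda$. Let $$Lu(x)=\begin{cases}\int_{\mathbb R^n}(u(x)-u(x+y))K(y)\,dy,& s<\frac12,\\ \mathrm{P.V.}\int_{\mathbb R^n}(u(x)-u(x+y))K(y)\,dy+b\cdot\nabla u(x),& s=\frac12,\\ \int_{\mathbb R^n}(u(x)-u(x+y)+\nabla u(x)\cdot y)K(y)\,dy,& s>\frac12,\end{cases}$$ where $\mathrm{P.V.}\int=\lim_{\varepsilon\downarrow0}\int_{|y|\ge\varepsilon}$,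 and let $L^*$ be the operator obtained by replacing $K$ with $K^*:=K_e-K_o$ and $b$ with $-b$, where $K_e(y)=\frac{K(y)+K(-y)}2$ and $K_o(y)=\frac{K(y)-K(-y)}2$. Let $\mathcal A+i\mathcal B$ be the Fourier symbol of $L$ (so that $L$ multiplies $e^{i\xi\cdot x}$ by $\mathcal A(\xi)+i\mathcal B(\xi)$), given by $$\mathcal A(\xi)=c_s\int_{S^{n-1}}|\theta\cdot\xi|^{2s}K_e(\theta)\,d\theta,\qquad c_s=-\Gamma(-2s)\cos(\pi s)\ \text{ if } s\ne\tfrac12,\quad c_{1/2}=\tfrac\pi2,$$ $$\mathcal B(\xi)=\begin{cases}\Gamma(-2s)\sin(\pi s)\int_{S^{n-1}}|\theta\cdot\xi|^{2s-1}(\theta\cdot\xi)K_o(\theta)\,d\theta,& s\ne\frac12,\\ \int_{S^{n-1}}(\theta\cdot\xi)\log|\theta\cdot\xi|\,K_o(\theta)\,d\theta+b\cdot\xi,& s=\frac12.\end{cases}$$ Put $\gamma=s+\frac1\pi\arctan\frac{\mathcal B(e_n)}{\mathcal A(e_n)}$, and let $\gamma^*\in(0,2s)$ be such that $\gamma+\gamma^*=2s$.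 Let $\eta,\tau\in C_c^\infty(\mathbb R^n)$ be real-valued, and let $$u(x)=(x_n)_+^{\gamma}\,\eta(x),\qquad v(x)=(x_n)_+^{\gamma^*}\,\tau(x).$$ Then $Lu(x)$ and $L^*v(x)$ are well defined at every $x\in\mathbb R^n_+=\{x_n>0\}$ (the integrals converge absolutely; for $s=\frac12$ the truncated integrals converge absolutely and the principal value exists), the function $\partial_nu\,L^*v+Lu\,\partial_nv$ is integrable on $\mathbb R^n_+$, and $$\int_{\mathbb R^n_+}\big(\partial_nu\,L^*v+Lu\,\partial_nv\big)\,dx=c(L,e_n)\int_{\mathbb R^{n-1}}\eta(x',0)\,\tau(x',0)\,dx',$$ $$c(L,e_n)=\Gamma(\gamma+1)\,\Gamma(\gamma^*+1)\sqrt{\mathcal A^2(e_n)+\mathcal B^2(e_n)}.$$ (For $n=1$ the integral on the right is $\eta(0)\tau(0)$.) -/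

import Mathlib

open MeasureTheory Set Filter
open scoped Topology RealInnerProductSpace ContDiff

noncomputable section

namespace Stable

/-- The Euclidean space of dimension `n = m + 1`. -/
abbrev Space (m : ℕ) : Type := EuclideanSpace ℝ (Fin (m + 1))

/-- The last coordinate `x_n` of a point. -/
def lastCoord {m : ℕ} (x : Space m) : ℝ := x (Fin.last m)

/-- The last coordinate vector `e_n`. -/
def eLast (m : ℕ) : Space m := EuclideanSpace.single (Fin.last m) (1 : ℝ)

/-- The open half space `{x_n > 0}`. -/
def halfSpace (m : ℕ) : Set (Space m) := {x | 0 < lastCoord x}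

/-- The point `(x', 0)` of the boundary hyperplane, for `x'` in the `m`-dimensional space. -/
def bdryPoint {m : ℕ} (x' : EuclideanSpace ℝ (Fin m)) : Space m :=
  WithLp.toLp 2 (Fin.snoc (α := fun _ => ℝ) (fun i => x' i) 0)

/-- The surface measure on the unit sphere (for `n = 1`, the counting measure on `{1, -1}`). -/
def sphereMeasure (m : ℕ) : Measure (Metric.sphere (0 : Space m) 1) :=
  (volume : Measure (Space m)).toSphere

/-- Even part of a kernel. -/
def evenPart {m : ℕ} (K : Space m → ℝ) (y : Space m) : ℝ := (K y + K (-y)) / 2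

/-- Odd part of a kernel. -/
def oddPart {m : ℕ} (K : Space m → ℝ) (y : Space m) : ℝ := (K y - K (-y)) / 2

/-- The kernel of the adjoint operator, `K_e - K_o`. -/
def adjKernel {m : ℕ} (K : Space m → ℝ) (y : Space m) : ℝ := evenPart K y - oddPart K y

/-- The assumptions on the kernel `K` and the drift `b` of a stable operator of order `2s` with
ellipticity constants `lam ≤ Lam`, in dimension `n = m + 1`. -/
structure IsStableKernel {m : ℕ} (s lam Lam : ℝ) (K : Space m → ℝ) (b : Space m) : Prop where
  locallyIntegrable : LocallyIntegrableOn K ({0}ᶜ : Set (Space m)) volume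
  nonneg : ∀ y, y ≠ 0 → 0 ≤ K y
  homogeneous : ∀ (t : ℝ) (y : Space m), 0 < t → y ≠ 0 →
    K (t • y) = t ^ (-((m : ℝ) + 1) - 2 * s) * K y
  cancellation : s = 1 / 2 →
    ∫ θ : Metric.sphere (0 : Space m) 1, K θ • (θ : Space m) ∂(sphereMeasure m) = 0
  lam_pos : 0 < lam
  lam_le : lam ≤ Lam
  lower_bound : ∀ ν : Space m, ‖ν‖ = 1 →
    lam ≤ ∫ θ : Metric.sphere (0 : Space m) 1,
      |⟪ν, (θ : Space m)⟫| ^ (2 * s) * K θ ∂(sphereMeasure m)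
  upper_bound : ∫ θ : Metric.sphere (0 : Space m) 1, K θ ∂(sphereMeasure m) ≤ Lam
  drift_bound : s = 1 / 2 → ‖b‖ ≤ Lam

/-- The truncated integral whose limit as `ε ↓ 0` is the principal value used for `s = 1/2`. -/
def truncOp {m : ℕ} (K : Space m → ℝ) (u : Space m → ℝ) (x : Space m) (ε : ℝ) : ℝ :=
  ∫ y in (Metric.ball (0 : Space m) ε)ᶜ, (u x - u (x + y)) * K y

/-- The stable operator of order `2s` with kernel `K` and (if `s = 1/2`) drift `b`, evaluated
pointwise; `fderiv ℝ u x y` is the scalar product of `∇u(x)` and `y`. -/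
def stableOp {m : ℕ} (s : ℝ) (K : Space m → ℝ) (b : Space m) (u : Space m → ℝ)
    (x : Space m) : ℝ :=
  if s < 1 / 2 then ∫ y, (u x - u (x + y)) * K y
  else if s = 1 / 2 then limUnder (𝓝[>] (0 : ℝ)) (truncOp K u x) + fderiv ℝ u x b
  else ∫ y, (u x - u (x + y) + fderiv ℝ u x y) * K y

/-- The pointwise expression defining `stableOp s K b u x` makes sense: the gradient exists where
it is used, the integrals converge absolutely, and for `s = 1/2` the principal value exists. -/
def StableOpDefinedAt {m : ℕ} (s : ℝ) (K : Space m → ℝ) (u : Space m → ℝ)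
    (x : Space m) : Prop :=
  (s < 1 / 2 → Integrable (fun y => (u x - u (x + y)) * K y)) ∧
  (s = 1 / 2 → DifferentiableAt ℝ u x ∧
    (∀ ε : ℝ, 0 < ε →
      IntegrableOn (fun y => (u x - u (x + y)) * K y) (Metric.ball (0 : Space m) ε)ᶜ) ∧
    ∃ l : ℝ, Tendsto (truncOp K u x) (𝓝[>] (0 : ℝ)) (𝓝 l)) ∧
  (1 / 2 < s → DifferentiableAt ℝ u x ∧
    Integrable (fun y => (u x - u (x + y) + fderiv ℝ u x y) * K y))

/-- The adjoint operator: kernel `K_e - K_o` and drift `-b`. -/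
def adjointOp {m : ℕ} (s : ℝ) (K : Space m → ℝ) (b : Space m) (u : Space m → ℝ)
    (x : Space m) : ℝ :=
  stableOp s (adjKernel K) (-b) u x

/-- Real part of the Fourier symbol. The constant is the value of the integral of
`(1 - cos t) t^(-1-2s)` over `(0, ∞)`, namely `-Γ(-2s) cos(π s) > 0` for `s ≠ 1/2`, and `π/2`
(the limit of the former) for `s = 1/2`. -/
def symbolA {m : ℕ} (s : ℝ) (K : Space m → ℝ) (ξ : Space m) : ℝ :=
  (if s = 1 / 2 then Real.pi / 2 else -Real.Gamma (-2 * s) * Real.cos (Real.pi * s)) *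
    ∫ θ : Metric.sphere (0 : Space m) 1,
      |⟪(θ : Space m), ξ⟫| ^ (2 * s) * evenPart K θ ∂(sphereMeasure m)

/-- Imaginary part of the Fourier symbol (convention: the operator multiplies the exponential
`x ↦ exp(i ξ·x)` by `A(ξ) + i B(ξ)`). -/
def symbolB {m : ℕ} (s : ℝ) (K : Space m → ℝ) (b : Space m) (ξ : Space m) : ℝ :=
  if s = 1 / 2 then
    (∫ θ : Metric.sphere (0 : Space m) 1,
      ⟪(θ : Space m), ξ⟫ * Real.log |⟪(θ : Space m), ξ⟫| * oddPart K θ ∂(sphereMeasure m))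
      + ⟪b, ξ⟫
  else
    Real.Gamma (-2 * s) * Real.sin (Real.pi * s) *
      ∫ θ : Metric.sphere (0 : Space m) 1,
        |⟪(θ : Space m), ξ⟫| ^ (2 * s - 1) * ⟪(θ : Space m), ξ⟫ * oddPart K θ ∂(sphereMeasure m)

/-- The boundary exponent `γ(L, ν) = s + π⁻¹ arctan (B(ν) / A(ν))`. -/
def bdryExponent {m : ℕ} (s : ℝ) (K : Space m → ℝ) (b : Space m) (ν : Space m) : ℝ :=
  s + 1 / Real.pi * Real.arctan (symbolB s K b ν / symbolA s K ν)

/-- The function `x ↦ (x_n)_+^β η(x)`. -/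
def powMul {m : ℕ} (β : ℝ) (η : Space m → ℝ) (x : Space m) : ℝ :=
  (max (lastCoord x) 0) ^ β * η x

/-- The partial derivative `∂_n u`. -/
def partialLast {m : ℕ} (u : Space m → ℝ) (x : Space m) : ℝ := fderiv ℝ u x (eLast m)

end Stable

end

/-! The identity is the boundary term of a duality argument. On the whole space L and L* are dual,
also after translating u by h ≥ 0 along e_n: ∫ u(x + h e_n) L*v = ∫ v Lu(x + h e_n). Subtract the
case h = 0, move the translation onto v in the terms with Lu, and divide by h. On the half space the
difference quotients converge to the integral of ∂_n u L*v + Lu ∂_n v. What is left over is the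
integral of u(x + h e_n) L*v over the layer -h < x_n < 0, into which the translated u protrudes
(`setIntegral_halfSpace_shift`, resting on `integral_mul_regOp_adjoint`).

In that layer L*v(x) = -∫ v(x - y) K(y) dy has size |x_n|^(γ*-2s) = |x_n|^(-γ), while u(x + h e_n)
has size (h - |x_n|)^γ. After the substitution x_n = -h r all powers of h cancel except one factor h
from the volume. The limit is ∫ ητ times F₋ B(γ*+1, γ) B(1-γ, γ+1), where F₋ = ∫ (-θ_n)_+^(2s) K(θ)
dθ is `fluxMinus` (`tendsto_integral_integral_layer`). The r-integral needs γ < 1. If γ ≥ 1 then γ*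
< 1, and the argument is run with L and L*, u and v exchanged.

Passing to the limit in the difference quotients needs an integrable majorant. The scaling bound
x_n^(γ-2s) for Lu is not enough, since its product with ∂_n v of size x_n^(γ*-1) is x_n^(-1). The
special exponent helps: L annihilates (x_n)_+^γ in the half space (`regOp_profile`), so only terms
in which the increment falls on η survive, and Lu = O(x_n^(-g)) with g < 2s-γ
(`exists_regOp_powMul_bound`). The annihilation is checked ray by ray: each ray gives a Beta
integral, and the directions balance because F₊ sin(πγ) = F₋ sin(π(2s-γ)). For s = 1/2 the balance
also involves a logarithmic moment and the drift.

The constant comes from πγ = πs + arg(A + iB), which gives √(A²+B²) sin(πγ) Γ(1+2s) = π F₋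
(`sqrt_mul_sin_mul_Gamma`). The reflection formula then turns the two Beta values into Γ(γ+1)
Γ(γ*+1) √(A²+B²). -/

open MeasureTheory Set Filter
open scoped Topology RealInnerProductSpace ContDiff

noncomputable section

namespace Stable

open scoped ENNReal

/-! ### Polar coordinates for the measure K(y) dy -/

section

variable {m : ℕ}

/-- The unit sphere of `Space m`. -/
abbrev Sph (m : ℕ) : Type := Metric.sphere (0 : Space m) 1

/-- The measure `K(y) dy`. -/
def kernelMeasure (K : Space m → ℝ) : Measure (Space m) :=
  volume.withDensity fun y => ENNReal.ofReal (K y)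

/-- The measure `K(θ) dθ` on the unit sphere. -/
def spectralMeasure (K : Space m → ℝ) : Measure (Sph m) :=
  (sphereMeasure m).withDensity fun θ => ENNReal.ofReal (K θ)

/-- The measure `r^(-1-2s) dr` on the half line. -/
def radialMeasure (s : ℝ) : Measure ℝ :=
  (volume.restrict (Ioi 0)).withDensity fun r => ENNReal.ofReal (r ^ (-1 - 2 * s))

instance (K : Space m → ℝ) : SFinite (kernelMeasure K) := by
  unfold kernelMeasure; infer_instance

instance (s : ℝ) : SFinite (radialMeasure s) := by
  unfold radialMeasure; infer_instance

instance : IsFiniteMeasure (sphereMeasure m) := by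
  unfold sphereMeasure; infer_instance

instance (K : Space m → ℝ) : SFinite (spectralMeasure K) := by
  unfold spectralMeasure; infer_instance

/-- Polar coordinates `(θ, r) ↦ r θ`. -/
def polarMap (p : Sph m × Ioi (0 : ℝ)) : Space m := p.2.1 • p.1.1

lemma polarMap_eq :
    (polarMap : Sph m × Ioi (0 : ℝ) → Space m)
      = Subtype.val ∘ (homeomorphUnitSphereProd (Space m)).symm := by
  ext1 p
  simp [polarMap, homeomorphUnitSphereProd_symm_apply_coe]

lemma measurableEmbedding_polarMap :
    MeasurableEmbedding (polarMap : Sph m × Ioi (0 : ℝ) → Space m) := by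
  rw [polarMap_eq]
  exact (MeasurableEmbedding.subtype_coe (measurableSet_singleton _).compl).comp
    (Homeomorph.measurableEmbedding _)

lemma measurePreserving_polarMap :
    MeasurePreserving (polarMap : Sph m × Ioi (0 : ℝ) → Space m)
      ((sphereMeasure m).prod (Measure.volumeIoiPow m)) volume := by
  rw [polarMap_eq]
  have h := (volume : Measure (Space m)).measurePreserving_homeomorphUnitSphereProd
  have hd : Module.finrank ℝ (Space m) - 1 = m := by simp [Space]
  rw [hd] at h
  have h2 : MeasurePreserving (Subtype.val : ({0}ᶜ : Set (Space m)) → Space m)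
      (Measure.comap Subtype.val volume) volume := by
    refine ⟨measurable_subtype_coe, ?_⟩
    rw [map_comap_subtype_coe (measurableSet_singleton _).compl,
      restrict_compl_singleton]
  exact h2.comp (MeasurePreserving.symm (homeomorphUnitSphereProd (Space m)).toMeasurableEquiv h)

lemma lintegral_polar (F : Space m → ℝ≥0∞) :
    ∫⁻ y, F y = ∫⁻ p : Sph m × Ioi (0 : ℝ), F (p.2.1 • p.1.1)
      ∂((sphereMeasure m).prod (Measure.volumeIoiPow m)) :=
  (measurePreserving_polarMap.lintegral_comp_emb measurableEmbedding_polarMap F).symm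

variable {s lam Lam : ℝ} {K : Space m → ℝ} {b : Space m}

lemma sphere_ne_zero (θ : Sph m) : (θ : Space m) ≠ 0 := by
  intro h
  have := norm_eq_of_mem_sphere θ
  rw [h] at this; simp at this

lemma IsStableKernel.aestronglyMeasurable (hK : IsStableKernel s lam Lam K b) :
    AEStronglyMeasurable K volume := by
  have := hK.locallyIntegrable.aestronglyMeasurable
  rwa [restrict_compl_singleton] at this

lemma IsStableKernel.nonneg_sphere (hK : IsStableKernel s lam Lam K b) (θ : Sph m) : 0 ≤ K θ :=
  hK.nonneg _ (sphere_ne_zero θ)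

/-- Local integrability away from 0 makes K integrable on the annulus 1 ≤ |y| ≤ 2. By Fubini it is
integrable on some sphere of radius r in [1, 2], and homogeneity carries this to the unit sphere. -/
lemma IsStableKernel.integrable_sphere (hK : IsStableKernel s lam Lam K b) :
    Integrable (fun θ : Sph m => K θ) (sphereMeasure m) := by
  set S : Set (Space m) := Metric.closedBall 0 2 \ Metric.ball 0 1
  have hSc : IsCompact S := (isCompact_closedBall _ _).diff Metric.isOpen_ball
  have hS0 : S ⊆ {0}ᶜ := by
    intro y hy h0
    simp only [mem_singleton_iff] at h0
    subst h0
    exact hy.2 (Metric.mem_ball_self one_pos)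
  have hint : Integrable (S.indicator K) volume :=
    (integrable_indicator_iff hSc.isClosed.measurableSet).2
      (hK.locallyIntegrable.integrableOn_compact_subset hS0 hSc)
  have h1 := (measurePreserving_polarMap.integrable_comp_emb measurableEmbedding_polarMap).2 hint
  have h2 := h1.prod_left_ae
  -- The radii in [1, 2] have positive measure, so the almost-everywhere statement of Fubini holds
  -- for at least one of them.
  have hpos : Measure.volumeIoiPow m {r | 1 ≤ r.1 ∧ r.1 ≤ 2} ≠ 0 := by
    intro h0
    rw [Measure.volumeIoiPow, withDensity_apply_eq_zero' (by fun_prop)] at h0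
    have : {a : Ioi (0:ℝ) | ENNReal.ofReal (a.1 ^ m) ≠ 0} ∩ {r : Ioi (0:ℝ) | 1 ≤ r.1 ∧ r.1 ≤ 2}
        = Subtype.val ⁻¹' (Icc (1:ℝ) 2) := by
      ext ⟨a, ha⟩
      have : 0 < a ^ m := pow_pos ha m
      simp only [mem_inter_iff, mem_ofPred_eq, mem_preimage, mem_Icc, ne_eq,
        ENNReal.ofReal_eq_zero, not_le]
      tauto
    rw [this, comap_subtype_coe_apply measurableSet_Ioi, Subtype.image_preimage_coe,
      inter_eq_self_of_subset_right, Real.volume_Icc] at h0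
    · norm_num at h0
    · intro x hx; exact lt_of_lt_of_le one_pos hx.1
  obtain ⟨r, hr, hr2⟩ : ∃ r : Ioi (0:ℝ), (1 ≤ r.1 ∧ r.1 ≤ 2) ∧
      Integrable (fun θ : Sph m => (S.indicator K ∘ polarMap) (θ, r)) (sphereMeasure m) := by
    by_contra hcon
    push Not at hcon
    apply hpos
    refine measure_mono_null ?_ h2
    intro r hr
    exact hcon r hr
  have hr0 : 0 < r.1 := r.2
  refine (hr2.const_mul ((r.1 ^ (-((m : ℝ) + 1) - 2 * s))⁻¹)).congr (Eventually.of_forall ?_)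
  intro θ
  have hmem : r.1 • θ.1 ∈ S := by
    have : ‖r.1 • θ.1‖ = r.1 := by rw [norm_smul, norm_eq_of_mem_sphere]; simp [abs_of_pos hr0]
    constructor
    · simp [this, hr.2]
    · simp [this, hr.1]
  have hp : (r.1 ^ (-((m : ℝ) + 1) - 2 * s)) ≠ 0 := (Real.rpow_pos_of_pos hr0 _).ne'
  simp only [Function.comp, polarMap, indicator_of_mem hmem]
  rw [hK.homogeneous _ _ hr0 (sphere_ne_zero θ)]
  field_simp

lemma IsStableKernel.aemeasurable_sphere (hK : IsStableKernel s lam Lam K b) :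
    AEMeasurable (fun θ : Sph m => ENNReal.ofReal (K θ)) (sphereMeasure m) :=
  hK.integrable_sphere.aestronglyMeasurable.aemeasurable.ennreal_ofReal

lemma IsStableKernel.isFiniteMeasure_spectral (hK : IsStableKernel s lam Lam K b) :
    IsFiniteMeasure (spectralMeasure K) :=
  isFiniteMeasure_withDensity_ofReal hK.integrable_sphere.2

lemma lintegral_kernelMeasure (hK : IsStableKernel s lam Lam K b) {F : Space m → ℝ≥0∞}
    (hF : AEMeasurable F volume) :
    ∫⁻ y, F y ∂(kernelMeasure K) = ∫⁻ y, ENNReal.ofReal (K y) * F y := by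
  rw [kernelMeasure, lintegral_withDensity_eq_lintegral_mul₀ _ hF]
  · rfl
  · exact hK.aestronglyMeasurable.aemeasurable.ennreal_ofReal

/-- The measure `K(y) dy` in polar coordinates. -/
lemma kernelMeasure_eq_map (hK : IsStableKernel s lam Lam K b) :
    kernelMeasure K = Measure.map (fun p : Sph m × ℝ => p.2 • (p.1 : Space m))
      ((spectralMeasure K).prod (radialMeasure s)) := by
  have hm : Measurable (fun p : Sph m × ℝ => p.2 • (p.1 : Space m)) := by fun_prop
  have hKs := hK.aemeasurable_sphere
  ext A hA
  rw [Measure.map_apply hm hA, ← lintegral_indicator_one hA,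
    ← lintegral_indicator_one (hm hA),
    lintegral_kernelMeasure hK ((measurable_one.indicator hA).aemeasurable), lintegral_polar]
  rw [lintegral_prod _ ((measurable_one.indicator (hm hA)).aemeasurable)]
  rw [spectralMeasure, lintegral_withDensity_eq_lintegral_mul₀ hKs
    (Measurable.aemeasurable (Measurable.lintegral_prod_right' (measurable_one.indicator (hm hA))))]
  have hcongr : ∀ p : Sph m × Ioi (0 : ℝ), ENNReal.ofReal (K (p.2.1 • p.1.1)) *
      A.indicator 1 (p.2.1 • p.1.1) = ENNReal.ofReal (K p.1) *
        (ENNReal.ofReal (p.2.1 ^ (-((m : ℝ) + 1) - 2 * s)) * A.indicator 1 (p.2.1 • p.1.1)) := by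
    rintro ⟨θ, r, hr⟩
    simp only
    rw [hK.homogeneous r θ hr (sphere_ne_zero θ), ENNReal.ofReal_mul
      (Real.rpow_nonneg (le_of_lt hr) _)]
    ring
  simp_rw [hcongr]
  rw [lintegral_prod]
  · refine lintegral_congr fun θ => ?_
    simp only [Pi.mul_apply]
    have hmeas1 : Measurable fun r : ℝ =>
        (ENNReal.ofReal (r ^ (-((m : ℝ) + 1) - 2 * s)) * A.indicator 1 (r • (θ : Space m))) :=
      (by fun_prop : Measurable fun r : ℝ => ENNReal.ofReal (r ^ (-((m : ℝ) + 1) - 2 * s))).mul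
        ((measurable_one.indicator hA).comp (by fun_prop))
    rw [lintegral_const_mul]
    swap
    · exact hmeas1.comp measurable_subtype_coe
    congr 1
    rw [Measure.volumeIoiPow, lintegral_withDensity_eq_lintegral_mul _
      (by fun_prop : Measurable fun r : Ioi (0 : ℝ) => ENNReal.ofReal (r.1 ^ m))
      (g := fun a : Ioi (0 : ℝ) => ENNReal.ofReal (a.1 ^ (-((m : ℝ) + 1) - 2 * s)) *
        A.indicator 1 (a.1 • (θ : Space m)))
      (hmeas1.comp measurable_subtype_coe)]
    rw [radialMeasure, lintegral_withDensity_eq_lintegral_mul _ (by fun_prop)]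
    swap
    · exact (measurable_one.indicator (hm hA)).comp (by fun_prop : Measurable fun y : ℝ => (θ, y))
    rw [← lintegral_subtype_comap measurableSet_Ioi]
    refine lintegral_congr fun r => ?_
    have hr : 0 < r.1 := r.2
    simp only [Pi.mul_apply]
    rw [← mul_assoc, ← ENNReal.ofReal_mul (by positivity)]
    -- The Jacobian r^(n-1) meets the homogeneity r^(-n-2s), with n = m + 1.
    have he : r.1 ^ m * r.1 ^ (-((m : ℝ) + 1) - 2 * s) = r.1 ^ (-1 - 2 * s) := by
      rw [← Real.rpow_natCast, ← Real.rpow_add hr]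
      ring_nf
    rw [he]
    rfl
  · refine AEMeasurable.mul ?_ ?_
    · exact hKs.comp_fst
    · refine Measurable.aemeasurable ?_
      refine Measurable.mul (by fun_prop) ?_
      exact ((measurable_one.indicator hA).comp (by fun_prop))

lemma integral_kernelMeasure (hK : IsStableKernel s lam Lam K b) (F : Space m → ℝ) :
    ∫ y, F y ∂(kernelMeasure K) = ∫ y, F y * K y := by
  rw [kernelMeasure, integral_withDensity_eq_integral_toReal_smul₀
    hK.aestronglyMeasurable.aemeasurable.ennreal_ofReal (by simp)]
  refine integral_congr_ae ?_
  filter_upwards [compl_mem_ae_iff.2 (measure_singleton (0 : Space m))] with y hy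
  rw [ENNReal.toReal_ofReal (hK.nonneg y hy), smul_eq_mul, mul_comm]

lemma integrable_kernelMeasure_iff (hK : IsStableKernel s lam Lam K b) (F : Space m → ℝ) :
    Integrable F (kernelMeasure K) ↔ Integrable (fun y => F y * K y) := by
  rw [kernelMeasure, integrable_withDensity_iff_integrable_smul₀'
    hK.aestronglyMeasurable.aemeasurable.ennreal_ofReal (by simp)]
  refine integrable_congr ?_
  filter_upwards [compl_mem_ae_iff.2 (measure_singleton (0 : Space m))] with y hy
  rw [ENNReal.toReal_ofReal (hK.nonneg y hy), smul_eq_mul, mul_comm]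

lemma kernelMeasure_singleton_zero : kernelMeasure K {0} = 0 :=
  withDensity_absolutelyContinuous _ _ (measure_singleton _)

lemma integral_radialMeasure (g : ℝ → ℝ) :
    ∫ r, g r ∂(radialMeasure s) = ∫ r in Ioi 0, g r * r ^ (-1 - 2 * s) := by
  rw [radialMeasure, integral_withDensity_eq_integral_toReal_smul₀ (by fun_prop) (by simp)]
  refine setIntegral_congr_fun measurableSet_Ioi fun r (hr : 0 < r) => ?_
  rw [ENNReal.toReal_ofReal (Real.rpow_nonneg hr.le _), smul_eq_mul, mul_comm]

lemma integrable_polar (hK : IsStableKernel s lam Lam K b) {F : Space m → ℝ}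
    (hF : Integrable F (kernelMeasure K)) :
    Integrable (fun p : Sph m × ℝ => F (p.2 • (p.1 : Space m)))
      ((spectralMeasure K).prod (radialMeasure s)) := by
  rw [kernelMeasure_eq_map hK] at hF
  exact hF.comp_measurable (by fun_prop)

lemma integral_polar (hK : IsStableKernel s lam Lam K b) {F : Space m → ℝ}
    (hF : Integrable F (kernelMeasure K)) :
    ∫ y, F y ∂(kernelMeasure K) =
      ∫ θ : Sph m, ∫ r in Ioi 0, F (r • (θ : Space m)) * r ^ (-1 - 2 * s)
        ∂volume ∂(spectralMeasure K) := by
  have h := integrable_polar hK hF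
  rw [kernelMeasure_eq_map hK] at hF ⊢
  rw [integral_map (by fun_prop) hF.1, integral_prod _ h]
  simp_rw [integral_radialMeasure]

lemma lintegral_kernelMeasure_polar (hK : IsStableKernel s lam Lam K b) {F : Space m → ℝ≥0∞}
    (hF : Measurable F) :
    ∫⁻ y, F y ∂(kernelMeasure K) =
      ∫⁻ θ : Sph m, ∫⁻ r in Ioi 0, F (r • (θ : Space m)) * ENNReal.ofReal (r ^ (-1 - 2 * s))
        ∂volume ∂(spectralMeasure K) := by
  rw [kernelMeasure_eq_map hK, lintegral_map hF (by fun_prop), lintegral_prod]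
  · refine lintegral_congr fun θ => ?_
    rw [radialMeasure, lintegral_withDensity_eq_lintegral_mul _ (by fun_prop)]
    · simp only [Pi.mul_apply, mul_comm]
    · exact hF.comp (by fun_prop)
  · exact (hF.comp (by fun_prop)).aemeasurable

lemma lintegral_kernelMeasure_radial (hK : IsStableKernel s lam Lam K b) {φ : ℝ → ℝ≥0∞}
    (hφ : Measurable φ) :
    ∫⁻ y, φ ‖y‖ ∂(kernelMeasure K) = spectralMeasure K univ *
      ∫⁻ r in Ioi 0, φ r * ENNReal.ofReal (r ^ (-1 - 2 * s)) := by
  rw [lintegral_kernelMeasure_polar hK (by fun_prop)]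
  have : ∀ θ : Sph m, ∫⁻ r in Ioi 0, φ ‖r • (θ : Space m)‖ * ENNReal.ofReal (r ^ (-1 - 2 * s))
      = ∫⁻ r in Ioi 0, φ r * ENNReal.ofReal (r ^ (-1 - 2 * s)) := by
    intro θ
    refine setLIntegral_congr_fun measurableSet_Ioi fun r (hr : 0 < r) => ?_
    simp only [norm_smul, norm_eq_of_mem_sphere, Real.norm_eq_abs, abs_of_pos hr, mul_one]
  simp_rw [this]
  rw [lintegral_const, mul_comm]

lemma lintegral_rpow_Ioo {e ρ : ℝ} (he : -1 < e) (hρ : 0 < ρ) :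
    ∫⁻ r in Ioo 0 ρ, ENNReal.ofReal (r ^ e) = ENNReal.ofReal (ρ ^ (e + 1) / (e + 1)) := by
  have hi : IntegrableOn (fun r : ℝ => r ^ e) (Ioc 0 ρ) :=
    (intervalIntegral.intervalIntegrable_rpow' (a := 0) (b := ρ) he).1
  rw [Measure.restrict_congr_set Ioo_ae_eq_Ioc, ← ofReal_integral_eq_lintegral_ofReal hi,
    ← intervalIntegral.integral_of_le hρ.le, integral_rpow (Or.inl he),
    Real.zero_rpow (by linarith)]
  · simp
  · filter_upwards [ae_restrict_mem measurableSet_Ioc] with r hr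
    exact Real.rpow_nonneg hr.1.le _

lemma lintegral_rpow_Ici {e ρ : ℝ} (he : e < -1) (hρ : 0 < ρ) :
    ∫⁻ r in Ici ρ, ENNReal.ofReal (r ^ e) = ENNReal.ofReal (ρ ^ (e + 1) / (-(e + 1))) := by
  rw [Measure.restrict_congr_set Ioi_ae_eq_Ici.symm,
    ← ofReal_integral_eq_lintegral_ofReal (integrableOn_Ioi_rpow_of_lt he hρ),
    integral_Ioi_rpow_of_lt he hρ]
  · rw [neg_div, div_neg]
  · filter_upwards [ae_restrict_mem measurableSet_Ioi] with r (hr : ρ < r)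
    exact Real.rpow_nonneg (hρ.trans hr).le _

/-- A function bounded by different powers of `‖y‖` inside and outside a ball. -/
lemma lintegral_kernelMeasure_le (hK : IsStableKernel s lam Lam K b) {F : Space m → ℝ}
    {A₁ A₂ i a ρ : ℝ} (hρ : 0 < ρ) (hi : 2 * s < i) (ha : a < 2 * s)
    (hA₁ : 0 ≤ A₁) (hA₂ : 0 ≤ A₂)
    (h1 : ∀ y, ‖y‖ < ρ → |F y| ≤ A₁ * ‖y‖ ^ i) (h2 : ∀ y, ρ ≤ ‖y‖ → |F y| ≤ A₂ * ‖y‖ ^ a) :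
    ∫⁻ y, ENNReal.ofReal |F y| ∂(kernelMeasure K) ≤
      ENNReal.ofReal ((spectralMeasure K univ).toReal *
        (A₁ * (ρ ^ (i - 2 * s) / (i - 2 * s)) + A₂ * (ρ ^ (a - 2 * s) / (2 * s - a)))) := by
  set φ : ℝ → ℝ≥0∞ := fun r => ENNReal.ofReal (if r < ρ then A₁ * r ^ i else A₂ * r ^ a) with hφdef
  have hφ : Measurable φ := by
    refine Measurable.ennreal_ofReal (Measurable.ite measurableSet_Iio ?_ ?_) <;> fun_prop
  have hfin : spectralMeasure K univ ≠ ⊤ := by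
    have := hK.isFiniteMeasure_spectral
    exact measure_ne_top _ _
  calc ∫⁻ y, ENNReal.ofReal |F y| ∂(kernelMeasure K) ≤ ∫⁻ y, φ ‖y‖ ∂(kernelMeasure K) := by
        refine lintegral_mono fun y => ENNReal.ofReal_le_ofReal ?_
        split_ifs with h
        · exact h1 y h
        · exact h2 y (not_lt.1 h)
    _ = spectralMeasure K univ * ∫⁻ r in Ioi 0, φ r * ENNReal.ofReal (r ^ (-1 - 2 * s)) :=
        lintegral_kernelMeasure_radial hK hφ
    _ = _ := by
        rw [ENNReal.ofReal_mul ENNReal.toReal_nonneg, ENNReal.ofReal_toReal hfin]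
        congr 1
        rw [← Ioo_union_Ici_eq_Ioi hρ, lintegral_union measurableSet_Ici]
        · rw [ENNReal.ofReal_add]
          · congr 1
            · rw [ENNReal.ofReal_mul hA₁, show i - 2 * s = (i - 1 - 2 * s) + 1 by ring,
                ← lintegral_rpow_Ioo (by linarith) hρ, ← lintegral_const_mul _ (by fun_prop)]
              refine setLIntegral_congr_fun measurableSet_Ioo fun r hr => ?_
              simp only [φ, if_pos hr.2]
              rw [ENNReal.ofReal_mul hA₁, mul_assoc, ← ENNReal.ofReal_mul
                (Real.rpow_nonneg hr.1.le _), ← Real.rpow_add hr.1]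
              ring_nf
            · rw [ENNReal.ofReal_mul hA₂, show 2 * s - a = -((a - 1 - 2 * s) + 1) by ring,
                show a - 2 * s = (a - 1 - 2 * s) + 1 by ring,
                ← lintegral_rpow_Ici (by linarith) hρ, ← lintegral_const_mul _ (by fun_prop)]
              refine setLIntegral_congr_fun measurableSet_Ici fun r (hr : ρ ≤ r) => ?_
              have hr0 : 0 < r := hρ.trans_le hr
              simp only [φ, if_neg (not_lt.2 hr)]
              rw [ENNReal.ofReal_mul hA₂, mul_assoc, ← ENNReal.ofReal_mul
                (Real.rpow_nonneg hr0.le _), ← Real.rpow_add hr0]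
              ring_nf
          · have : 0 ≤ i - 2 * s := by linarith
            positivity
          · have : 0 ≤ 2 * s - a := by linarith
            positivity
        · rw [Set.disjoint_left]
          intro r hr hr2
          exact absurd hr.2 (not_lt.2 hr2)

lemma integrable_kernelMeasure_of_le (hK : IsStableKernel s lam Lam K b) {F : Space m → ℝ}
    (hF : AEStronglyMeasurable F (kernelMeasure K))
    {A₁ A₂ i a ρ : ℝ} (hρ : 0 < ρ) (hi : 2 * s < i) (ha : a < 2 * s)
    (hA₁ : 0 ≤ A₁) (hA₂ : 0 ≤ A₂)
    (h1 : ∀ y, ‖y‖ < ρ → |F y| ≤ A₁ * ‖y‖ ^ i) (h2 : ∀ y, ρ ≤ ‖y‖ → |F y| ≤ A₂ * ‖y‖ ^ a) :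
    Integrable F (kernelMeasure K) := by
  refine ⟨hF, ?_⟩
  rw [hasFiniteIntegral_iff_norm]
  exact (lintegral_kernelMeasure_le hK hρ hi ha hA₁ hA₂ h1 h2).trans_lt ENNReal.ofReal_lt_top

end

/-! ### Beta integrals and integration by parts against a power -/

section

open ProbabilityTheory (beta beta_pos)

section BetaIntegrals

/-- Both claims are read off from the fact that the Beta density has total mass one. -/
lemma integrableOn_and_integral_beta {α β : ℝ} (hα : 0 < α) (hβ : 0 < β) :
    IntegrableOn (fun x : ℝ => x ^ (α - 1) * (1 - x) ^ (β - 1)) (Ioo 0 1) ∧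
    ∫ x in Ioo (0 : ℝ) 1, x ^ (α - 1) * (1 - x) ^ (β - 1) = beta α β := by
  have hB := beta_pos hα hβ
  have h1 := ProbabilityTheory.lintegral_betaPDF_eq_one hα hβ
  rw [ProbabilityTheory.lintegral_betaPDF] at h1
  have hnn : 0 ≤ᵐ[volume.restrict (Ioo (0 : ℝ) 1)]
      fun x : ℝ => 1 / beta α β * x ^ (α - 1) * (1 - x) ^ (β - 1) := by
    refine ae_restrict_of_forall_mem measurableSet_Ioo fun x hx => ?_
    have h0 : 0 < x := hx.1
    have h1 : 0 < 1 - x := by linarith [hx.2]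
    simp only [Pi.zero_apply]
    positivity
  have hmeas : AEStronglyMeasurable
      (fun x : ℝ => 1 / beta α β * x ^ (α - 1) * (1 - x) ^ (β - 1))
      (volume.restrict (Ioo (0 : ℝ) 1)) := by fun_prop
  have hint : Integrable (fun x : ℝ => 1 / beta α β * x ^ (α - 1) * (1 - x) ^ (β - 1))
      (volume.restrict (Ioo (0 : ℝ) 1)) := by
    refine ⟨hmeas, ?_⟩
    rw [hasFiniteIntegral_iff_ofReal hnn, h1]
    exact ENNReal.one_lt_top
  have hval := integral_eq_lintegral_of_nonneg_ae hnn hmeas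
  rw [h1] at hval
  constructor
  · refine (hint.const_mul (beta α β)).congr (Eventually.of_forall fun x => ?_)
    simp only
    field_simp
  · have : ∀ x : ℝ, x ^ (α - 1) * (1 - x) ^ (β - 1)
        = beta α β * (1 / beta α β * x ^ (α - 1) * (1 - x) ^ (β - 1)) := by
      intro x; field_simp
    simp_rw [this]
    rw [integral_const_mul, hval]
    simp

/-- Substitution t = x / (1 - x) in the Beta integral over (0, 1). -/
lemma integrableOn_and_integral_beta_second {α β : ℝ} (hα : 0 < α) (hβ : 0 < β) :
    IntegrableOn (fun t : ℝ => t ^ (α - 1) * (1 + t) ^ (-α - β)) (Ioi 0) ∧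
    ∫ t in Ioi (0 : ℝ), t ^ (α - 1) * (1 + t) ^ (-α - β) = beta α β := by
  obtain ⟨h1, h2⟩ := integrableOn_and_integral_beta hα hβ
  set φ : ℝ → ℝ := fun x => x / (1 - x) with hφ
  have himg : φ '' Ioo 0 1 = Ioi 0 := by
    ext t
    constructor
    · rintro ⟨x, hx, rfl⟩
      exact div_pos hx.1 (by linarith [hx.2])
    · intro ht
      have ht' : 0 < t := ht
      refine ⟨t / (1 + t), ⟨by positivity, ?_⟩, ?_⟩
      · rw [div_lt_one (by linarith)]; linarith
      · simp only [hφ]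
        field_simp
        ring
  have hder : ∀ x ∈ Ioo (0 : ℝ) 1, HasDerivWithinAt φ (1 / (1 - x) ^ 2) (Ioo 0 1) x := by
    intro x hx
    have hne : 1 - x ≠ 0 := by linarith [hx.2]
    have := ((hasDerivAt_id x).div ((hasDerivAt_id x).const_sub 1) hne).hasDerivWithinAt
      (s := Ioo 0 1)
    convert! this using 1
    simp
  have hinj : InjOn φ (Ioo 0 1) := by
    intro x hx y hy hxy
    have h1 : 1 - x ≠ 0 := by linarith [hx.2]
    have h2 : 1 - y ≠ 0 := by linarith [hy.2]
    simp only [hφ] at hxy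
    rw [div_eq_div_iff h1 h2] at hxy
    linarith
  have hcongr : ∀ x ∈ Ioo (0 : ℝ) 1,
      |1 / (1 - x) ^ 2| • (φ x ^ (α - 1) * (1 + φ x) ^ (-α - β))
        = x ^ (α - 1) * (1 - x) ^ (β - 1) := by
    intro x hx
    have h0 : 0 < x := hx.1
    have h1 : 0 < 1 - x := by linarith [hx.2]
    have e1 : 1 + φ x = (1 - x)⁻¹ := by simp only [hφ]; field_simp; ring
    rw [e1, abs_of_pos (by positivity), smul_eq_mul]
    simp only [hφ]
    rw [Real.div_rpow h0.le h1.le, Real.inv_rpow h1.le, ← Real.rpow_neg h1.le,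
      ← Real.rpow_natCast, one_div, ← Real.rpow_neg h1.le, div_eq_mul_inv,
      ← Real.rpow_neg h1.le]
    rw [show (1 - x) ^ (-((2 : ℕ) : ℝ)) * (x ^ (α - 1) * (1 - x) ^ (-(α - 1)) *
      (1 - x) ^ (-(-α - β))) = x ^ (α - 1) * ((1 - x) ^ (-((2 : ℕ) : ℝ)) * (1 - x) ^ (-(α - 1)) *
      (1 - x) ^ (-(-α - β))) by ring, ← Real.rpow_add h1, ← Real.rpow_add h1]
    congr 2
    push_cast
    ring
  rw [← himg]
  constructor
  · rw [integrableOn_image_iff_integrableOn_abs_deriv_smul measurableSet_Ioo hder hinj]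
    exact h1.congr_fun (fun x hx => (hcongr x hx).symm) measurableSet_Ioo
  · rw [integral_image_eq_integral_abs_deriv_smul measurableSet_Ioo hder hinj, ← h2]
    exact setIntegral_congr_fun measurableSet_Ioo hcongr

/-- Integration by parts against a power on the half line. -/
lemma integral_primitive_mul_rpow {s : ℝ} (hs : 0 < s) {h g : ℝ → ℝ}
    (hint : IntegrableOn (fun r => h r * r ^ (-2 * s)) (Ioi 0))
    (hg : ∀ t, 0 < t → g t = ∫ r in Ioc 0 t, h r) :
    IntegrableOn (fun t => g t * t ^ (-1 - 2 * s)) (Ioi 0) ∧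
    ∫ t in Ioi 0, g t * t ^ (-1 - 2 * s) = 1 / (2 * s) * ∫ r in Ioi 0, h r * r ^ (-2 * s) := by
  set μ : Measure ℝ := volume.restrict (Ioi 0) with hμ
  -- Fubini for h(r) t^(-1-2s) on the triangle 0 < r ≤ t. Integrating in t first leaves h(r) r^(-2s)
  -- / (2s), so no boundary terms need to be controlled.
  set f : ℝ × ℝ → ℝ := fun p => {q : ℝ × ℝ | q.1 ≤ q.2}.indicator
    (fun q => h q.1 * q.2 ^ (-1 - 2 * s)) p with hf
  -- Measurability of h is recovered from that of h r^(-2s) by multiplying back with r^(2s).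
  have hhmeas : AEStronglyMeasurable h μ := by
    have h1 : AEStronglyMeasurable (fun r : ℝ => (h r * r ^ (-2 * s)) * r ^ (2 * s)) μ :=
      hint.aestronglyMeasurable.mul (by fun_prop)
    refine h1.congr ?_
    filter_upwards [ae_restrict_mem measurableSet_Ioi] with r (hr : 0 < r)
    rw [mul_assoc, ← Real.rpow_add hr]
    simp
  have hfm : AEStronglyMeasurable f (μ.prod μ) := by
    refine AEStronglyMeasurable.indicator ?_ (measurableSet_le measurable_fst measurable_snd)
    exact hhmeas.comp_fst.mul (measurable_snd.pow_const _).aestronglyMeasurable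
  have hsec : ∀ r t, f (r, t) = (Ici r).indicator (fun t => h r * t ^ (-1 - 2 * s)) t := by
    intro r t
    simp only [hf, indicator, mem_ofPred_eq, mem_Ici]
  have hrest : ∀ r : ℝ, 0 < r → (μ.restrict (Ici r)) = volume.restrict (Ici r) := by
    intro r hr
    rw [hμ, Measure.restrict_restrict measurableSet_Ici, inter_eq_self_of_subset_left]
    intro x hx; exact lt_of_lt_of_le hr hx
  have hpow : ∀ r : ℝ, 0 < r → IntegrableOn (fun t : ℝ => t ^ (-1 - 2 * s)) (Ici r) volume := by
    intro r hr
    rw [integrableOn_Ici_iff_integrableOn_Ioi]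
    exact integrableOn_Ioi_rpow_of_lt (by linarith) hr
  have hpowval : ∀ r : ℝ, 0 < r → ∫ t in Ici r, (t : ℝ) ^ (-1 - 2 * s) = r ^ (-2 * s) / (2 * s) := by
    intro r hr
    rw [integral_Ici_eq_integral_Ioi, integral_Ioi_rpow_of_lt (by linarith) hr]
    rw [show -1 - 2 * s + 1 = -(2 * s) by ring, neg_div_neg_eq, show -(2 * s) = -2 * s by ring]
  have hfi : Integrable f (μ.prod μ) := by
    rw [integrable_prod_iff hfm]
    constructor
    · filter_upwards [ae_restrict_mem measurableSet_Ioi] with r (hr : 0 < r)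
      simp_rw [hsec]
      rw [integrable_indicator_iff measurableSet_Ici, IntegrableOn, hrest r hr]
      exact (hpow r hr).const_mul _
    · refine ((hint.norm).const_mul (1 / (2 * s))).congr ?_
      filter_upwards [ae_restrict_mem measurableSet_Ioi] with r (hr : 0 < r)
      simp_rw [hsec, norm_indicator_eq_indicator_norm]
      rw [integral_indicator measurableSet_Ici, hrest r hr]
      have : ∫ t in Ici r, ‖h r * t ^ (-1 - 2 * s)‖ = ∫ t in Ici r, ‖h r‖ * t ^ (-1 - 2 * s) := by
        refine setIntegral_congr_fun measurableSet_Ici fun t (ht : r ≤ t) => ?_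
        simp only [norm_mul]
        rw [Real.norm_of_nonneg (r := t ^ (-1 - 2 * s))
          (Real.rpow_nonneg (hr.le.trans ht) _)]
      rw [this, integral_const_mul, hpowval r hr, norm_mul,
        Real.norm_of_nonneg (r := r ^ (-2 * s)) (Real.rpow_nonneg hr.le _)]
      ring
  have hgsec : ∀ t, 0 < t → ∫ r, f (r, t) ∂μ = g t * t ^ (-1 - 2 * s) := by
    intro t ht
    have : ∀ r, f (r, t) = (Iic t).indicator (fun r => h r * t ^ (-1 - 2 * s)) r := by
      intro r
      simp only [hf, indicator, mem_ofPred_eq, mem_Iic]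
    simp_rw [this]
    rw [integral_indicator measurableSet_Iic, integral_mul_const, hμ,
      Measure.restrict_restrict measurableSet_Iic, hg t ht, inter_comm, Ioi_inter_Iic]
  constructor
  · refine hfi.integral_prod_right.congr ?_
    filter_upwards [ae_restrict_mem measurableSet_Ioi] with t (ht : 0 < t)
    exact hgsec t ht
  · rw [← setIntegral_congr_fun measurableSet_Ioi fun t ht => hgsec t ht,
      ← integral_integral_swap (f := fun r t => f (r, t)) hfi, ← integral_const_mul]
    refine setIntegral_congr_fun measurableSet_Ioi fun r (hr : 0 < r) => ?_
    simp_rw [hsec]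
    rw [integral_indicator measurableSet_Ici, hrest r hr, integral_const_mul, hpowval r hr]
    ring

end BetaIntegrals

end

/-! ### Hypersingular integrals of (1 + t)^β and (1 - t)_+^β on the half line -/

section

open ProbabilityTheory (beta beta_pos)

section HalfLineIntegrals

/-- The truncated power `(1 - t)_+^μ`, vanishing for `t ≥ 1` for every exponent. -/
def truncPow (μ t : ℝ) : ℝ := if t < 1 then (1 - t) ^ μ else 0

lemma truncPow_eq_max {μ : ℝ} (hμ : 0 < μ) (t : ℝ) : truncPow μ t = max (1 - t) 0 ^ μ := by
  unfold truncPow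
  split_ifs with h
  · rw [max_eq_left (by linarith)]
  · rw [max_eq_right (by linarith), Real.zero_rpow hμ.ne']

lemma integral_one_add_rpow {μ t : ℝ} (ht : 0 < t) :
    ∫ r in Ioc 0 t, μ * (1 + r) ^ (μ - 1) = (1 + t) ^ μ - 1 := by
  rw [← intervalIntegral.integral_of_le ht.le,
    intervalIntegral.integral_eq_sub_of_hasDerivAt (f := fun r : ℝ => (1 + r) ^ μ)]
  · simp
  · intro x hx
    rw [uIcc_of_le ht.le] at hx
    have hx0 : 0 < 1 + x := by linarith [hx.1]
    have := ((hasDerivAt_id x).const_add 1).rpow_const (p := μ) (Or.inl hx0.ne')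
    simpa using this
  · apply ContinuousOn.intervalIntegrable
    intro x hx
    rw [uIcc_of_le ht.le] at hx
    have hx0 : 0 < 1 + x := by linarith [hx.1]
    exact (ContinuousAt.const_mul (ContinuousAt.rpow_const (by fun_prop)
      (Or.inl hx0.ne')) _).continuousWithinAt

lemma intervalIntegrable_one_sub_rpow {μ t : ℝ} (hμ : 0 < μ) :
    IntervalIntegrable (fun r : ℝ => (1 - r) ^ (μ - 1)) volume 0 t := by
  have := (intervalIntegral.intervalIntegrable_rpow' (a := 1) (b := 1 - t) (r := μ - 1)
    (by linarith)).comp_sub_left (c := 1)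
  simpa using this

lemma integral_truncPow_sub_one {μ t : ℝ} (hμ : 0 < μ) (ht : 0 < t) :
    ∫ r in Ioc 0 t, μ * truncPow (μ - 1) r = 1 - truncPow μ t := by
  have key : ∀ u, 0 < u → u ≤ 1 →
      ∫ r in Ioc 0 u, μ * truncPow (μ - 1) r = 1 - truncPow μ u := by
    intro u hu hu1
    have e1 : ∫ r in Ioc 0 u, μ * truncPow (μ - 1) r = ∫ r in Ioc 0 u, μ * (1 - r) ^ (μ - 1) := by
      rw [integral_Ioc_eq_integral_Ioo, integral_Ioc_eq_integral_Ioo]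
      refine setIntegral_congr_fun measurableSet_Ioo fun r hr => ?_
      simp only [truncPow, if_pos (hr.2.trans_le hu1)]
    rw [e1, ← intervalIntegral.integral_of_le hu.le,
      intervalIntegral.integral_eq_sub_of_hasDerivAt_of_le (f := fun r : ℝ => -(1 - r) ^ μ) hu.le]
    · rw [truncPow_eq_max hμ, max_eq_left (by linarith)]
      simp; ring
    · refine Continuous.continuousOn ?_
      exact (Continuous.rpow_const (by fun_prop) (fun _ => Or.inr hμ.le)).neg
    · intro x hx
      have hx0 : 1 - x ≠ 0 := by linarith [hx.2]
      have := (((hasDerivAt_id x).const_sub 1).rpow_const (p := μ) (Or.inl hx0)).neg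
      convert! this using 1
      simp
    · exact (intervalIntegrable_one_sub_rpow hμ).const_mul _
  rcases le_or_gt t 1 with h | h
  · exact key t ht h
  · have h1 := key 1 one_pos le_rfl
    have : truncPow μ t = truncPow μ 1 := by simp [truncPow, not_lt.2 h.le]
    rw [this, ← h1]
    refine setIntegral_eq_of_subset_of_forall_sdiff_eq_zero measurableSet_Ioc
      (Ioc_subset_Ioc_right h.le) ?_
    intro x hx
    have : ¬ x < 1 := fun hlt => hx.2 ⟨hx.1.1, hlt.le⟩
    simp [truncPow, this]

/-- Integration by parts replaces 1 - (1 + t)^μ by its derivative against t^(-2σ), which is a Beta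
integral of the second kind. It converges at 0 because 2σ < 1 and at infinity because μ < 2σ. -/
lemma one_add_rpow_radial {σ μ : ℝ} (hσ : 0 < σ) (hσ1 : 2 * σ < 1) (hμ : μ < 2 * σ) :
    IntegrableOn (fun t : ℝ => (1 - (1 + t) ^ μ) * t ^ (-1 - 2 * σ)) (Ioi 0) ∧
    ∫ t in Ioi (0 : ℝ), (1 - (1 + t) ^ μ) * t ^ (-1 - 2 * σ)
      = -(μ / (2 * σ)) * beta (1 - 2 * σ) (2 * σ - μ) := by
  obtain ⟨h1, h2⟩ := integrableOn_and_integral_beta_second (α := 1 - 2 * σ) (β := 2 * σ - μ)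
    (by linarith) (by linarith)
  have e : ∀ r : ℝ, -(μ * (1 + r) ^ (μ - 1)) * r ^ (-2 * σ)
      = -μ * (r ^ (1 - 2 * σ - 1) * (1 + r) ^ (-(1 - 2 * σ) - (2 * σ - μ))) := by
    intro r
    rw [show 1 - 2 * σ - 1 = -2 * σ by ring, show -(1 - 2 * σ) - (2 * σ - μ) = μ - 1 by ring]
    ring
  have := integral_primitive_mul_rpow hσ (h := fun r => -(μ * (1 + r) ^ (μ - 1)))
    (g := fun t => 1 - (1 + t) ^ μ)
    (by simp_rw [e]; exact h1.const_mul _)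
    (fun t ht => by rw [integral_neg, integral_one_add_rpow ht]; ring)
  refine ⟨this.1, ?_⟩
  rw [this.2]
  simp_rw [e]
  rw [integral_const_mul, h2]
  ring

lemma truncPow_beta {α μ : ℝ} (hα : 0 < α) (hμ : 0 < μ) :
    IntegrableOn (fun t : ℝ => truncPow (μ - 1) t * t ^ (α - 1)) (Ioi 0) ∧
    ∫ t in Ioi (0 : ℝ), truncPow (μ - 1) t * t ^ (α - 1) = beta α μ := by
  obtain ⟨h1, h2⟩ := integrableOn_and_integral_beta hα hμ
  have e : ∀ r : ℝ, (Iio 1).indicator (fun r : ℝ => r ^ (α - 1) * (1 - r) ^ (μ - 1)) r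
      = truncPow (μ - 1) r * r ^ (α - 1) := by
    intro r
    by_cases h : r < 1
    · simp [truncPow, h, indicator, mul_comm]
    · simp [truncPow, h, indicator]
  have hi : Iio (1 : ℝ) ∩ Ioi 0 = Ioo 0 1 := by rw [inter_comm, Ioi_inter_Iio]
  simp_rw [← e]
  constructor
  · rw [IntegrableOn, integrable_indicator_iff measurableSet_Iio, IntegrableOn,
      Measure.restrict_restrict measurableSet_Iio, hi]
    exact h1
  · rw [integral_indicator measurableSet_Iio, Measure.restrict_restrict measurableSet_Iio, hi, h2]

lemma truncPow_radial_of_pos {σ μ : ℝ} (hσ : 0 < σ) (hσ1 : 2 * σ < 1) (hμ : 0 < μ) :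
    IntegrableOn (fun t : ℝ => (1 - truncPow μ t) * t ^ (-1 - 2 * σ)) (Ioi 0) ∧
    ∫ t in Ioi (0 : ℝ), (1 - truncPow μ t) * t ^ (-1 - 2 * σ)
      = μ / (2 * σ) * beta (1 - 2 * σ) μ := by
  obtain ⟨h1, h2⟩ := truncPow_beta (α := 1 - 2 * σ) (by linarith) hμ
  have e : ∀ r : ℝ, μ * truncPow (μ - 1) r * r ^ (-2 * σ)
      = μ * (truncPow (μ - 1) r * r ^ (1 - 2 * σ - 1)) := by
    intro r
    rw [show 1 - 2 * σ - 1 = -2 * σ by ring]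
    ring
  have := integral_primitive_mul_rpow hσ (h := fun r => μ * truncPow (μ - 1) r)
    (g := fun t => 1 - truncPow μ t)
    (by simp_rw [e]; exact h1.const_mul _)
    (fun t ht => (integral_truncPow_sub_one hμ ht).symm)
  refine ⟨this.1, ?_⟩
  rw [this.2]
  simp_rw [e]
  rw [integral_const_mul, h2]
  ring

/-- For -1 < μ ≤ 0 the function is unbounded or jumps at t = 1, so the version for positive
exponents does not apply. The relation (1-t)^μ = (1-t)^(μ+1) + t (1-t)^μ reduces to the exponent μ +
1 and one Beta integral. The range is needed for μ = β - 1 when s > 1/2. -/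
lemma truncPow_radial {σ μ : ℝ} (hσ : 0 < σ) (hσ1 : 2 * σ < 1) (hμ : -1 < μ) :
    IntegrableOn (fun t : ℝ => (1 - truncPow μ t) * t ^ (-1 - 2 * σ)) (Ioi 0) ∧
    ∫ t in Ioi (0 : ℝ), (1 - truncPow μ t) * t ^ (-1 - 2 * σ)
      = (μ + 1 - 2 * σ) / (2 * σ) * beta (1 - 2 * σ) (μ + 1) := by
  obtain ⟨h1, h2⟩ := truncPow_radial_of_pos hσ hσ1 (μ := μ + 1) (by linarith)
  obtain ⟨h3, h4⟩ := truncPow_beta (α := 1 - 2 * σ) (μ := μ + 1) (by linarith) (by linarith)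
  have e : ∀ t ∈ Ioi (0 : ℝ), (1 - truncPow (μ + 1) t) * t ^ (-1 - 2 * σ)
      - truncPow (μ + 1 - 1) t * t ^ (1 - 2 * σ - 1) = (1 - truncPow μ t) * t ^ (-1 - 2 * σ) := by
    intro t (ht : 0 < t)
    have : t ^ (1 - 2 * σ - 1) = t * t ^ (-1 - 2 * σ) := by
      rw [← Real.rpow_one_add' ht.le (by linarith)]; ring_nf
    rw [this, add_sub_cancel_right]
    by_cases h : t < 1
    · simp only [truncPow, if_pos h]
      rw [Real.rpow_add_one (by linarith)]
      ring
    · simp [truncPow, h]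
  constructor
  · exact (h1.sub h3).congr_fun e measurableSet_Ioi
  · rw [← setIntegral_congr_fun measurableSet_Ioi e, integral_sub h1 h3, h2, h4]
    field_simp

/-- One integration by parts lowers the order 2s to 2s - 1 and the exponent β to β - 1. The linear
correction becomes the constant that the lower-order formula needs. -/
lemma one_add_rpow_radial_taylor {s β : ℝ} (hs : 1 / 2 < s) (hs1 : s < 1) (hβ : β < 2 * s) :
    IntegrableOn (fun t : ℝ => (1 - (1 + t) ^ β + β * t) * t ^ (-1 - 2 * s)) (Ioi 0) ∧
    ∫ t in Ioi (0 : ℝ), (1 - (1 + t) ^ β + β * t) * t ^ (-1 - 2 * s)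
      = β / (2 * s) * (-((β - 1) / (2 * s - 1)) * beta (2 - 2 * s) (2 * s - β)) := by
  obtain ⟨h1, h2⟩ := one_add_rpow_radial (σ := s - 1 / 2) (μ := β - 1) (by linarith) (by linarith)
    (by linarith)
  have e : ∀ r : ℝ, (-(β * (1 + r) ^ (β - 1)) + β) * r ^ (-2 * s)
      = β * ((1 - (1 + r) ^ (β - 1)) * r ^ (-1 - 2 * (s - 1 / 2))) := by
    intro r
    rw [show -1 - 2 * (s - 1 / 2) = -2 * s by ring]
    ring
  have := integral_primitive_mul_rpow (s := s) (by linarith)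
    (h := fun r => -(β * (1 + r) ^ (β - 1)) + β)
    (g := fun t => 1 - (1 + t) ^ β + β * t)
    (by simp_rw [e]; exact h1.const_mul _)
    (fun t ht => by
      rw [integral_add, integral_neg, integral_one_add_rpow ht]
      · simp [ht.le]; ring
      · have : IntervalIntegrable (fun r : ℝ => -(β * (1 + r) ^ (β - 1))) volume 0 t := by
          apply ContinuousOn.intervalIntegrable
          intro x hx
          rw [uIcc_of_le ht.le] at hx
          have hx0 : 0 < 1 + x := by linarith [hx.1]
          exact (ContinuousAt.const_mul (ContinuousAt.rpow_const (by fun_prop)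
            (Or.inl hx0.ne')) _).neg.continuousWithinAt
        exact this.1
      · exact integrable_const _)
  refine ⟨this.1, ?_⟩
  rw [this.2]
  simp_rw [e]
  rw [integral_const_mul, h2]
  rw [show 1 - 2 * (s - 1 / 2) = 2 - 2 * s by ring, show 2 * (s - 1 / 2) = 2 * s - 1 by ring,
    show 2 * s - 1 - (β - 1) = 2 * s - β by ring]
  ring

lemma truncPow_radial_taylor {s β : ℝ} (hs : 1 / 2 < s) (hs1 : s < 1) (hβ : 0 < β) :
    IntegrableOn (fun t : ℝ => (1 - truncPow β t - β * t) * t ^ (-1 - 2 * s)) (Ioi 0) ∧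
    ∫ t in Ioi (0 : ℝ), (1 - truncPow β t - β * t) * t ^ (-1 - 2 * s)
      = -(β / (2 * s)) * ((β + 1 - 2 * s) / (2 * s - 1) * beta (2 - 2 * s) β) := by
  obtain ⟨h1, h2⟩ := truncPow_radial (σ := s - 1 / 2) (μ := β - 1) (by linarith) (by linarith)
    (by linarith)
  have e : ∀ r : ℝ, (β * truncPow (β - 1) r - β) * r ^ (-2 * s)
      = -β * ((1 - truncPow (β - 1) r) * r ^ (-1 - 2 * (s - 1 / 2))) := by
    intro r
    rw [show -1 - 2 * (s - 1 / 2) = -2 * s by ring]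
    ring
  have := integral_primitive_mul_rpow (s := s) (by linarith)
    (h := fun r => β * truncPow (β - 1) r - β)
    (g := fun t => 1 - truncPow β t - β * t)
    (by simp_rw [e]; exact h1.const_mul _)
    (fun t ht => by
      rw [integral_sub, integral_truncPow_sub_one hβ ht]
      · simp [ht.le]; ring
      · have h := (truncPow_beta (α := 1) one_pos hβ).1
        simp only [sub_self, Real.rpow_zero, mul_one] at h
        exact (h.mono_set Ioc_subset_Ioi_self).const_mul _
      · exact integrable_const _)
  refine ⟨this.1, ?_⟩
  rw [this.2]
  simp_rw [e]
  rw [integral_const_mul, h2]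
  rw [show 1 - 2 * (s - 1 / 2) = 2 - 2 * s by ring, show 2 * (s - 1 / 2) = 2 * s - 1 by ring,
    show β - 1 + 1 - (2 * s - 1) = β + 1 - 2 * s by ring, sub_add_cancel]
  ring

end HalfLineIntegrals

end

/-! ### Cancellation of the one-dimensional constants -/

section

open ProbabilityTheory (beta beta_pos)

section PowerTaylor

/-- The mean value inequality is applied twice, with the second derivative bounded on [-1/2, 1/2].
-/
lemma exists_one_add_rpow_taylor (β : ℝ) :
    ∃ C, 0 ≤ C ∧ ∀ z : ℝ, |z| ≤ 1 / 2 → |1 + β * z - (1 + z) ^ β| ≤ C * z ^ 2 := by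
  have hc : ContinuousOn (fun z : ℝ => β * (β - 1) * (1 + z) ^ (β - 1 - 1)) (Icc (-1 / 2) (1 / 2)) := by
    intro z hz
    have : 1 + z ≠ 0 := by linarith [hz.1]
    exact (ContinuousAt.const_mul (ContinuousAt.rpow_const (by fun_prop)
            (Or.inl this)) _).continuousWithinAt
  obtain ⟨C, hC⟩ := isCompact_Icc.exists_bound_of_continuousOn hc
  have hC0 : 0 ≤ C := (norm_nonneg _).trans (hC 0 (by constructor <;> norm_num))
  refine ⟨C, hC0, fun z hz => ?_⟩
  have hz' := abs_le.1 hz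
  have h1 : ∀ w ∈ Icc (-1 / 2 : ℝ) (1 / 2), |β * (1 + w) ^ (β - 1) - β| ≤ C * |w| := by
    intro w hw
    have := Convex.norm_image_sub_le_of_norm_hasDerivWithin_le
      (f := fun z : ℝ => β * (1 + z) ^ (β - 1)) (s := Icc (-1 / 2 : ℝ) (1 / 2))
      (f' := fun z : ℝ => β * (β - 1) * (1 + z) ^ (β - 1 - 1)) (C := C) (x := 0) (y := w) ?_ hC
      (convex_Icc _ _) (by constructor <;> norm_num) hw
    · simpa using this
    · intro x hx
      have : 1 + x ≠ 0 := by linarith [hx.1]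
      have := (((hasDerivAt_id x).const_add 1).rpow_const (p := β - 1) (Or.inl this)).const_mul β
      convert! this.hasDerivWithinAt using 1
      simp; ring
  have hsub : Icc (-|z|) |z| ⊆ Icc (-1 / 2 : ℝ) (1 / 2) :=
    Icc_subset_Icc (by linarith) hz
  have := Convex.norm_image_sub_le_of_norm_hasDerivWithin_le
      (f := fun z : ℝ => (1 + z) ^ β - β * z) (s := Icc (-|z|) |z|)
      (f' := fun z : ℝ => β * (1 + z) ^ (β - 1) - β) (C := C * |z|) (x := 0) (y := z) ?_ ?_
      (convex_Icc _ _) (by simp) (abs_le.1 le_rfl)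
  · simp only [sub_zero, Real.norm_eq_abs, add_zero, Real.one_rpow, mul_zero] at this
    rw [mul_assoc, ← abs_mul, ← sq, abs_of_nonneg (sq_nonneg z)] at this
    rw [abs_sub_comm]
    convert! this using 2
    ring
  · intro x hx
    have hne : 1 + x ≠ 0 := by linarith [(hsub hx).1]
    have := (((hasDerivAt_id x).const_add 1).rpow_const (p := β) (Or.inl hne)).sub
      ((hasDerivAt_id x).const_mul β)
    convert! this.hasDerivWithinAt using 1
    simp
  · intro x hx
    exact (h1 x (hsub hx)).trans (mul_le_mul_of_nonneg_left (abs_le.2 hx) hC0)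

end PowerTaylor

section KernelConstants

lemma integrableOn_mul_rpow_of_le {s : ℝ} {F : ℝ → ℝ} (hF : Measurable F)
    {A₁ A₂ i a ρ : ℝ} (hρ : 0 < ρ) (hi : 2 * s < i) (ha : a < 2 * s)
    (h1 : ∀ t, 0 < t → t ≤ ρ → |F t| ≤ A₁ * t ^ i) (h2 : ∀ t, ρ < t → |F t| ≤ A₂ * t ^ a) :
    IntegrableOn (fun t => F t * t ^ (-1 - 2 * s)) (Ioi 0) := by
  have hm : Measurable fun t : ℝ => F t * t ^ (-1 - 2 * s) := hF.mul (measurable_id.pow_const _)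
  rw [← Ioc_union_Ioi_eq_Ioi hρ.le]
  refine IntegrableOn.union ?_ ?_
  · have hi' : IntegrableOn (fun r : ℝ => A₁ * r ^ (i - 1 - 2 * s)) (Ioc 0 ρ) :=
      ((intervalIntegral.intervalIntegrable_rpow' (a := 0) (b := ρ) (by linarith)).1).const_mul _
    refine hi'.mono' hm.aestronglyMeasurable ?_
    refine ae_restrict_of_forall_mem measurableSet_Ioc fun t ht => ?_
    rw [norm_mul, Real.norm_of_nonneg (Real.rpow_nonneg ht.1.le _), Real.norm_eq_abs,
      show i - 1 - 2 * s = i + (-1 - 2 * s) by ring, Real.rpow_add ht.1, ← mul_assoc]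
    exact mul_le_mul_of_nonneg_right (h1 t ht.1 ht.2) (Real.rpow_nonneg ht.1.le _)
  · have hi' : IntegrableOn (fun r : ℝ => A₂ * r ^ (a - 1 - 2 * s)) (Ioi ρ) :=
      (integrableOn_Ioi_rpow_of_lt (by linarith) hρ).const_mul _
    refine hi'.mono' hm.aestronglyMeasurable ?_
    refine ae_restrict_of_forall_mem measurableSet_Ioi fun t (ht : ρ < t) => ?_
    have ht0 : 0 < t := hρ.trans ht
    rw [norm_mul, Real.norm_of_nonneg (Real.rpow_nonneg ht0.le _), Real.norm_eq_abs,
      show a - 1 - 2 * s = a + (-1 - 2 * s) by ring, Real.rpow_add ht0, ← mul_assoc]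
    exact mul_le_mul_of_nonneg_right (h2 t ht) (Real.rpow_nonneg ht0.le _)

lemma one_div_Gamma_one_sub {z : ℝ} (hz0 : 0 < z) (hz1 : z < 1) :
    1 / Real.Gamma (1 - z) = Real.Gamma z * Real.sin (Real.pi * z) / Real.pi := by
  have h := Real.Gamma_mul_Gamma_one_sub z
  have hs : 0 < Real.sin (Real.pi * z) :=
    Real.sin_pos_of_pos_of_lt_pi (by positivity) (by nlinarith [Real.pi_pos])
  have hG : 0 < Real.Gamma (1 - z) := Real.Gamma_pos_of_pos (by linarith)
  have hpi := Real.pi_pos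
  rw [eq_div_iff hs.ne'] at h
  rw [div_eq_div_iff hG.ne' hpi.ne']
  linarith

/-- A form of the reflection formula that stays valid through the pole of Γ(1 - z) at z = 1, where
both sides vanish. For s > 1/2 the exponents can reach or pass 1, so this is the form needed there.
-/
lemma one_sub_div_Gamma_two_sub {z : ℝ} (hz0 : 0 < z) (hz1 : z < 2) :
    (1 - z) / Real.Gamma (2 - z) = Real.Gamma z * Real.sin (Real.pi * z) / Real.pi := by
  have hpi := Real.pi_pos
  by_cases h1 : z = 1
  · subst h1; simp
  have hz : 1 - z ≠ 0 := sub_ne_zero.2 (Ne.symm h1)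
  have h := Real.Gamma_mul_Gamma_one_sub z
  have hG2 : Real.Gamma (2 - z) = (1 - z) * Real.Gamma (1 - z) := by
    rw [← Real.Gamma_add_one hz]; ring_nf
  have hG : 0 < Real.Gamma (2 - z) := Real.Gamma_pos_of_pos (by linarith)
  have hG' : Real.Gamma (1 - z) ≠ 0 := by
    intro h0; rw [h0, mul_zero] at hG2; exact hG.ne' hG2
  have hs : Real.sin (Real.pi * z) ≠ 0 := by
    intro h0
    rw [h0, div_zero] at h
    exact (mul_ne_zero (Real.Gamma_pos_of_pos hz0).ne' hG') h
  rw [eq_div_iff hs] at h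
  rw [hG2, div_eq_div_iff (mul_ne_zero hz hG') hpi.ne']
  linear_combination (-(1 - z)) * h

/-- The reflection formula turns 1/Γ(1-β) and 1/Γ(1-(2s-β)) into sines. Up to sign and these sines,
the two ray integrals then have the same factor Γ(1-2s) Γ(β) Γ(2s-β), so the assumed sine relation
is exactly what balances them. -/
lemma power_constants_cancel_of_lt {s β kp km : ℝ} (hs1 : s < 1 / 2) (hβ : 0 < β)
    (hβs : β < 2 * s) (hk : kp * Real.sin (Real.pi * β) = km * Real.sin (Real.pi * (2 * s - β))) :
    kp * ∫ t in Ioi (0 : ℝ), (1 - (1 + t) ^ β) * t ^ (-1 - 2 * s) =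
      -(km * ∫ t in Ioi (0 : ℝ), (1 - truncPow β t) * t ^ (-1 - 2 * s)) := by
  rw [(one_add_rpow_radial (by linarith) (by linarith) hβs).2,
    (truncPow_radial_of_pos (by linarith) (by linarith) hβ).2, beta, beta,
    show 1 - 2 * s + (2 * s - β) = 1 - β by ring, show 1 - 2 * s + β = 1 - (2 * s - β) by ring,
    div_eq_mul_one_div _ (Real.Gamma (1 - β)), div_eq_mul_one_div _ (Real.Gamma (1 - (2 * s - β))),
    one_div_Gamma_one_sub hβ (by linarith), one_div_Gamma_one_sub (by linarith) (by linarith)]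
  linear_combination (-(β / (2 * s) * Real.Gamma (1 - 2 * s) * Real.Gamma (2 * s - β) *
    Real.Gamma β / Real.pi)) * hk

lemma power_constants_cancel_of_gt {s β kp km : ℝ} (hs : 1 / 2 < s) (hs1 : s < 1) (hβ : 0 < β)
    (hβs : β < 2 * s) (hk : kp * Real.sin (Real.pi * β) = km * Real.sin (Real.pi * (2 * s - β))) :
    kp * ∫ t in Ioi (0 : ℝ), (1 - (1 + t) ^ β + β * t) * t ^ (-1 - 2 * s) =
      -(km * ∫ t in Ioi (0 : ℝ), (1 - truncPow β t - β * t) * t ^ (-1 - 2 * s)) := by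
  rw [(one_add_rpow_radial_taylor hs hs1 hβs).2, (truncPow_radial_taylor hs hs1 hβ).2, beta, beta,
    show 2 - 2 * s + (2 * s - β) = 2 - β by ring, show 2 - 2 * s + β = 2 - (2 * s - β) by ring]
  have h1 := one_sub_div_Gamma_two_sub hβ (by linarith)
  have h2 := one_sub_div_Gamma_two_sub (z := 2 * s - β) (by linarith) (by linarith)
  have e1 : -((β - 1) / (2 * s - 1)) *
      (Real.Gamma (2 - 2 * s) * Real.Gamma (2 * s - β) / Real.Gamma (2 - β))
      = Real.Gamma (2 - 2 * s) * Real.Gamma (2 * s - β) / (2 * s - 1) *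
        ((1 - β) / Real.Gamma (2 - β)) := by ring
  have e2 : (β + 1 - 2 * s) / (2 * s - 1) *
      (Real.Gamma (2 - 2 * s) * Real.Gamma β / Real.Gamma (2 - (2 * s - β)))
      = Real.Gamma (2 - 2 * s) * Real.Gamma β / (2 * s - 1) *
        ((1 - (2 * s - β)) / Real.Gamma (2 - (2 * s - β))) := by ring
  rw [e1, e2, h1, h2]
  linear_combination (β / (2 * s) * Real.Gamma (2 - 2 * s) / (2 * s - 1) *
    Real.Gamma (2 * s - β) * Real.Gamma β / Real.pi) * hk

lemma measurable_truncPow (μ : ℝ) : Measurable (truncPow μ) := by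
  unfold truncPow
  exact Measurable.ite measurableSet_Iio (by fun_prop) measurable_const

lemma abs_one_sub_one_add_rpow_le {β t : ℝ} (hβ : 0 < β) (hβ1 : β ≤ 1) (ht : 0 ≤ t) :
    |1 - (1 + t) ^ β| ≤ t ^ β := by
  have h1 : (1 : ℝ) ≤ (1 + t) ^ β := Real.one_le_rpow (by linarith) hβ.le
  have h2 := Real.rpow_add_le_add_rpow zero_le_one ht hβ.le hβ1
  rw [abs_of_nonpos (by linarith)]
  rw [Real.one_rpow] at h2
  linarith

lemma abs_one_sub_truncPow_le {β t : ℝ} (hβ : 0 < β) (hβ1 : β ≤ 1) (ht : 0 ≤ t) :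
    |1 - truncPow β t| ≤ t ^ β := by
  unfold truncPow
  split_ifs with h
  · have h2 := Real.rpow_add_le_add_rpow (by linarith : 0 ≤ 1 - t) ht hβ.le hβ1
    have h3 : (1 - t) ^ β ≤ 1 := Real.rpow_le_one (by linarith) (by linarith) hβ.le
    rw [sub_add_cancel, Real.one_rpow] at h2
    rw [abs_of_nonneg (by linarith)]
    linarith
  · simpa using Real.one_le_rpow (not_lt.1 h) hβ.le

/-- At order one the linear correction must be cut off: without it the integrand is not integrable
at 0, and uncut it is not integrable at infinity. The position c of the cutoff is free because
rescaling a ray moves it. -/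
lemma integrableOn_one_add_rpow_cutoff {β c : ℝ} (hβ : 0 < β) (hβ1 : β < 1) (hc : 0 < c) :
    IntegrableOn (fun t : ℝ => (1 - (1 + t) ^ β + β * (if t < c then t else 0)) *
      t ^ (-1 - 2 * (1 / 2) : ℝ)) (Ioi 0) := by
  obtain ⟨C, hC0, hC⟩ := exists_one_add_rpow_taylor β
  have hρ : 0 < min (c / 2) (1 / 2) := by positivity
  -- Beyond ρ the cutoff term is at most βc, which is absorbed into t^β at the price of the factor
  -- ρ^(-β).
  refine integrableOn_mul_rpow_of_le (ρ := min (c / 2) (1 / 2)) (i := 2) (a := β)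
    (A₁ := C) (A₂ := 1 + β * c * (min (c / 2) (1 / 2) ^ β)⁻¹) ?_ hρ
    (by norm_num) (by linarith) ?_ ?_
  · refine Measurable.add (by fun_prop) (Measurable.const_mul ?_ _)
    exact Measurable.ite measurableSet_Iio measurable_id measurable_const
  · intro t ht0 ht
    have := hC t (by rw [abs_of_pos ht0]; exact ht.trans (min_le_right _ _))
    have htc : t < c := by linarith [ht.trans (min_le_left _ _)]
    rw [if_pos htc, Real.rpow_two]
    convert! this using 2
    ring
  · intro t ht
    have ht0 : 0 < t := hρ.trans ht
    refine (abs_add_le _ _).trans ?_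
    rw [add_mul, one_mul]
    refine add_le_add (abs_one_sub_one_add_rpow_le hβ hβ1.le ht0.le) ?_
    have h1 : |β * if t < c then t else 0| ≤ β * c := by
      split_ifs with h
      · rw [abs_of_pos (by positivity)]; gcongr
      · simp; positivity
    refine h1.trans ?_
    rw [mul_assoc]
    refine le_mul_of_one_le_right (by positivity) ?_
    rw [inv_mul_eq_div, one_le_div (by positivity)]
    gcongr

lemma integrableOn_truncPow_cutoff {β c : ℝ} (hβ : 0 < β) (hβ1 : β < 1) (hc : 0 < c) :
    IntegrableOn (fun t : ℝ => (1 - truncPow β t - β * (if t < c then t else 0)) *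
      t ^ (-1 - 2 * (1 / 2) : ℝ)) (Ioi 0) := by
  obtain ⟨C, hC0, hC⟩ := exists_one_add_rpow_taylor β
  have hρ : 0 < min (c / 2) (1 / 2) := by positivity
  refine integrableOn_mul_rpow_of_le (ρ := min (c / 2) (1 / 2)) (i := 2) (a := β)
    (A₁ := C) (A₂ := 1 + β * c * (min (c / 2) (1 / 2) ^ β)⁻¹) ?_ hρ
    (by norm_num) (by linarith) ?_ ?_
  · refine Measurable.sub (measurable_const.sub (measurable_truncPow _)) (Measurable.const_mul ?_ _)
    exact Measurable.ite measurableSet_Iio measurable_id measurable_const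
  · intro t ht0 ht
    have ht2 : t ≤ 1 / 2 := ht.trans (min_le_right _ _)
    have := hC (-t) (by rw [abs_neg, abs_of_pos ht0]; exact ht2)
    have htc : t < c := by linarith [ht.trans (min_le_left _ _)]
    rw [if_pos htc, Real.rpow_two, truncPow, if_pos (by linarith)]
    rw [neg_sq] at this
    convert! this using 2
    ring_nf
  · intro t ht
    have ht0 : 0 < t := hρ.trans ht
    refine (abs_sub _ _).trans ?_
    rw [add_mul, one_mul]
    refine add_le_add (abs_one_sub_truncPow_le hβ hβ1.le ht0.le) ?_
    have h1 : |β * if t < c then t else 0| ≤ β * c := by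
      split_ifs with h
      · rw [abs_of_pos (by positivity)]; gcongr
      · simp; positivity
    refine h1.trans ?_
    rw [mul_assoc]
    refine le_mul_of_one_le_right (by positivity) ?_
    rw [inv_mul_eq_div, one_le_div (by positivity)]
    gcongr

/-- The value of the symmetric hypersingular integral of `(1 + t)_+^β` of order one. -/
lemma integral_symmetric_power {β : ℝ} (hβ : 0 < β) (hβ1 : β < 1) :
    IntegrableOn (fun t : ℝ => (2 - (1 + t) ^ β - truncPow β t) * t ^ (-1 - 2 * (1 / 2) : ℝ))
      (Ioi 0) ∧
    ∫ t in Ioi (0 : ℝ), (2 - (1 + t) ^ β - truncPow β t) * t ^ (-1 - 2 * (1 / 2) : ℝ)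
      = Real.pi * β * (Real.cos (Real.pi * β) / Real.sin (Real.pi * β)) := by
  set f : ℝ → ℝ := fun t => 2 - (1 + t) ^ β - truncPow β t with hf
  have hsin : 0 < Real.sin (Real.pi * β) :=
    Real.sin_pos_of_pos_of_lt_pi (by positivity) (by nlinarith [Real.pi_pos])
  have hint : IntegrableOn (fun t : ℝ => f t * t ^ (-1 - 2 * (1 / 2) : ℝ)) (Ioi 0) := by
    refine ((integrableOn_one_add_rpow_cutoff hβ hβ1 one_pos).add
      (integrableOn_truncPow_cutoff hβ hβ1 one_pos)).congr_fun (fun t _ => ?_) measurableSet_Ioi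
    simp only [hf, Pi.add_apply]
    ring
  refine ⟨hint, ?_⟩
  -- Order one is approached by the orders 1 - δ, at which the two halves converge separately. Each
  -- has a pole as δ tends to 0, and the poles cancel in the sum.
  have hI : ∀ δ, 0 < δ → δ < 1 - β →
      IntegrableOn (fun t : ℝ => f t * t ^ (-1 - 2 * ((1 - δ) / 2))) (Ioi 0) ∧
      ∫ t in Ioi (0 : ℝ), f t * t ^ (-1 - 2 * ((1 - δ) / 2)) =
        β / (1 - δ) * (beta δ β - beta δ (1 - δ - β)) := by
    intro δ h0 h1
    obtain ⟨a1, a2⟩ := one_add_rpow_radial (σ := (1 - δ) / 2) (μ := β) (by linarith) (by linarith)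
      (by linarith)
    obtain ⟨b1, b2⟩ := truncPow_radial_of_pos (σ := (1 - δ) / 2) (μ := β) (by linarith)
      (by linarith) hβ
    have e : ∀ t ∈ Ioi (0 : ℝ), (1 - (1 + t) ^ β) * t ^ (-1 - 2 * ((1 - δ) / 2)) +
        (1 - truncPow β t) * t ^ (-1 - 2 * ((1 - δ) / 2)) = f t * t ^ (-1 - 2 * ((1 - δ) / 2)) := by
      intro t _
      simp only [hf]; ring
    refine ⟨(a1.add b1).congr_fun e measurableSet_Ioi, ?_⟩
    rw [← setIntegral_congr_fun measurableSet_Ioi e, integral_add a1 b1, a2, b2]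
    rw [show 2 * ((1 - δ) / 2) = 1 - δ by ring, show 1 - (1 - δ) = δ by ring]
    ring
  have hev : ∀ᶠ δ in 𝓝[>] (0 : ℝ), 0 < δ ∧ δ < (1 - β) / 2 :=
    Ioo_mem_nhdsGT (by linarith)
  have hlim1 : Tendsto (fun δ : ℝ => ∫ t in Ioi (0 : ℝ), f t * t ^ (-1 - 2 * ((1 - δ) / 2)))
      (𝓝[>] 0) (𝓝 (∫ t in Ioi (0 : ℝ), f t * t ^ (-1 - 2 * (1 / 2) : ℝ))) := by
    set δ₀ : ℝ := (1 - β) / 2 with hδ₀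
    -- The kernel t^(-2+δ) is at most t^(-2) for t ≤ 1 and at most t^(-2+δ₀) for t > 1. Their sum is
    -- the majorant.
    refine tendsto_integral_filter_of_dominated_convergence
      (fun t => ‖f t * t ^ (-1 - 2 * (1 / 2) : ℝ)‖ + ‖f t * t ^ (-1 - 2 * ((1 - δ₀) / 2))‖)
      ?_ ?_ ?_ ?_
    · filter_upwards [hev] with δ hδ
      exact (hI δ hδ.1 (by linarith)).1.aestronglyMeasurable
    · filter_upwards [hev] with δ hδ
      refine ae_restrict_of_forall_mem measurableSet_Ioi fun t (ht : 0 < t) => ?_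
      simp only [norm_mul, Real.norm_of_nonneg (Real.rpow_nonneg ht.le _)]
      rw [← mul_add]
      refine mul_le_mul_of_nonneg_left ?_ (norm_nonneg _)
      rcases le_or_gt t 1 with h1 | h1
      · refine le_add_of_le_of_nonneg ?_ (Real.rpow_nonneg ht.le _)
        exact Real.rpow_le_rpow_of_exponent_ge ht h1 (by linarith)
      · refine le_add_of_nonneg_of_le (Real.rpow_nonneg ht.le _) ?_
        exact Real.rpow_le_rpow_of_exponent_le h1.le (by linarith)
    · exact hint.norm.add (hI δ₀ (by linarith) (by linarith)).1.norm
    · refine ae_restrict_of_forall_mem measurableSet_Ioi fun t (ht : 0 < t) => ?_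
      refine Tendsto.mono_left ?_ nhdsWithin_le_nhds
      refine Tendsto.const_mul _ ?_
      have : Continuous fun δ : ℝ => t ^ (-1 - 2 * ((1 - δ) / 2)) :=
        Continuous.rpow continuous_const (by fun_prop) (fun _ => Or.inl ht.ne')
      have h2 := this.tendsto 0
      simpa using h2
  refine tendsto_nhds_unique hlim1 ?_
  -- By reflection and Γ(δ+1) = δ Γ(δ), the difference of the two Beta values is minus the
  -- difference quotient of π / sin(πx) at β with step δ, times factors with a finite limit. The
  -- cotangent in the result comes from this derivative.
  have hder : HasDerivAt (fun x : ℝ => Real.pi / Real.sin (Real.pi * x))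
      (-(Real.pi * (Real.cos (Real.pi * β) * Real.pi)) / Real.sin (Real.pi * β) ^ 2) β := by
    have h1 : HasDerivAt (fun x : ℝ => Real.pi * x) Real.pi β := by
      simpa using (hasDerivAt_id β).const_mul Real.pi
    have := (hasDerivAt_const β Real.pi).div h1.sin hsin.ne'
    convert! this using 1
    simp
  have hslope := (hasDerivAt_iff_tendsto_slope_zero.1 hder).mono_left
    (nhdsWithin_mono 0 (fun x (hx : 0 < x) => hx.ne'))
  have hG1 : Tendsto (fun δ : ℝ => Real.Gamma (δ + 1)) (𝓝[>] 0) (𝓝 1) := by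
    have hc : ContinuousAt (fun δ : ℝ => Real.Gamma (δ + 1)) 0 := by
      refine ContinuousAt.comp (g := Real.Gamma) ?_ (by fun_prop)
      refine (Real.differentiableAt_Gamma fun k => ?_).continuousAt
      have : (0 : ℝ) ≤ k := k.cast_nonneg
      linarith
    have := hc.tendsto.mono_left (nhdsWithin_le_nhds (s := Ioi 0))
    simpa using this
  have hG2 : Tendsto (fun δ : ℝ => Real.Gamma (β + δ)) (𝓝[>] 0) (𝓝 (Real.Gamma β)) := by
    have hc : ContinuousAt (fun δ : ℝ => Real.Gamma (β + δ)) 0 := by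
      refine ContinuousAt.comp (g := Real.Gamma) ?_ (by fun_prop)
      refine (Real.differentiableAt_Gamma fun k => ?_).continuousAt
      have : (0 : ℝ) ≤ k := k.cast_nonneg
      linarith
    have := hc.tendsto.mono_left (nhdsWithin_le_nhds (s := Ioi 0))
    simpa using this
  have hβ2 : Tendsto (fun δ : ℝ => β / (1 - δ)) (𝓝[>] 0) (𝓝 β) := by
    have hc : ContinuousAt (fun δ : ℝ => β / (1 - δ)) 0 :=
      ContinuousAt.div (by fun_prop) (by fun_prop) (by norm_num)
    have := hc.tendsto.mono_left (nhdsWithin_le_nhds (s := Ioi 0))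
    simpa using this
  have hGβ := Real.Gamma_pos_of_pos hβ
  have hGβ' : 0 < Real.Gamma (1 - β) := Real.Gamma_pos_of_pos (by linarith)
  have hlim2 := (hβ2.mul hG1).mul (((hG2.mul_const (Real.Gamma (1 - β))).inv₀
    (by positivity)).mul hslope.neg)
  have hval : β * 1 * ((Real.Gamma β * Real.Gamma (1 - β))⁻¹ *
      -(-(Real.pi * (Real.cos (Real.pi * β) * Real.pi)) / Real.sin (Real.pi * β) ^ 2))
      = Real.pi * β * (Real.cos (Real.pi * β) / Real.sin (Real.pi * β)) := by
    rw [Real.Gamma_mul_Gamma_one_sub]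
    have hpi := Real.pi_pos
    field_simp
  rw [hval] at hlim2
  refine hlim2.congr' ?_
  filter_upwards [hev] with δ hδ
  rw [(hI δ hδ.1 (by linarith)).2, mul_assoc]
  congr 1
  have hδ0 := hδ.1
  have r1 := Real.Gamma_mul_Gamma_one_sub β
  have r2 := Real.Gamma_mul_Gamma_one_sub (β + δ)
  rw [← r1, ← r2, Real.Gamma_add_one hδ0.ne', beta, beta, smul_eq_mul,
    show δ + (1 - δ - β) = 1 - β by ring, show 1 - (β + δ) = 1 - δ - β by ring, add_comm δ β]
  have : 0 < Real.Gamma (β + δ) := Real.Gamma_pos_of_pos (by linarith)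
  field_simp
  ring

end KernelConstants

end

/-! ### Powers of the positive part and regularity up to the hyperplane -/

section

section PositivePart

/-- The function `t ↦ t_+^β`. -/
def posPow (β t : ℝ) : ℝ := max t 0 ^ β

/-- The derivative of `t ↦ t_+^β` off the origin. -/
def posPowDeriv (β t : ℝ) : ℝ := if 0 < t then β * t ^ (β - 1) else 0

lemma posPow_of_pos {β t : ℝ} (ht : 0 < t) : posPow β t = t ^ β := by
  rw [posPow, max_eq_left ht.le]

lemma posPow_of_nonpos {β t : ℝ} (hβ : 0 < β) (ht : t ≤ 0) : posPow β t = 0 := by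
  rw [posPow, max_eq_right ht, Real.zero_rpow hβ.ne']

lemma posPow_nonneg (β t : ℝ) : 0 ≤ posPow β t := Real.rpow_nonneg (le_max_right _ _) _

lemma continuous_posPow {β : ℝ} (hβ : 0 < β) : Continuous (posPow β) := by
  unfold posPow
  exact Continuous.rpow_const (by fun_prop) (fun _ => Or.inr hβ.le)

lemma posPow_le {β t R : ℝ} (hβ : 0 < β) (hR : 0 ≤ R) (ht : t ≤ R) : posPow β t ≤ R ^ β :=
  Real.rpow_le_rpow (le_max_right _ _) (max_le ht hR) hβ.le

lemma hasDerivAt_posPow {β t : ℝ} (hβ : 0 < β) (ht : t ≠ 0) :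
    HasDerivAt (posPow β) (posPowDeriv β t) t := by
  rcases lt_or_gt_of_ne ht with h | h
  · rw [posPowDeriv, if_neg (not_lt.2 h.le)]
    refine (hasDerivAt_const t (0 : ℝ)).congr_of_eventuallyEq ?_
    filter_upwards [Iio_mem_nhds h] with x hx
    exact posPow_of_nonpos hβ (le_of_lt hx)
  · rw [posPowDeriv, if_pos h]
    refine (Real.hasDerivAt_rpow_const (Or.inl ht)).congr_of_eventuallyEq ?_
    filter_upwards [Ioi_mem_nhds h] with x hx
    exact posPow_of_pos hx

lemma abs_rpow_sub_rpow_le {β a b : ℝ} (hβ : 0 ≤ β) (hβ1 : β ≤ 1) (ha : 0 ≤ a) (hb : 0 ≤ b) :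
    |a ^ β - b ^ β| ≤ |a - b| ^ β := by
  wlog h : b ≤ a generalizing a b
  · rw [abs_sub_comm, abs_sub_comm a b]
    exact this hb ha (le_of_not_ge h)
  · have h1 := Real.rpow_le_rpow hb h hβ
    have h2 := Real.rpow_add_le_add_rpow (sub_nonneg.2 h) hb hβ hβ1
    rw [sub_add_cancel] at h2
    rw [abs_of_nonneg (sub_nonneg.2 h1), abs_of_nonneg (sub_nonneg.2 h)]
    linarith

lemma abs_max_sub_max_le' (t t' : ℝ) : |max t 0 - max t' 0| ≤ |t - t'| := by
  simpa using abs_max_sub_max_le_abs t t' 0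

/-- An upper bound on t and t' suffices, since the function is constant on the negative axis. For
exponents above 1 only Lipschitz continuity is kept, whence the minimum. -/
lemma exists_posPow_holder {β₀ R : ℝ} (hβ₀ : 0 < β₀) (hR : 0 < R) :
    ∃ C, 0 ≤ C ∧ ∀ t t' : ℝ, t ≤ R → t' ≤ R →
      |posPow β₀ t - posPow β₀ t'| ≤ C * |t - t'| ^ min β₀ 1 := by
  rcases le_or_gt β₀ 1 with h | h
  · refine ⟨1, zero_le_one, fun t t' _ _ => ?_⟩
    rw [min_eq_left h, one_mul]
    exact (abs_rpow_sub_rpow_le hβ₀.le h (le_max_right _ _) (le_max_right _ _)).trans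
      (Real.rpow_le_rpow (abs_nonneg _) (abs_max_sub_max_le' t t') hβ₀.le)
  · refine ⟨β₀ * R ^ (β₀ - 1), by positivity, fun t t' ht ht' => ?_⟩
    rw [min_eq_right h.le, Real.rpow_one, abs_sub_comm, abs_sub_comm t]
    have := Convex.norm_image_sub_le_of_norm_hasDerivWithin_le (s := Icc 0 R)
      (f := fun x : ℝ => x ^ β₀) (f' := fun x => β₀ * x ^ (β₀ - 1)) (C := β₀ * R ^ (β₀ - 1))
      (x := max t 0) (y := max t' 0)
      (fun x _ => (Real.hasDerivAt_rpow_const (Or.inr h.le)).hasDerivWithinAt)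
      (fun x hx => by
        rw [Real.norm_of_nonneg (by have := Real.rpow_nonneg hx.1 (β₀ - 1); positivity)]
        have := Real.rpow_le_rpow hx.1 hx.2 (by linarith : 0 ≤ β₀ - 1)
        gcongr)
      (convex_Icc _ _) ⟨le_max_right _ _, max_le ht hR.le⟩ ⟨le_max_right _ _, max_le ht' hR.le⟩
    refine this.trans ?_
    gcongr
    exact abs_max_sub_max_le' t' t

lemma abs_posPowDeriv_le {β t : ℝ} (hβ : 0 < β) : |posPowDeriv β t| ≤ β * |t| ^ (β - 1) := by
  unfold posPowDeriv
  split_ifs with h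
  · rw [abs_of_pos h, abs_of_pos (by positivity)]
  · simp only [abs_zero]; positivity

/-- By homogeneity everything reduces to the expansion of (1 + z)^β at z = r/t. The condition |r| ≤
|t|/2 keeps t + r on the same side of 0, and on the negative side all terms vanish. -/
lemma exists_posPow_taylor {β : ℝ} (hβ : 0 < β) :
    ∃ C, 0 ≤ C ∧ ∀ t r : ℝ, t ≠ 0 → |r| ≤ |t| / 2 →
      |posPow β t - posPow β (t + r) + posPowDeriv β t * r| ≤ C * |t| ^ (β - 2) * r ^ 2 := by
  obtain ⟨C, hC0, hC⟩ := exists_one_add_rpow_taylor β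
  refine ⟨C, hC0, fun t r ht hr => ?_⟩
  rcases lt_or_gt_of_ne ht with h | h
  · rw [abs_of_neg h] at hr
    have hr' := abs_le.1 hr
    rw [posPow_of_nonpos hβ h.le, posPow_of_nonpos hβ (by linarith), posPowDeriv,
      if_neg (not_lt.2 h.le)]
    simp only [sub_zero, zero_mul, add_zero, abs_zero]
    positivity
  · rw [abs_of_pos h] at hr ⊢
    have hr' := abs_le.1 hr
    rw [posPow_of_pos h, posPow_of_pos (by linarith), posPowDeriv, if_pos h]
    have hz : |r / t| ≤ 1 / 2 := by
      rw [abs_div, abs_of_pos h, div_le_iff₀ h]; linarith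
    have h1 := hC _ hz
    have e1 : t + r = t * (1 + r / t) := by field_simp
    have hz' := abs_le.1 hz
    have e2 : t ^ β - (t + r) ^ β + β * t ^ (β - 1) * r
        = t ^ β * (1 + β * (r / t) - (1 + r / t) ^ β) := by
      rw [e1, Real.mul_rpow h.le (by linarith), Real.rpow_sub_one h.ne']
      field_simp
      ring
    rw [e2, abs_mul, abs_of_pos (Real.rpow_pos_of_pos h _)]
    calc t ^ β * |1 + β * (r / t) - (1 + r / t) ^ β| ≤ t ^ β * (C * (r / t) ^ 2) := by gcongr
      _ = C * t ^ (β - 2) * r ^ 2 := by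
        rw [Real.rpow_sub h, Real.rpow_two]; field_simp

lemma rpow_le_const_mul_rpow {d R e e' : ℝ} (hd : 0 < d) (hdR : d ≤ R) (he : e' ≤ e) :
    d ^ e ≤ R ^ (e - e') * d ^ e' := by
  rw [show e = (e - e') + e' by ring, Real.rpow_add hd]
  simp only [add_sub_cancel_right]
  gcongr

end PositivePart

section Regularity

variable {m : ℕ}

/-- The last coordinate as a continuous linear form. -/
def lastCoordL (m : ℕ) : Space m →L[ℝ] ℝ := EuclideanSpace.proj (Fin.last m)

lemma lastCoordL_apply (x : Space m) : lastCoordL m x = lastCoord x := rfl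

lemma lastCoord_add (x y : Space m) : lastCoord (x + y) = lastCoord x + lastCoord y := rfl

lemma lastCoord_neg (x : Space m) : lastCoord (-x) = -lastCoord x := rfl

lemma lastCoord_smul (t : ℝ) (x : Space m) : lastCoord (t • x) = t * lastCoord x := rfl

lemma abs_lastCoord_le (x : Space m) : |lastCoord x| ≤ ‖x‖ := by
  simpa [lastCoord] using PiLp.norm_apply_le x (Fin.last m)

@[fun_prop]
lemma continuous_lastCoord : Continuous (lastCoord : Space m → ℝ) := (lastCoordL m).continuous

@[fun_prop]
lemma measurable_lastCoord : Measurable (lastCoord : Space m → ℝ) :=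
  continuous_lastCoord.measurable

/-- Quantitative boundary regularity of order `β` in the slab `|x_n| ≤ R`. -/
structure BdryRegular (β R C : ℝ) (f : Space m → ℝ) : Prop where
  nonneg : 0 ≤ C
  continuous : Continuous f
  holder : ∀ x y, |lastCoord x| ≤ R → |f x - f (x + y)| ≤ C * ‖y‖ ^ β
  differentiableAt : ∀ x, lastCoord x ≠ 0 → DifferentiableAt ℝ f x
  grad : ∀ x, lastCoord x ≠ 0 → |lastCoord x| ≤ R → ‖fderiv ℝ f x‖ ≤ C * |lastCoord x| ^ (β - 1)
  taylor : ∀ x y, lastCoord x ≠ 0 → |lastCoord x| ≤ R → ‖y‖ ≤ |lastCoord x| / 2 →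
    |f x - f (x + y) + fderiv ℝ f x y| ≤ C * |lastCoord x| ^ (β - 2) * ‖y‖ ^ 2

/-- Within half the distance to the hyperplane this is the Taylor bound plus the gradient bound.
Farther out it follows from the Hölder bound, because |y|^(β-1) ≤ 2 d^(β-1) when |y| > d/2 and 0 < β
≤ 1. -/
lemma BdryRegular.lip {β R C : ℝ} {f : Space m → ℝ} (hf : BdryRegular β R C f) (hβ : 0 < β)
    (hβ1 : β ≤ 1) {x : Space m} (hx : lastCoord x ≠ 0) (hxR : |lastCoord x| ≤ R) (y : Space m) :
    |f x - f (x + y)| ≤ 2 * C * |lastCoord x| ^ (β - 1) * ‖y‖ := by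
  have hC := hf.nonneg
  have hd : 0 < |lastCoord x| := abs_pos.2 hx
  set d := |lastCoord x| with hdd
  rcases le_or_gt ‖y‖ (d / 2) with h | h
  · have h1 := hf.taylor x y hx hxR h
    have h2 : |fderiv ℝ f x y| ≤ C * d ^ (β - 1) * ‖y‖ :=
      ((fderiv ℝ f x).le_opNorm y).trans
        (mul_le_mul_of_nonneg_right (hf.grad x hx hxR) (norm_nonneg _))
    have e : d ^ (β - 1) = d ^ (β - 2) * d := by
      rw [← Real.rpow_add_one hd.ne']; ring_nf
    have h3 : C * d ^ (β - 2) * ‖y‖ ^ 2 ≤ C * d ^ (β - 1) * ‖y‖ := by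
      rw [e, sq, ← mul_assoc, ← mul_assoc]
      gcongr
      linarith
    calc |f x - f (x + y)| = |(f x - f (x + y) + fderiv ℝ f x y) - fderiv ℝ f x y| := by ring_nf
      _ ≤ _ := abs_sub _ _
      _ ≤ C * d ^ (β - 1) * ‖y‖ + C * d ^ (β - 1) * ‖y‖ := add_le_add (h1.trans h3) h2
      _ = _ := by ring
  · have hy : 0 < ‖y‖ := by linarith
    refine (hf.holder x y hxR).trans ?_
    have h1 : ‖y‖ ^ β = ‖y‖ ^ (β - 1) * ‖y‖ := by
      rw [← Real.rpow_add_one hy.ne']; ring_nf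
    have h2 : ‖y‖ ^ (β - 1) ≤ (d / 2) ^ (β - 1) :=
      Real.rpow_le_rpow_of_nonpos (by positivity) h.le (by linarith)
    have h3 : (d / 2) ^ (β - 1) ≤ 2 * d ^ (β - 1) := by
      rw [Real.div_rpow hd.le (by norm_num), div_eq_mul_inv, ← Real.rpow_neg (by norm_num),
        mul_comm]
      gcongr
      calc (2 : ℝ) ^ (-(β - 1)) ≤ 2 ^ (1 : ℝ) :=
            Real.rpow_le_rpow_of_exponent_le (by norm_num) (by linarith)
        _ = 2 := Real.rpow_one _
    rw [h1, ← mul_assoc]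
    refine mul_le_mul_of_nonneg_right ?_ hy.le
    calc C * ‖y‖ ^ (β - 1) ≤ C * (2 * d ^ (β - 1)) := by gcongr; exact h2.trans h3
      _ = _ := by ring

/-- Bounds of a test function up to second order. -/
structure TestBounds (N ρ : ℝ) (η : Space m → ℝ) : Prop where
  nonneg : 0 ≤ N
  pos : 0 < ρ
  differentiable : Differentiable ℝ η
  bound : ∀ x, |η x| ≤ N
  support : ∀ x, ρ < ‖x‖ → η x = 0
  grad : ∀ x, ‖fderiv ℝ η x‖ ≤ N
  lip : ∀ x y, |η x - η (x + y)| ≤ N * ‖y‖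
  taylor : ∀ x y, |η x - η (x + y) + fderiv ℝ η x y| ≤ N * ‖y‖ ^ 2

lemma exists_testBounds {η : Space m → ℝ} (hη : ContDiff ℝ ∞ η) (hs : HasCompactSupport η) :
    ∃ N ρ, TestBounds N ρ η := by
  have h0 : Continuous η := hη.continuous
  have hd : Differentiable ℝ η := hη.differentiable (by simp)
  have h1 : ContDiff ℝ 1 (fderiv ℝ η) := hη.fderiv_right (by norm_cast)
  have hs1 : HasCompactSupport (fderiv ℝ η) := hs.fderiv ℝ
  obtain ⟨N0, hN0⟩ := hs.exists_bound_of_continuous h0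
  obtain ⟨N1, hN1⟩ := hs1.exists_bound_of_continuous h1.continuous
  obtain ⟨N2, hN2⟩ := h1.lipschitzWith_of_hasCompactSupport hs1 (by simp)
  obtain ⟨ρ, hρ⟩ := hs.isCompact.isBounded.subset_closedBall 0
  have hN00 : 0 ≤ N0 := (norm_nonneg _).trans (hN0 0)
  have hN10 : 0 ≤ N1 := (norm_nonneg _).trans (hN1 0)
  have hle0 : N0 ≤ N0 + N1 + N2 := by linarith [N2.2, show (0:ℝ) ≤ N2 from N2.2]
  have hle1 : N1 ≤ N0 + N1 + N2 := by linarith [show (0:ℝ) ≤ N2 from N2.2]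
  have hle2 : (N2 : ℝ) ≤ N0 + N1 + N2 := by linarith
  refine ⟨N0 + N1 + N2, max ρ 1, ?_, by positivity, hd, fun x => (hN0 x).trans hle0, ?_,
    fun x => (hN1 x).trans hle1, ?_, ?_⟩
  · exact hN00.trans hle0
  · intro x hx
    by_contra hne
    have := hρ (subset_tsupport η hne)
    rw [mem_closedBall_zero_iff] at this
    exact absurd (lt_of_le_of_lt (le_max_left ρ 1) hx) (not_lt.2 this)
  · intro x y
    have := Convex.norm_image_sub_le_of_norm_hasFDerivWithin_le (f := η) (f' := fderiv ℝ η)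
      (s := univ) (x := x + y) (y := x) (C := N1)
      (fun z _ => (hd z).hasFDerivAt.hasFDerivWithinAt) (fun z _ => hN1 z) convex_univ
      (mem_univ _) (mem_univ _)
    rw [sub_add_cancel_left, norm_neg] at this
    exact this.trans (by gcongr)
  · intro x y
    have := Convex.norm_image_sub_le_of_norm_hasFDerivWithin_le' (f := η) (f' := fderiv ℝ η)
      (s := Metric.closedBall x ‖y‖) (x := x) (y := x + y) (C := N2 * ‖y‖) (φ := fderiv ℝ η x)
      (fun z _ => (hd z).hasFDerivAt.hasFDerivWithinAt)
      (fun z hz => by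
        have := hN2.dist_le_mul z x
        rw [dist_eq_norm] at this
        exact this.trans (mul_le_mul_of_nonneg_left hz N2.2)) (convex_closedBall _ _)
      (Metric.mem_closedBall_self (norm_nonneg _)) (by simp)
    rw [add_sub_cancel_left, Real.norm_eq_abs] at this
    rw [← abs_neg]
    calc |-(η x - η (x + y) + fderiv ℝ η x y)| = |η (x + y) - η x - fderiv ℝ η x y| := by
          congr 1; ring
      _ ≤ N2 * ‖y‖ * ‖y‖ := this
      _ = N2 * ‖y‖ ^ 2 := by ring
      _ ≤ _ := by gcongr

lemma TestBounds.holder {N ρ β : ℝ} {η : Space m → ℝ} (hη : TestBounds N ρ η) (hβ : 0 < β)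
    (hβ1 : β ≤ 1) (x y : Space m) : |η x - η (x + y)| ≤ 2 * N * ‖y‖ ^ β := by
  have hN := hη.nonneg
  rcases le_or_gt ‖y‖ 1 with h | h
  · refine (hη.lip x y).trans ?_
    have : ‖y‖ ≤ ‖y‖ ^ β := by
      rcases (norm_nonneg y).eq_or_lt with h0 | h0
      · rw [← h0, Real.zero_rpow hβ.ne']
      · simpa using Real.rpow_le_rpow_of_exponent_ge h0 h hβ1
    nlinarith [norm_nonneg y]
  · have h1 : 1 ≤ ‖y‖ ^ β := Real.one_le_rpow h.le hβ.le
    refine (abs_sub _ _).trans ?_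
    nlinarith [hη.bound x, hη.bound (x + y)]

lemma powMul_eq (β : ℝ) (η : Space m → ℝ) (x : Space m) :
    powMul β η x = posPow β (lastCoord x) * η x := rfl

lemma hasFDerivAt_posPow_lastCoord {β : ℝ} (hβ : 0 < β) {x : Space m} (hx : lastCoord x ≠ 0) :
    HasFDerivAt (fun x : Space m => posPow β (lastCoord x))
      (posPowDeriv β (lastCoord x) • lastCoordL m) x :=
  (hasDerivAt_posPow hβ hx).comp_hasFDerivAt x (lastCoordL m).hasFDerivAt

lemma hasFDerivAt_powMul {β : ℝ} (hβ : 0 < β) {η : Space m → ℝ} {x : Space m}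
    (hη : DifferentiableAt ℝ η x) (hx : lastCoord x ≠ 0) :
    HasFDerivAt (powMul β η) (posPow β (lastCoord x) • fderiv ℝ η x +
      η x • (posPowDeriv β (lastCoord x) • lastCoordL m)) x :=
  (hasFDerivAt_posPow_lastCoord hβ hx).mul hη.hasFDerivAt

/-- Product rule for each bound. Excess powers of the distance are traded for powers of R, so an
exponent above 1 may be lowered to 1. -/
lemma exists_bdryRegular_powMul {β₀ N ρ R : ℝ} {η : Space m → ℝ} (hβ₀ : 0 < β₀)
    (hη : TestBounds N ρ η) (hR : 0 < R) :
    ∃ C, BdryRegular (min β₀ 1) R C (powMul β₀ η) := by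
  obtain ⟨C1, hC10, hC1⟩ := exists_posPow_holder hβ₀ (lt_max_of_lt_left hR : 0 < max R ρ)
  obtain ⟨C2, hC20, hC2⟩ := exists_posPow_taylor hβ₀
  have hN := hη.nonneg
  set β := min β₀ 1 with hβdef
  have hβ : 0 < β := lt_min hβ₀ one_pos
  have hβ1 : β ≤ 1 := min_le_right _ _
  have hββ₀ : β ≤ β₀ := min_le_left _ _
  set P : Space m → ℝ := fun x => posPow β₀ (lastCoord x) with hP
  set P' : Space m → ℝ := fun x => posPowDeriv β₀ (lastCoord x) with hP'
  have hfd : ∀ x, lastCoord x ≠ 0 → ∀ y, fderiv ℝ (powMul β₀ η) x y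
      = P x * fderiv ℝ η x y + η x * (P' x * lastCoord y) := by
    intro x hx y
    rw [(hasFDerivAt_powMul hβ₀ (hη.differentiable x) hx).fderiv]
    rfl
  have hP'b : ∀ x, lastCoord x ≠ 0 → |lastCoord x| ≤ R →
      |P' x| ≤ β₀ * R ^ (β₀ - β) * |lastCoord x| ^ (β - 1) := by
    intro x hx hxR
    refine (abs_posPowDeriv_le hβ₀).trans ?_
    have := rpow_le_const_mul_rpow (abs_pos.2 hx) hxR (by linarith : β - 1 ≤ β₀ - 1)
    rw [show β₀ - 1 - (β - 1) = β₀ - β by ring] at this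
    rw [mul_assoc]
    gcongr
  -- A1, A2 and A3 are the constants of the Hölder, gradient and Taylor bounds. Their sum serves for
  -- all three.
  set A1 := 2 * N * R ^ β₀ + N * C1
  set A2 := R ^ β₀ * N * R ^ (1 - β) + N * (β₀ * R ^ (β₀ - β))
  set A3 := (2 * R) ^ β₀ * N * R ^ (2 - β) + N * (C2 * R ^ (β₀ - β)) +
    (C2 * R ^ (β₀ - β) + β₀ * R ^ (β₀ - β)) * N * R
  have hA1 : 0 ≤ A1 := by positivity
  have hA2 : 0 ≤ A2 := by positivity
  have hA3 : 0 ≤ A3 := by positivity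
  refine ⟨A1 + A2 + A3, by positivity, ?_, ?_, ?_, ?_, ?_⟩
  · exact ((continuous_posPow hβ₀).comp continuous_lastCoord).mul hη.differentiable.continuous
  · intro x y hx
    have e : powMul β₀ η x - powMul β₀ η (x + y)
        = P x * (η x - η (x + y)) + (P x - P (x + y)) * η (x + y) := by
      simp only [powMul_eq, hP]; ring
    have h1 : |P x * (η x - η (x + y))| ≤ R ^ β₀ * (2 * N * ‖y‖ ^ β) := by
      rw [abs_mul, abs_of_nonneg (posPow_nonneg _ _)]
      gcongr
      · exact posPow_le hβ₀ hR.le ((le_abs_self _).trans hx)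
      · exact hη.holder hβ hβ1 x y
    have h2 : |(P x - P (x + y)) * η (x + y)| ≤ C1 * ‖y‖ ^ β * N := by
      -- If η does not vanish at x + y, that point lies in the ball of radius ρ. This is why the
      -- Hölder constant was taken for heights up to max R ρ.
      by_cases h0 : η (x + y) = 0
      · rw [h0, mul_zero, abs_zero]; positivity
      · have hle : lastCoord (x + y) ≤ ρ := by
          by_contra hlt
          refine h0 (hη.support _ (lt_of_lt_of_le (not_le.1 hlt) ?_))
          exact (le_abs_self _).trans (abs_lastCoord_le _)
        rw [abs_mul]
        gcongr
        · refine (hC1 _ _ (((le_abs_self _).trans hx).trans (le_max_left _ _))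
            (hle.trans (le_max_right _ _))).trans ?_
          rw [lastCoord_add, sub_add_cancel_left, abs_neg]
          gcongr
          exact abs_lastCoord_le y
        · exact hη.bound _
    rw [e]
    refine (abs_add_le _ _).trans ((add_le_add h1 h2).trans ?_)
    have : A1 * ‖y‖ ^ β ≤ (A1 + A2 + A3) * ‖y‖ ^ β := by gcongr; linarith
    calc _ = A1 * ‖y‖ ^ β := by ring
      _ ≤ _ := this
  · intro x hx
    exact (hasFDerivAt_powMul hβ₀ (hη.differentiable x) hx).differentiableAt
  · intro x hx hxR
    have hd : 0 < |lastCoord x| := abs_pos.2 hx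
    refine ContinuousLinearMap.opNorm_le_bound _ (by positivity) fun y => ?_
    rw [hfd x hx y]
    have h1 : |P x * fderiv ℝ η x y| ≤ R ^ β₀ * (N * ‖y‖) * (R ^ (1 - β) * |lastCoord x| ^ (β - 1)) := by
      rw [abs_mul, abs_of_nonneg (posPow_nonneg _ _)]
      have hone : (1 : ℝ) ≤ R ^ (1 - β) * |lastCoord x| ^ (β - 1) := by
        have := rpow_le_const_mul_rpow hd hxR (by linarith : β - 1 ≤ 0)
        rwa [Real.rpow_zero, show 0 - (β - 1) = 1 - β by ring] at this
      refine le_trans ?_ (le_mul_of_one_le_right (by positivity) hone)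
      gcongr
      · exact posPow_le hβ₀ hR.le ((le_abs_self _).trans hxR)
      · exact ((fderiv ℝ η x).le_opNorm y).trans (by gcongr; exact hη.grad x)
    have h2 : |η x * (P' x * lastCoord y)| ≤
        N * (β₀ * R ^ (β₀ - β) * |lastCoord x| ^ (β - 1) * ‖y‖) := by
      rw [abs_mul, abs_mul]
      gcongr
      · exact hη.bound x
      · exact hP'b x hx hxR
      · exact abs_lastCoord_le y
    rw [Real.norm_eq_abs]
    refine (abs_add_le _ _).trans ((add_le_add h1 h2).trans ?_)
    calc _ = A2 * |lastCoord x| ^ (β - 1) * ‖y‖ := by ring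
      _ ≤ (A1 + A2 + A3) * |lastCoord x| ^ (β - 1) * ‖y‖ := by gcongr; linarith
  · intro x y hx hxR hy
    have hd : 0 < |lastCoord x| := abs_pos.2 hx
    set d := |lastCoord x| with hdd
    have hyn : |lastCoord y| ≤ d / 2 := (abs_lastCoord_le y).trans hy
    -- The Taylor remainder of a product: each factor contributes its own remainder, and the cross
    -- term is a first difference of the power times the gradient of η.
    have e : powMul β₀ η x - powMul β₀ η (x + y) + fderiv ℝ (powMul β₀ η) x y
        = P (x + y) * (η x - η (x + y) + fderiv ℝ η x y)
          + η x * (P x - P (x + y) + P' x * lastCoord y)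
          + (P x - P (x + y)) * fderiv ℝ η x y := by
      rw [hfd x hx y]
      simp only [powMul_eq, hP]; ring
    have hT : |P x - P (x + y) + P' x * lastCoord y| ≤
        C2 * R ^ (β₀ - β) * d ^ (β - 2) * ‖y‖ ^ 2 := by
      refine (hC2 (lastCoord x) (lastCoord y) hx hyn).trans ?_
      have h1 := rpow_le_const_mul_rpow hd hxR (by linarith : β - 2 ≤ β₀ - 2)
      rw [show β₀ - 2 - (β - 2) = β₀ - β by ring] at h1
      have h2 : lastCoord y ^ 2 ≤ ‖y‖ ^ 2 := sq_le_sq' (by linarith [(abs_le.1 (abs_lastCoord_le y)).1])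
        ((le_abs_self _).trans (abs_lastCoord_le y))
      calc C2 * d ^ (β₀ - 2) * lastCoord y ^ 2
          ≤ C2 * (R ^ (β₀ - β) * d ^ (β - 2)) * ‖y‖ ^ 2 := by gcongr
        _ = _ := by ring
    have hL : |P x - P (x + y)| ≤ (C2 * R ^ (β₀ - β) + β₀ * R ^ (β₀ - β)) * d ^ (β - 1) * ‖y‖ := by
      have e1 : d ^ (β - 1) = d ^ (β - 2) * d := by
        rw [← Real.rpow_add_one hd.ne']; ring_nf
      have h3 : C2 * R ^ (β₀ - β) * d ^ (β - 2) * ‖y‖ ^ 2 ≤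
          C2 * R ^ (β₀ - β) * d ^ (β - 1) * ‖y‖ := by
        rw [e1, sq, ← mul_assoc, ← mul_assoc]
        gcongr
        linarith
      have h4 : |P' x * lastCoord y| ≤ β₀ * R ^ (β₀ - β) * d ^ (β - 1) * ‖y‖ := by
        rw [abs_mul]
        gcongr
        · exact hP'b x hx hxR
        · exact abs_lastCoord_le y
      calc |P x - P (x + y)|
          = |(P x - P (x + y) + P' x * lastCoord y) - P' x * lastCoord y| := by ring_nf
        _ ≤ _ := abs_sub _ _
        _ ≤ _ := add_le_add (hT.trans h3) h4
        _ = _ := by ring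
    have h1 : |P (x + y) * (η x - η (x + y) + fderiv ℝ η x y)| ≤
        (2 * R) ^ β₀ * (N * ‖y‖ ^ 2) * (R ^ (2 - β) * d ^ (β - 2)) := by
      rw [abs_mul, abs_of_nonneg (posPow_nonneg _ _)]
      have hone : (1 : ℝ) ≤ R ^ (2 - β) * d ^ (β - 2) := by
        have := rpow_le_const_mul_rpow hd hxR (by linarith : β - 2 ≤ 0)
        rwa [Real.rpow_zero, show 0 - (β - 2) = 2 - β by ring] at this
      refine le_trans ?_ (le_mul_of_one_le_right (by positivity) hone)
      gcongr
      · refine posPow_le hβ₀ (by positivity) ?_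
        rw [lastCoord_add]
        linarith [le_abs_self (lastCoord x), le_abs_self (lastCoord y)]
      · exact hη.taylor x y
    have h2 : |η x * (P x - P (x + y) + P' x * lastCoord y)| ≤
        N * (C2 * R ^ (β₀ - β) * d ^ (β - 2) * ‖y‖ ^ 2) := by
      rw [abs_mul]
      gcongr
      exact hη.bound x
    have h3 : |(P x - P (x + y)) * fderiv ℝ η x y| ≤
        (C2 * R ^ (β₀ - β) + β₀ * R ^ (β₀ - β)) * (R * d ^ (β - 2)) * ‖y‖ * (N * ‖y‖) := by
      rw [abs_mul]
      gcongr
      · refine hL.trans ?_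
        gcongr
        rw [show β - 1 = 1 + (β - 2) by ring, Real.rpow_add hd, Real.rpow_one]
        gcongr
      · exact ((fderiv ℝ η x).le_opNorm y).trans (by gcongr; exact hη.grad x)
    rw [e]
    refine (abs_add_le _ _).trans ((add_le_add ((abs_add_le _ _).trans (add_le_add h1 h2)) h3).trans ?_)
    calc _ = A3 * d ^ (β - 2) * ‖y‖ ^ 2 := by ring
      _ ≤ (A1 + A2 + A3) * d ^ (β - 2) * ‖y‖ ^ 2 := by gcongr; linarith

end Regularity

end

/-! ### The operator as an absolutely convergent integral -/

section

variable {m : ℕ} {s lam Lam : ℝ} {K : Space m → ℝ} {b : Space m}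

section Operator

/-- The cutoff of the gradient correction: `0`, the indicator of `r < 1`, or `1`, according to
whether `s < 1/2`, `s = 1/2` or `s > 1/2`. -/
def gradCutoff (s r : ℝ) : ℝ := if s < 1 / 2 then 0 else if s = 1 / 2 then (if r < 1 then 1 else 0) else 1

/-- The drift, which is present for `s = 1/2` only. -/
def effDrift (s : ℝ) (b : Space m) : Space m := if s = 1 / 2 then b else 0

/-- The compensated increment `f(x) - f(x+y) + χ(|y|) ∇f(x)·y`. -/
def increment (s : ℝ) (f : Space m → ℝ) (x y : Space m) : ℝ :=
  f x - f (x + y) + gradCutoff s ‖y‖ * fderiv ℝ f x y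

/-- The stable operator in terms of absolutely convergent integrals. -/
def regOp (s : ℝ) (K : Space m → ℝ) (b : Space m) (f : Space m → ℝ) (x : Space m) : ℝ :=
  ∫ y, increment s f x y ∂(kernelMeasure K) + fderiv ℝ f x (effDrift s b)

lemma measurable_gradCutoff (s : ℝ) : Measurable (gradCutoff s) := by
  unfold gradCutoff
  split_ifs
  · exact measurable_const
  · exact Measurable.ite measurableSet_Iio measurable_const measurable_const
  · exact measurable_const

lemma abs_gradCutoff_le (s r : ℝ) : |gradCutoff s r| ≤ 1 := by
  unfold gradCutoff
  split_ifs <;> simp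

/-- Expanding the direction in the standard basis reduces joint measurability to derivatives in
fixed directions, which are measurable without any differentiability of f. -/
lemma measurable_fderiv_apply (f : Space m → ℝ) :
    Measurable fun p : Space m × Space m => fderiv ℝ f p.1 p.2 := by
  have e : (fun p : Space m × Space m => fderiv ℝ f p.1 p.2) = fun p =>
      ∑ i, p.2 i * fderiv ℝ f p.1 (EuclideanSpace.single i (1 : ℝ)) := by
    ext p
    have h : p.2 = ∑ i, p.2 i • EuclideanSpace.single i (1 : ℝ) := by
      ext j
      simp [Pi.single_apply]
    conv_lhs => rw [h]
    simp only [map_sum, map_smul, smul_eq_mul]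
  rw [e]
  refine Finset.measurable_sum _ fun i _ => Measurable.mul ?_ ?_
  · fun_prop
  · exact (measurable_fderiv_apply_const ℝ f _).comp measurable_fst

lemma measurable_increment {f : Space m → ℝ} (hf : Continuous f) :
    Measurable fun p : Space m × Space m => increment s f p.1 p.2 := by
  unfold increment
  refine Measurable.add ?_ (Measurable.mul ?_ (measurable_fderiv_apply f))
  · exact (Continuous.measurable (by fun_prop))
  · exact (measurable_gradCutoff s).comp (by fun_prop)

lemma measurable_increment_right {f : Space m → ℝ} (hf : Continuous f) (x : Space m) :
    Measurable (increment s f x) :=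
  (measurable_increment hf).comp (by fun_prop : Measurable fun y : Space m => (x, y))

lemma measurable_regOp {f : Space m → ℝ} (hf : Continuous f) :
    StronglyMeasurable (regOp s K b f) := by
  unfold regOp
  refine StronglyMeasurable.add ?_ ?_
  · exact (measurable_increment hf).stronglyMeasurable.integral_prod_right'
  · exact (measurable_fderiv_apply_const ℝ f _).stronglyMeasurable

lemma increment_of_lt (hs : s < 1 / 2) (f : Space m → ℝ) (x y : Space m) :
    increment s f x y = f x - f (x + y) := by
  rw [increment, gradCutoff, if_pos hs, zero_mul, add_zero]

lemma increment_of_gt (hs : 1 / 2 < s) (f : Space m → ℝ) (x y : Space m) :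
    increment s f x y = f x - f (x + y) + fderiv ℝ f x y := by
  rw [increment, gradCutoff, if_neg (not_lt.2 hs.le), if_neg hs.ne', one_mul]

lemma increment_half_of_lt {f : Space m → ℝ} {x y : Space m} (hy : ‖y‖ < 1) :
    increment (1 / 2) f x y = f x - f (x + y) + fderiv ℝ f x y := by
  rw [increment, gradCutoff, if_neg (lt_irrefl _), if_pos rfl, if_pos hy, one_mul]

lemma increment_half_of_ge {f : Space m → ℝ} {x y : Space m} (hy : 1 ≤ ‖y‖) :
    increment (1 / 2) f x y = f x - f (x + y) := by
  rw [increment, gradCutoff, if_neg (lt_irrefl _), if_pos rfl, if_neg (not_lt.2 hy), zero_mul,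
    add_zero]

/-- Powers of `‖y‖` controlling the compensated increment inside and outside of the ball of radius
`|x_n|/2`. -/
lemma exists_increment_bound {β R C ε : ℝ} {f : Space m → ℝ} (hs1 : s < 1)
    (hf : BdryRegular β R C f) (hβ : 0 < β) (hβ1 : β ≤ 1) (hβs : β < 2 * s) (hR : 0 < R)
    (hε : 0 < ε) (hε1 : s = 1 / 2 → ε ≤ 1 - β) :
    ∃ A i a, 0 ≤ A ∧ 2 * s < i ∧ a < 2 * s ∧ ∀ x, lastCoord x ≠ 0 → |lastCoord x| ≤ R →
      (∀ y, ‖y‖ < |lastCoord x| / 2 →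
        |increment s f x y| ≤ A * |lastCoord x| ^ (β - i - ε) * ‖y‖ ^ i) ∧
      (∀ y, |lastCoord x| / 2 ≤ ‖y‖ →
        |increment s f x y| ≤ A * |lastCoord x| ^ (β - a - ε) * ‖y‖ ^ a) := by
  have hC := hf.nonneg
  have hgrad : ∀ x, lastCoord x ≠ 0 → |lastCoord x| ≤ R → ∀ y,
      |fderiv ℝ f x y| ≤ C * |lastCoord x| ^ (β - 1) * ‖y‖ := fun x hx hxR y =>
    ((fderiv ℝ f x).le_opNorm y).trans
        (mul_le_mul_of_nonneg_right (hf.grad x hx hxR) (norm_nonneg _))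
  have hpw : ∀ x : Space m, lastCoord x ≠ 0 → |lastCoord x| ≤ R → ∀ e,
      |lastCoord x| ^ e ≤ R ^ ε * |lastCoord x| ^ (e - ε) := by
    intro x hx hxR e
    have := rpow_le_const_mul_rpow (abs_pos.2 hx) hxR (by linarith : e - ε ≤ e)
    rwa [sub_sub_cancel] at this
  rcases lt_trichotomy s (1 / 2) with hs | hs | hs
  · refine ⟨2 * C * R ^ ε + C * R ^ ε, 1, β, by positivity, by linarith, hβs, fun x hx hxR => ⟨?_, ?_⟩⟩
    · intro y _
      rw [increment_of_lt hs, Real.rpow_one]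
      refine (hf.lip hβ hβ1 hx hxR y).trans ?_
      refine mul_le_mul_of_nonneg_right ?_ (norm_nonneg _)
      calc 2 * C * |lastCoord x| ^ (β - 1) ≤ 2 * C * (R ^ ε * |lastCoord x| ^ (β - 1 - ε)) := by
            gcongr; exact hpw x hx hxR _
        _ = 2 * C * R ^ ε * |lastCoord x| ^ (β - 1 - ε) := by ring
        _ ≤ _ := by gcongr; linarith [show 0 ≤ C * R ^ ε by positivity]
    · intro y _
      rw [increment_of_lt hs]
      refine (hf.holder x y hxR).trans ?_
      refine mul_le_mul_of_nonneg_right ?_ (by positivity)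
      calc C = C * |lastCoord x| ^ (β - β) := by simp
        _ ≤ C * (R ^ ε * |lastCoord x| ^ (β - β - ε)) := by gcongr; exact hpw x hx hxR _
        _ = C * R ^ ε * |lastCoord x| ^ (β - β - ε) := by ring
        _ ≤ _ := by gcongr; linarith [show 0 ≤ C * R ^ ε by positivity]
  · subst hs
    have hε1 := hε1 rfl
    -- For s = 1/2 the gradient term is present on d/2 ≤ |y| < 1, where exponent 1 would be the
    -- borderline one and would produce log d. Taking 1 - ε outside pays for the logarithm with a
    -- factor d^(-ε); ε ≤ 1 - β makes |y|^(β-1+ε) nonincreasing.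
    refine ⟨C * R ^ ε + 2 * C * R * R ^ ε + (2 * C * R ^ ε + C), 2, 1 - ε, by positivity,
      by norm_num, by linarith, fun x hx hxR => ⟨?_, ?_⟩⟩
    · intro y hy
      have hd : 0 < |lastCoord x| := abs_pos.2 hx
      rw [Real.rpow_two]
      have h0 : |increment (1 / 2) f x y| ≤ (C + 2 * C * R) * |lastCoord x| ^ (β - 2) * ‖y‖ ^ 2 := by
        -- Half the distance to the hyperplane may exceed 1, where the cutoff has removed the
        -- gradient. There the Lipschitz bound and |y| ≤ |y|² suffice.
        rcases lt_or_ge ‖y‖ 1 with h1 | h1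
        · rw [increment_half_of_lt h1]
          refine (hf.taylor x y hx hxR hy.le).trans ?_
          have : C ≤ C + 2 * C * R := by linarith [show 0 ≤ 2 * C * R by positivity]
          gcongr
        · rw [increment_half_of_ge h1]
          refine (hf.lip hβ hβ1 hx hxR y).trans ?_
          have e : |lastCoord x| ^ (β - 1) = |lastCoord x| * |lastCoord x| ^ (β - 2) := by
            rw [show β - 1 = 1 + (β - 2) by ring, Real.rpow_add hd, Real.rpow_one]
          calc 2 * C * |lastCoord x| ^ (β - 1) * ‖y‖
              ≤ 2 * C * (R * |lastCoord x| ^ (β - 2)) * ‖y‖ ^ 2 := by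
                rw [e]; gcongr; exact le_self_pow₀ h1 (by norm_num)
            _ = 2 * C * R * |lastCoord x| ^ (β - 2) * ‖y‖ ^ 2 := by ring
            _ ≤ _ := by gcongr; linarith
      refine h0.trans ?_
      refine mul_le_mul_of_nonneg_right ?_ (by positivity)
      calc (C + 2 * C * R) * |lastCoord x| ^ (β - 2)
          ≤ (C + 2 * C * R) * (R ^ ε * |lastCoord x| ^ (β - 2 - ε)) := by
            gcongr; exact hpw x hx hxR _
        _ = (C * R ^ ε + 2 * C * R * R ^ ε) * |lastCoord x| ^ (β - 2 - ε) := by ring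
        _ ≤ _ := mul_le_mul_of_nonneg_right
            (by linarith [show 0 ≤ 2 * C * R ^ ε + C by positivity]) (by positivity)
    · intro y hy
      have hd : 0 < |lastCoord x| := abs_pos.2 hx
      have hy0 : 0 < ‖y‖ := by linarith
      set d := |lastCoord x| with hdd
      have h1 : |f x - f (x + y)| ≤ 2 * C * R ^ ε * d ^ (β - 1) * ‖y‖ ^ (1 - ε) := by
        refine (hf.holder x y hxR).trans ?_
        have e : ‖y‖ ^ β = ‖y‖ ^ (β - 1 + ε) * ‖y‖ ^ (1 - ε) := by
          rw [← Real.rpow_add hy0]; ring_nf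
        have h2 : ‖y‖ ^ (β - 1 + ε) ≤ (d / 2) ^ (β - 1 + ε) :=
          Real.rpow_le_rpow_of_nonpos (by positivity) hy (by linarith)
        have h3 : (d / 2) ^ (β - 1 + ε) ≤ 2 * d ^ (β - 1 + ε) := by
          rw [Real.div_rpow hd.le (by norm_num), div_eq_mul_inv, ← Real.rpow_neg (by norm_num),
            mul_comm]
          gcongr
          calc (2 : ℝ) ^ (-(β - 1 + ε)) ≤ 2 ^ (1 : ℝ) :=
                Real.rpow_le_rpow_of_exponent_le (by norm_num) (by linarith)
            _ = 2 := Real.rpow_one _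
        have h4 := hpw x hx hxR (β - 1 + ε)
        rw [add_sub_cancel_right] at h4
        rw [e, ← mul_assoc]
        refine mul_le_mul_of_nonneg_right ?_ (by positivity)
        calc C * ‖y‖ ^ (β - 1 + ε) ≤ C * (2 * (R ^ ε * d ^ (β - 1))) := by
              gcongr
              exact (h2.trans h3).trans (by gcongr)
          _ = _ := by ring
      have h2 : |increment (1 / 2) f x y| ≤ (2 * C * R ^ ε + C) * d ^ (β - 1) * ‖y‖ ^ (1 - ε) := by
        rcases lt_or_ge ‖y‖ 1 with h3 | h3
        · rw [increment_half_of_lt h3]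
          refine (abs_add_le _ _).trans ((add_le_add h1 (hgrad x hx hxR y)).trans ?_)
          have h4 : ‖y‖ ≤ ‖y‖ ^ (1 - ε) := by
            simpa using Real.rpow_le_rpow_of_exponent_ge hy0 h3.le (by linarith : 1 - ε ≤ 1)
          calc _ ≤ 2 * C * R ^ ε * d ^ (β - 1) * ‖y‖ ^ (1 - ε)
                + C * d ^ (β - 1) * ‖y‖ ^ (1 - ε) := by gcongr
            _ = _ := by ring
        · rw [increment_half_of_ge h3]
          refine h1.trans ?_
          gcongr
          linarith
      refine h2.trans ?_
      rw [show β - (1 - ε) - ε = β - 1 by ring]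
      refine mul_le_mul_of_nonneg_right (mul_le_mul_of_nonneg_right ?_ (by positivity))
        (by positivity)
      linarith [show 0 ≤ C * R ^ ε + 2 * C * R * R ^ ε by positivity]
  · refine ⟨3 * C * R ^ ε, 2, 1, by positivity, by linarith, by linarith, fun x hx hxR => ⟨?_, ?_⟩⟩
    · intro y hy
      rw [increment_of_gt hs, Real.rpow_two]
      refine (hf.taylor x y hx hxR hy.le).trans ?_
      refine mul_le_mul_of_nonneg_right ?_ (by positivity)
      calc C * |lastCoord x| ^ (β - 2) ≤ C * (R ^ ε * |lastCoord x| ^ (β - 2 - ε)) := by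
            gcongr; exact hpw x hx hxR _
        _ = C * R ^ ε * |lastCoord x| ^ (β - 2 - ε) := by ring
        _ ≤ _ := by gcongr; linarith
    · intro y _
      rw [increment_of_gt hs, Real.rpow_one]
      refine (abs_add_le _ _).trans ((add_le_add (hf.lip hβ hβ1 hx hxR y)
        (hgrad x hx hxR y)).trans ?_)
      rw [← add_mul]
      refine mul_le_mul_of_nonneg_right ?_ (norm_nonneg _)
      calc 2 * C * |lastCoord x| ^ (β - 1) + C * |lastCoord x| ^ (β - 1)
          = 3 * C * |lastCoord x| ^ (β - 1) := by ring
        _ ≤ 3 * C * (R ^ ε * |lastCoord x| ^ (β - 1 - ε)) := by gcongr; exact hpw x hx hxR _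
        _ = _ := by ring

/-- Integrating |y|^i inside and |y|^a outside the ball of radius d/2 against K gives d^(i-2s) and
d^(a-2s) up to constants. Both pieces therefore scale as d^(β-2s-ε), whatever i and a are. -/
lemma exists_lintegral_increment_le {β R C ε : ℝ} {f : Space m → ℝ}
    (hK : IsStableKernel s lam Lam K b) (hs1 : s < 1)
    (hf : BdryRegular β R C f) (hβ : 0 < β) (hβ1 : β ≤ 1) (hβs : β < 2 * s) (hR : 0 < R)
    (hε : 0 < ε) (hε1 : s = 1 / 2 → ε ≤ 1 - β) :
    ∃ M, 0 ≤ M ∧ ∀ x, lastCoord x ≠ 0 → |lastCoord x| ≤ R →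
      ∫⁻ y, ENNReal.ofReal |increment s f x y| ∂(kernelMeasure K) ≤
        ENNReal.ofReal (M * |lastCoord x| ^ (β - 2 * s - ε)) := by
  obtain ⟨A, i, a, hA, hi, ha, h⟩ := exists_increment_bound hs1 hf hβ hβ1 hβs hR hε hε1
  set S := (spectralMeasure K univ).toReal
  have hS : 0 ≤ S := ENNReal.toReal_nonneg
  have hi' : 0 < i - 2 * s := by linarith
  have ha' : 0 < 2 * s - a := by linarith
  refine ⟨S * (A * ((1 / 2) ^ (i - 2 * s) / (i - 2 * s)) +
    A * ((1 / 2) ^ (a - 2 * s) / (2 * s - a))), by positivity, fun x hx hxR => ?_⟩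
  obtain ⟨h1, h2⟩ := h x hx hxR
  have hd : 0 < |lastCoord x| := abs_pos.2 hx
  set d := |lastCoord x|
  refine (lintegral_kernelMeasure_le hK (half_pos hd) hi ha (by positivity) (by positivity)
    h1 h2).trans (ENNReal.ofReal_le_ofReal (le_of_eq ?_))
  rw [div_eq_mul_one_div d 2, Real.mul_rpow hd.le (by norm_num),
    Real.mul_rpow hd.le (by norm_num),
    show β - i - ε = (β - 2 * s - ε) - (i - 2 * s) by ring,
    show β - a - ε = (β - 2 * s - ε) - (a - 2 * s) by ring,
    Real.rpow_sub hd (β - 2 * s - ε) (i - 2 * s), Real.rpow_sub hd (β - 2 * s - ε) (a - 2 * s)]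
  have p1 := (Real.rpow_pos_of_pos hd (i - 2 * s)).ne'
  have p2 := (Real.rpow_pos_of_pos hd (a - 2 * s)).ne'
  field_simp
  exact mul_comm _ _

lemma integrable_increment {β R C : ℝ} {f : Space m → ℝ}
    (hK : IsStableKernel s lam Lam K b) (hs1 : s < 1)
    (hf : BdryRegular β R C f) (hβ : 0 < β) (hβ1 : β ≤ 1) (hβs : β < 2 * s) (hR : 0 < R)
    {x : Space m} (hx : lastCoord x ≠ 0) (hxR : |lastCoord x| ≤ R) :
    Integrable (increment s f x) (kernelMeasure K) := by
  obtain ⟨ε, hε, hε1⟩ : ∃ ε, 0 < ε ∧ (s = 1 / 2 → ε ≤ 1 - β) := by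
    by_cases h : s = 1 / 2
    · exact ⟨1 - β, by rw [h] at hβs; linarith, fun _ => le_rfl⟩
    · exact ⟨1, one_pos, fun h' => absurd h' h⟩
  obtain ⟨M, _, hM⟩ := exists_lintegral_increment_le hK hs1 hf hβ hβ1 hβs hR hε hε1
  refine ⟨(measurable_increment_right hf.continuous x).aestronglyMeasurable, ?_⟩
  rw [hasFiniteIntegral_iff_norm]
  exact (hM x hx hxR).trans_lt ENNReal.ofReal_lt_top

end Operator

/-! ### Agreement with the pointwise definition, principal value included -/

section PointwiseOperator

lemma kernelMeasure_compl_ball_lt_top (hK : IsStableKernel s lam Lam K b) (hs : 0 < s) {ρ : ℝ}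
    (hρ : 0 < ρ) : kernelMeasure K (Metric.ball 0 ρ)ᶜ < ⊤ := by
  have hF : Integrable ((Metric.ball (0 : Space m) ρ)ᶜ.indicator fun _ => (1 : ℝ))
      (kernelMeasure K) := by
    refine integrable_kernelMeasure_of_le hK (A₁ := 0) (A₂ := 1) (i := 2 * s + 1) (a := 0)
      ((measurable_const.indicator measurableSet_ball.compl).aestronglyMeasurable) hρ (by linarith)
      (by linarith) le_rfl zero_le_one ?_ ?_
    · intro y hy
      simp [hy]
    · intro y hy
      simp [not_lt.2 hy]
  rw [integrable_indicator_iff measurableSet_ball.compl, integrableOn_const_iff] at hF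
  simpa using hF

lemma abs_powMul_le_of_testBounds {N ρ β : ℝ} {η : Space m → ℝ} (hη : TestBounds N ρ η)
    (hβ : 0 < β) : ∀ x, |powMul β η x| ≤ ρ ^ β * N := by
  intro x
  have hN := hη.nonneg
  have hρ := hη.pos
  by_cases h : η x = 0
  · rw [powMul_eq, h, mul_zero, abs_zero]; positivity
  · have hx : ‖x‖ ≤ ρ := by
      by_contra hlt
      exact h (hη.support x (not_le.1 hlt))
    rw [powMul_eq, abs_mul, abs_of_nonneg (posPow_nonneg _ _)]
    gcongr
    · exact posPow_le hβ hρ.le (((le_abs_self _).trans (abs_lastCoord_le x)).trans hx)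
    · exact hη.bound x

/-- The first moment of the kernel over annuli vanishes in the critical case. -/
lemma integral_annulus_linear (hK : IsStableKernel (1 / 2) lam Lam K b) (ℓ : Space m →L[ℝ] ℝ)
    {ε : ℝ} (hε : 0 < ε) :
    Integrable ({y : Space m | ε ≤ ‖y‖ ∧ ‖y‖ < 1}.indicator ℓ) (kernelMeasure K) ∧
    ∫ y, {y : Space m | ε ≤ ‖y‖ ∧ ‖y‖ < 1}.indicator ℓ y ∂(kernelMeasure K) = 0 := by
  set A : Set (Space m) := {y : Space m | ε ≤ ‖y‖ ∧ ‖y‖ < 1} with hA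
  have hAm : MeasurableSet A :=
    (measurableSet_le measurable_const measurable_norm).inter
      (measurableSet_lt measurable_norm measurable_const)
  have hint : Integrable (A.indicator ℓ) (kernelMeasure K) := by
    refine integrable_kernelMeasure_of_le hK (A₁ := 0) (A₂ := ‖ℓ‖) (i := 2) (a := 0)
      ((ℓ.continuous.measurable.indicator hAm).aestronglyMeasurable) hε (by norm_num)
      (by norm_num) le_rfl (norm_nonneg _) ?_ ?_
    · intro y hy
      rw [indicator_of_notMem (fun h : y ∈ A => absurd h.1 (not_le.2 hy))]
      simp
    · intro y _
      rw [Real.rpow_zero, mul_one]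
      by_cases h : y ∈ A
      · rw [indicator_of_mem h]
        refine (ℓ.le_opNorm y).trans ?_
        exact mul_le_of_le_one_right (norm_nonneg _) h.2.le
      · rw [indicator_of_notMem h, abs_zero]; exact norm_nonneg _
  refine ⟨hint, ?_⟩
  rw [integral_polar hK hint]
  have e : ∀ θ : Sph m, ∫ r in Ioi (0 : ℝ), A.indicator ℓ (r • (θ : Space m)) *
      r ^ (-1 - 2 * (1 / 2) : ℝ) = ℓ θ * ∫ r in Ioi (0 : ℝ), (Ico ε 1).indicator (fun r => r) r *
        r ^ (-1 - 2 * (1 / 2) : ℝ) := by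
    intro θ
    rw [← integral_const_mul]
    refine setIntegral_congr_fun measurableSet_Ioi fun r (hr : 0 < r) => ?_
    have hn : ‖r • (θ : Space m)‖ = r := by
      rw [norm_smul, norm_eq_of_mem_sphere, mul_one, Real.norm_of_nonneg hr.le]
    simp only [indicator, hA, mem_ofPred_eq, hn, mem_Ico]
    split_ifs
    · rw [map_smul, smul_eq_mul]; ring
    · simp
  simp_rw [e]
  rw [integral_mul_const]
  suffices h : ∫ θ : Sph m, ℓ θ ∂(spectralMeasure K) = 0 by rw [h, zero_mul]
  rw [spectralMeasure, integral_withDensity_eq_integral_toReal_smul₀ hK.aemeasurable_sphere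
    (by simp)]
  have e2 : ∀ θ : Sph m, (ENNReal.ofReal (K θ)).toReal • ℓ θ = ℓ (K θ • (θ : Space m)) := by
    intro θ
    rw [ENNReal.toReal_ofReal (hK.nonneg_sphere θ), map_smul]
  simp_rw [e2]
  rw [ContinuousLinearMap.integral_comp_comm, hK.cancellation rfl, map_zero]
  refine (hK.integrable_sphere.norm).mono' ?_ ?_
  · exact hK.integrable_sphere.aestronglyMeasurable.smul (by fun_prop)
  · refine Eventually.of_forall fun θ => ?_
    rw [norm_smul, norm_eq_of_mem_sphere, mul_one]

/-- The first moment of K over ε ≤ |y| < 1 vanishes, so the gradient correction may be inserted into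
the truncated integral for free. The compensated integrand is absolutely integrable, and the
principal value is its full integral by dominated convergence. -/
lemma tendsto_truncOp {f : Space m → ℝ} (hK : IsStableKernel (1 / 2) lam Lam K b)
    (hfc : Continuous f) {B : ℝ} (hB : ∀ x, |f x| ≤ B) {x : Space m}
    (hint : Integrable (increment (1 / 2) f x) (kernelMeasure K)) :
    (∀ ε : ℝ, 0 < ε → IntegrableOn (fun y => (f x - f (x + y)) * K y) (Metric.ball 0 ε)ᶜ) ∧
    Tendsto (truncOp K f x) (𝓝[>] 0) (𝓝 (∫ y, increment (1 / 2) f x y ∂(kernelMeasure K))) := by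
  have hm : Measurable fun y => f x - f (x + y) := Continuous.measurable (by fun_prop)
  have h1 : ∀ ε : ℝ, 0 < ε → Integrable ((Metric.ball (0 : Space m) ε)ᶜ.indicator
      fun y => f x - f (x + y)) (kernelMeasure K) := by
    intro ε hε
    rw [integrable_indicator_iff measurableSet_ball.compl]
    refine Measure.integrableOn_of_bounded (M := 2 * B)
      (kernelMeasure_compl_ball_lt_top hK (by norm_num) hε).ne hm.aestronglyMeasurable ?_
    refine Eventually.of_forall fun y => (abs_sub _ _).trans ?_
    linarith [hB x, hB (x + y)]
  have e1 : ∀ ε : ℝ, ∀ y, (Metric.ball (0 : Space m) ε)ᶜ.indicator (fun y => f x - f (x + y)) y * K y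
      = (Metric.ball (0 : Space m) ε)ᶜ.indicator (fun y => (f x - f (x + y)) * K y) y := by
    intro ε y
    simp only [indicator]
    split_ifs <;> simp
  refine ⟨fun ε hε => ?_, ?_⟩
  · rw [← integrable_indicator_iff measurableSet_ball.compl]
    have := (integrable_kernelMeasure_iff hK _).1 (h1 ε hε)
    simp_rw [e1] at this
    exact this
  · have h2 : ∀ ε : ℝ, 0 < ε → ε < 1 → truncOp K f x ε =
        ∫ y, (Metric.ball (0 : Space m) ε)ᶜ.indicator (increment (1 / 2) f x) y
          ∂(kernelMeasure K) := by
      intro ε hε hε1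
      -- This zero is what is added to the truncated integral to complete the compensated increment.
      obtain ⟨hA1, hA2⟩ := integral_annulus_linear hK (fderiv ℝ f x) hε
      have : truncOp K f x ε = ∫ y, (Metric.ball (0 : Space m) ε)ᶜ.indicator
          (fun y => f x - f (x + y)) y ∂(kernelMeasure K) := by
        rw [integral_kernelMeasure hK]
        simp_rw [e1]
        rw [integral_indicator measurableSet_ball.compl]
        rfl
      rw [this, ← add_zero (∫ y, _ ∂(kernelMeasure K)), ← hA2, ← integral_add (h1 ε hε) hA1]
      refine integral_congr_ae (Eventually.of_forall fun y => ?_)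
      simp only [indicator, mem_compl_iff, mem_ball_zero_iff, not_lt, mem_ofPred_eq]
      by_cases h : ε ≤ ‖y‖
      · by_cases h' : ‖y‖ < 1
        · rw [if_pos h, if_pos ⟨h, h'⟩, if_pos h, increment_half_of_lt h']
        · rw [if_pos h, if_neg (fun h'' => h' h''.2), if_pos h,
            increment_half_of_ge (not_lt.1 h'), add_zero]
      · rw [if_neg h, if_neg (fun h'' => h h''.1), if_neg h, add_zero]
    have h3 : Tendsto (fun ε : ℝ => ∫ y, (Metric.ball (0 : Space m) ε)ᶜ.indicator
        (increment (1 / 2) f x) y ∂(kernelMeasure K)) (𝓝[>] 0)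
        (𝓝 (∫ y, increment (1 / 2) f x y ∂(kernelMeasure K))) := by
      refine tendsto_integral_filter_of_dominated_convergence
        (fun y => ‖increment (1 / 2) f x y‖) ?_ ?_ hint.norm ?_
      · exact Eventually.of_forall fun ε =>
          hint.aestronglyMeasurable.indicator measurableSet_ball.compl
      · exact Eventually.of_forall fun ε => Eventually.of_forall fun y => norm_indicator_le_norm_self _ _
      · filter_upwards [compl_mem_ae_iff.2 (kernelMeasure_singleton_zero (K := K))] with y hy
        refine tendsto_const_nhds.congr' ?_
        have hy0 : 0 < ‖y‖ := norm_pos_iff.2 hy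
        filter_upwards [Ioo_mem_nhdsGT hy0] with ε hε
        rw [indicator_of_mem]
        simpa using hε.2.le
    refine h3.congr' ?_
    filter_upwards [Ioo_mem_nhdsGT (one_pos : (0:ℝ) < 1)] with ε hε
    exact (h2 ε hε.1 hε.2).symm

/-- Working with `regOp` gives the three ranges of s a common form in which Fubini and dominated
convergence apply. The principal value is handled only here. -/
lemma stableOp_eq_regOp {f : Space m → ℝ} (hK : IsStableKernel s lam Lam K b)
    (hfc : Continuous f) {B : ℝ} (hB : ∀ x, |f x| ≤ B) {x : Space m}
    (hd : DifferentiableAt ℝ f x) (hint : Integrable (increment s f x) (kernelMeasure K)) :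
    StableOpDefinedAt s K f x ∧ stableOp s K b f x = regOp s K b f x := by
  rcases lt_trichotomy s (1 / 2) with hs | hs | hs
  · have h1 := (integrable_kernelMeasure_iff hK _).1 hint
    simp_rw [increment_of_lt hs] at h1
    refine ⟨⟨fun _ => h1, fun h => absurd h hs.ne, fun h => absurd h hs.not_gt⟩, ?_⟩
    rw [stableOp, if_pos hs, regOp, integral_kernelMeasure hK, effDrift, if_neg hs.ne, map_zero,
      add_zero]
    simp_rw [increment_of_lt hs]
  · subst hs
    obtain ⟨h1, h2⟩ := tendsto_truncOp hK hfc hB hint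
    refine ⟨⟨fun h => absurd h (lt_irrefl _), fun _ => ⟨hd, h1, _, h2⟩,
      fun h => absurd h (lt_irrefl _)⟩, ?_⟩
    rw [stableOp, if_neg (lt_irrefl _), if_pos rfl, regOp, h2.limUnder_eq, effDrift, if_pos rfl]
  · have h1 := (integrable_kernelMeasure_iff hK _).1 hint
    simp_rw [increment_of_gt hs] at h1
    refine ⟨⟨fun h => absurd h hs.not_gt, fun h => absurd h hs.ne', fun _ => ⟨hd, h1⟩⟩, ?_⟩
    rw [stableOp, if_neg hs.not_gt, if_neg hs.ne', regOp, integral_kernelMeasure hK, effDrift,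
      if_neg hs.ne', map_zero, add_zero]
    simp_rw [increment_of_gt hs]

end PointwiseOperator

end

/-! ### The operator annihilates the matched power of x_n -/

section

variable {m : ℕ} {s lam Lam : ℝ} {K : Space m → ℝ} {b : Space m}

section Profile

/-- The integral of `(θ_n)_+^(2s)` against the spectral measure. -/
def fluxPlus (s : ℝ) (K : Space m → ℝ) : ℝ :=
  ∫ θ : Sph m, posPow (2 * s) (lastCoord (θ : Space m)) ∂(spectralMeasure K)

/-- The integral of `(-θ_n)_+^(2s)` against the spectral measure. -/
def fluxMinus (s : ℝ) (K : Space m → ℝ) : ℝ :=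
  ∫ θ : Sph m, posPow (2 * s) (-lastCoord (θ : Space m)) ∂(spectralMeasure K)

/-- The exponent `β` annihilated by the operator: `L (x_n)_+^β = 0` in the half space. -/
structure IsMatched (s : ℝ) (K : Space m → ℝ) (b : Space m) (β : ℝ) : Prop where
  ne_half : s ≠ 1 / 2 →
    fluxPlus s K * Real.sin (Real.pi * β) = fluxMinus s K * Real.sin (Real.pi * (2 * s - β))
  half : s = 1 / 2 → fluxMinus s K = fluxPlus s K ∧
    fluxPlus s K * Real.pi * Real.cos (Real.pi * β) +
      (∫ θ : Sph m, lastCoord (θ : Space m) * Real.log |lastCoord (θ : Space m)|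
        ∂(spectralMeasure K) + lastCoord b) * Real.sin (Real.pi * β) = 0

lemma abs_lastCoord_sphere_le (θ : Sph m) : |lastCoord (θ : Space m)| ≤ 1 := by
  simpa using abs_lastCoord_le (θ : Space m)

lemma measurable_posPow (β : ℝ) : Measurable (posPow β) := by
  unfold posPow; fun_prop

lemma integrable_spectral_of_bound (hK : IsStableKernel s lam Lam K b) {g : Sph m → ℝ} {B : ℝ}
    (hg : Measurable g) (hB : ∀ θ, |g θ| ≤ B) : Integrable g (spectralMeasure K) := by
  have := hK.isFiniteMeasure_spectral
  exact Integrable.of_bound hg.aestronglyMeasurable B (Eventually.of_forall hB)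

lemma abs_posPow_le_one {β t : ℝ} (hβ : 0 < β) (ht : t ≤ 1) : |posPow β t| ≤ 1 := by
  rw [abs_of_nonneg (posPow_nonneg _ _)]
  simpa using posPow_le hβ zero_le_one ht

lemma integrable_fluxPlus (hK : IsStableKernel s lam Lam K b) (hs : 0 < s) :
    Integrable (fun θ : Sph m => posPow (2 * s) (lastCoord (θ : Space m))) (spectralMeasure K) :=
  integrable_spectral_of_bound hK ((measurable_posPow _).comp (by fun_prop)) fun θ =>
    abs_posPow_le_one (by linarith) ((le_abs_self _).trans (abs_lastCoord_sphere_le θ))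

lemma integrable_fluxMinus (hK : IsStableKernel s lam Lam K b) (hs : 0 < s) :
    Integrable (fun θ : Sph m => posPow (2 * s) (-lastCoord (θ : Space m))) (spectralMeasure K) :=
  integrable_spectral_of_bound hK ((measurable_posPow _).comp (by fun_prop)) fun θ =>
    abs_posPow_le_one (by linarith) ((neg_le_abs _).trans (abs_lastCoord_sphere_le θ))

lemma integral_Ioi_scale {s c : ℝ} (hc : 0 < c) (g : ℝ → ℝ) :
    ∫ r in Ioi (0 : ℝ), g (c * r) * r ^ (-1 - 2 * s)
      = c ^ (2 * s) * ∫ t in Ioi (0 : ℝ), g t * t ^ (-1 - 2 * s) := by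
  have h := integral_comp_mul_left_Ioi (fun t => g t * t ^ (-1 - 2 * s)) 0 hc
  rw [mul_zero, smul_eq_mul] at h
  have e : ∀ r ∈ Ioi (0 : ℝ), g (c * r) * r ^ (-1 - 2 * s)
      = c ^ (1 + 2 * s) * (g (c * r) * (c * r) ^ (-1 - 2 * s)) := by
    intro r (hr : 0 < r)
    rw [Real.mul_rpow hc.le hr.le, show -1 - 2 * s = -(1 + 2 * s) by ring, Real.rpow_neg hc.le]
    have := (Real.rpow_pos_of_pos hc (1 + 2 * s)).ne'
    field_simp
  rw [setIntegral_congr_fun measurableSet_Ioi e, integral_const_mul, h, ← mul_assoc,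
    Real.rpow_add hc, Real.rpow_one]
  field_simp

/-- The increment of the profile in a direction `θ`. -/
lemma increment_profile_polar {β : ℝ} (hβ : 0 < β) {x : Space m} (hx : 0 < lastCoord x)
    (θ : Sph m) {r : ℝ} (hr : 0 < r) :
    increment s (fun x : Space m => posPow β (lastCoord x)) x (r • (θ : Space m)) =
      lastCoord x ^ β - posPow β (lastCoord x + r * lastCoord (θ : Space m)) +
        gradCutoff s r * (β * lastCoord x ^ (β - 1) * (r * lastCoord (θ : Space m))) := by
  rw [increment, (hasFDerivAt_posPow_lastCoord hβ hx.ne').fderiv, norm_smul, norm_eq_of_mem_sphere,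
    mul_one, Real.norm_of_nonneg hr.le, posPow_of_pos hx, lastCoord_add, lastCoord_smul]
  congr 2
  rw [posPowDeriv, if_pos hx]
  rfl

lemma posPow_add_mul {β d c : ℝ} (hd : 0 < d) {r : ℝ} (hr : 0 < r) (hc : 0 < c) :
    posPow β (d + r * c) = d ^ β * (1 + c / d * r) ^ β := by
  rw [posPow_of_pos (by positivity), ← Real.mul_rpow hd.le (by positivity)]
  congr 1
  field_simp

lemma posPow_sub_mul {β d c : ℝ} (hβ : 0 < β) (hd : 0 < d) {r : ℝ} :
    posPow β (d - r * c) = d ^ β * truncPow β (c / d * r) := by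
  rw [truncPow_eq_max hβ, posPow, ← Real.mul_rpow hd.le (le_max_right _ _), mul_max_of_nonneg _ _ hd.le,
    mul_zero]
  congr 2
  field_simp

lemma rpow_mul_div_rpow {β d c : ℝ} (hd : 0 < d) (hc : 0 < c) :
    d ^ β * (c / d) ^ (2 * s) = d ^ (β - 2 * s) * c ^ (2 * s) := by
  rw [Real.div_rpow hc.le hd.le, Real.rpow_sub hd]
  ring

/-- Along the ray in direction θ the profile is d^β (1 ± ct)_+^β with c = |θ_n|/d. Rescaling t
factors out d^(β-2s) |θ_n|^(2s) and leaves a constant that depends only on the sign of θ_n. Summing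
over θ gives F₊ Ip + F₋ Im, which vanishes by matching. -/
lemma regOp_profile_of_ne_half (hK : IsStableKernel s lam Lam K b) (hs0 : 0 < s) (hs1 : s < 1)
    (hs : s ≠ 1 / 2) {β : ℝ} (hβ : 0 < β) (hβs : β < 2 * s) (hm : IsMatched s K b β)
    {x : Space m} (hx : 0 < lastCoord x)
    (hint : Integrable (increment s (fun x : Space m => posPow β (lastCoord x)) x)
      (kernelMeasure K)) :
    regOp s K b (fun x : Space m => posPow β (lastCoord x)) x = 0 := by
  -- The cutoff is the constant 0 or 1 according to whether s is below or above 1/2. Naming it c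
  -- lets both ranges share the ray computation.
  obtain ⟨c, Ip, Im, hc, hIp, hIm, hI⟩ : ∃ c Ip Im : ℝ, (∀ r, gradCutoff s r = c) ∧
      (∫ t in Ioi (0 : ℝ), (1 - (1 + t) ^ β + c * (β * t)) * t ^ (-1 - 2 * s) = Ip) ∧
      (∫ t in Ioi (0 : ℝ), (1 - truncPow β t - c * (β * t)) * t ^ (-1 - 2 * s) = Im) ∧
      fluxPlus s K * Ip = -(fluxMinus s K * Im) := by
    have hk := hm.ne_half hs
    rcases lt_or_gt_of_ne hs with h | h
    · refine ⟨0, _, _, fun r => by rw [gradCutoff, if_pos h], rfl, rfl, ?_⟩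
      simpa using power_constants_cancel_of_lt h hβ hβs hk
    · refine ⟨1, _, _, fun r => by rw [gradCutoff, if_neg h.not_gt, if_neg h.ne'], rfl, rfl, ?_⟩
      simpa using power_constants_cancel_of_gt h hs1 hβ hβs hk
  rw [regOp, effDrift, if_neg hs, map_zero, add_zero, integral_polar hK hint]
  set d := lastCoord x with hd
  have inner : ∀ θ : Sph m, ∫ r in Ioi 0,
      increment s (fun x : Space m => posPow β (lastCoord x)) x (r • (θ : Space m)) *
        r ^ (-1 - 2 * s) = d ^ (β - 2 * s) * (posPow (2 * s) (lastCoord (θ : Space m)) * Ip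
          + posPow (2 * s) (-lastCoord (θ : Space m)) * Im) := by
    intro θ
    set q := lastCoord (θ : Space m)
    have hdm : d ^ (β - 1) = d ^ β * d⁻¹ := by rw [Real.rpow_sub_one hx.ne', div_eq_mul_inv]
    rcases lt_trichotomy q 0 with hq | hq | hq
    · have hq' : 0 < -q := by linarith
      rw [posPow_of_nonpos (by linarith) hq.le, posPow_of_pos hq', zero_mul, zero_add,
        ← mul_assoc, ← rpow_mul_div_rpow hx hq', mul_assoc, ← hIm,
        ← integral_Ioi_scale (div_pos hq' hx) (fun t => 1 - truncPow β t - c * (β * t)),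
        ← integral_const_mul]
      refine setIntegral_congr_fun measurableSet_Ioi fun r (hr : 0 < r) => ?_
      rw [increment_profile_polar hβ hx θ hr, hc, show d + r * q = d - r * (-q) by ring,
        posPow_sub_mul hβ hx, hdm]
      field_simp
      ring
    · rw [hq, neg_zero, posPow_of_nonpos (by linarith) le_rfl, zero_mul, zero_mul, add_zero, mul_zero]
      rw [setIntegral_congr_fun (g := fun _ => (0 : ℝ)) measurableSet_Ioi, integral_zero]
      intro r (hr : 0 < r)
      beta_reduce
      rw [increment_profile_polar hβ hx θ hr, show lastCoord (θ : Space m) = 0 from hq, mul_zero,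
        add_zero, posPow_of_pos hx]
      simp [hd]
    · rw [posPow_of_nonpos (by linarith) (by linarith : -q ≤ 0), posPow_of_pos hq, zero_mul, add_zero,
        ← mul_assoc, ← rpow_mul_div_rpow hx hq, mul_assoc, ← hIp,
        ← integral_Ioi_scale (div_pos hq hx) (fun t => 1 - (1 + t) ^ β + c * (β * t)),
        ← integral_const_mul]
      refine setIntegral_congr_fun measurableSet_Ioi fun r (hr : 0 < r) => ?_
      rw [increment_profile_polar hβ hx θ hr, hc, posPow_add_mul hx hr hq, hdm]
      field_simp
      ring
  simp_rw [inner]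
  rw [integral_const_mul, integral_add ((integrable_fluxPlus hK hs0).mul_const _)
    ((integrable_fluxMinus hK hs0).mul_const _), integral_mul_const, integral_mul_const]
  change d ^ (β - 2 * s) * (fluxPlus s K * Ip + fluxMinus s K * Im) = 0
  rw [hI]
  ring

/-- Rescaling a ray moves the cutoff from 1 to c, and the difference is the integral of dt/t between
them. This is the origin of the logarithm in the symbol at s = 1/2. -/
lemma integral_cutoff_diff {c : ℝ} (hc : 0 < c) :
    IntegrableOn (fun t : ℝ => ((if t < c then t else 0) - (if t < 1 then t else 0)) *
      t ^ (-1 - 2 * (1 / 2) : ℝ)) (Ioi 0) ∧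
    ∫ t in Ioi (0 : ℝ), ((if t < c then t else 0) - (if t < 1 then t else 0)) *
      t ^ (-1 - 2 * (1 / 2) : ℝ) = Real.log c := by
  have key : ∀ a b : ℝ, 0 < a → a ≤ b →
      IntegrableOn (fun t : ℝ => ((if t < b then t else 0) - (if t < a then t else 0)) *
        t ^ (-1 - 2 * (1 / 2) : ℝ)) (Ioi 0) ∧
      ∫ t in Ioi (0 : ℝ), ((if t < b then t else 0) - (if t < a then t else 0)) *
        t ^ (-1 - 2 * (1 / 2) : ℝ) = Real.log (b / a) := by
    intro a b ha hab
    have e : ∀ t ∈ Ioi (0 : ℝ), (Ico a b).indicator (fun t => t⁻¹) t =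
        ((if t < b then t else 0) - (if t < a then t else 0)) * t ^ (-1 - 2 * (1 / 2) : ℝ) := by
      intro t (ht : 0 < t)
      have e1 : t ^ (-1 - 2 * (1 / 2) : ℝ) = t⁻¹ * t⁻¹ := by
        rw [show (-1 - 2 * (1 / 2) : ℝ) = -1 + -1 by norm_num, Real.rpow_add ht, Real.rpow_neg_one]
      rw [e1]
      by_cases h1 : t < a
      · have h2 : t < b := h1.trans_le hab
        simp [indicator, h1, h2]
      · by_cases h2 : t < b
        · simp only [indicator, mem_Ico, h1, h2, not_lt.1 h1, if_true, if_false, and_self]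
          field_simp
          simp
        · simp [indicator, h1, h2]
    have hsub : Ico a b ∩ Ioi 0 = Ico a b := by
      rw [inter_eq_left]
      intro t ht
      exact ha.trans_le ht.1
    have hci : IntegrableOn (fun t : ℝ => t⁻¹) (Ico a b) := by
      refine (ContinuousOn.integrableOn_Icc ?_).mono_set Ico_subset_Icc_self
      intro t ht
      exact (continuousAt_inv₀ (ha.trans_le ht.1).ne').continuousWithinAt
    constructor
    · refine IntegrableOn.congr_fun ?_ e measurableSet_Ioi
      rw [IntegrableOn, integrable_indicator_iff measurableSet_Ico, IntegrableOn,
        Measure.restrict_restrict measurableSet_Ico, hsub]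
      exact hci
    · rw [← setIntegral_congr_fun measurableSet_Ioi e, integral_indicator measurableSet_Ico,
        Measure.restrict_restrict measurableSet_Ico, hsub, integral_Ico_eq_integral_Ioo,
        ← integral_Ioc_eq_integral_Ioo, ← intervalIntegral.integral_of_le hab,
        integral_inv_of_pos ha (ha.trans_le hab)]
  rcases le_total 1 c with h | h
  · have := key 1 c one_pos h
    rwa [div_one] at this
  · obtain ⟨h1, h2⟩ := key c 1 hc h
    have e : ∀ t : ℝ, ((if t < c then t else 0) - (if t < 1 then t else 0)) *
        t ^ (-1 - 2 * (1 / 2) : ℝ) = -(((if t < 1 then t else 0) - (if t < c then t else 0)) *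
        t ^ (-1 - 2 * (1 / 2) : ℝ)) := by
      intro t; ring
    simp_rw [e]
    refine ⟨h1.neg, ?_⟩
    rw [integral_neg, h2, one_div, Real.log_inv, neg_neg]

lemma abs_mul_log_abs_le {t : ℝ} (ht : |t| ≤ 1) : |t * Real.log (|t|)| ≤ 1 := by
  rcases eq_or_ne t 0 with h | h
  · simp [h]
  · have h1 := Real.abs_log_mul_self_lt |t| (abs_pos.2 h) ht
    rw [abs_mul, abs_abs] at h1
    rw [abs_mul, mul_comm]
    exact h1.le

/-- As for s ≠ 1/2, but each ray also contributes θ_n (log|θ_n| - log d) times β d^(β-1). The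
log|θ_n| terms combine with the drift into the imaginary part of the symbol, and the log d terms
cancel because the first moment vanishes. -/
lemma regOp_profile_half (hK : IsStableKernel (1 / 2) lam Lam K b)
    {β : ℝ} (hβ : 0 < β) (hβ1 : β < 1) (hm : IsMatched (1 / 2) K b β)
    {x : Space m} (hx : 0 < lastCoord x)
    (hint : Integrable (increment (1 / 2) (fun x : Space m => posPow β (lastCoord x)) x)
      (kernelMeasure K)) :
    regOp (1 / 2) K b (fun x : Space m => posPow β (lastCoord x)) x = 0 := by
  set d := lastCoord x with hd
  set Jp : ℝ → ℝ := fun c => ∫ t in Ioi (0 : ℝ), (1 - (1 + t) ^ β + β * (if t < c then t else 0)) *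
    t ^ (-1 - 2 * (1 / 2) : ℝ) with hJp
  set Jm : ℝ → ℝ := fun c => ∫ t in Ioi (0 : ℝ), (1 - truncPow β t - β * (if t < c then t else 0)) *
    t ^ (-1 - 2 * (1 / 2) : ℝ) with hJm
  have hJpc : ∀ c, 0 < c → Jp c = Jp 1 + β * Real.log c := by
    intro c hc
    obtain ⟨h1, h2⟩ := integral_cutoff_diff hc
    rw [hJp, ← h2, ← integral_const_mul,
      ← integral_add (integrableOn_one_add_rpow_cutoff hβ hβ1 one_pos) (h1.const_mul β)]
    refine setIntegral_congr_fun measurableSet_Ioi fun t _ => ?_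
    ring
  have hJmc : ∀ c, 0 < c → Jm c = Jm 1 - β * Real.log c := by
    intro c hc
    obtain ⟨h1, h2⟩ := integral_cutoff_diff hc
    rw [hJm, ← h2, ← integral_const_mul,
      ← integral_sub (integrableOn_truncPow_cutoff hβ hβ1 one_pos) (h1.const_mul β)]
    refine setIntegral_congr_fun measurableSet_Ioi fun t _ => ?_
    ring
  -- Only the sum of the two ray constants is known explicitly. It is all that is needed, since the
  -- two fluxes coincide at s = 1/2.
  have hJsum : Jp 1 + Jm 1 = Real.pi * β * (Real.cos (Real.pi * β) / Real.sin (Real.pi * β)) := by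
    rw [← (integral_symmetric_power hβ hβ1).2, hJp, hJm,
      ← integral_add (integrableOn_one_add_rpow_cutoff hβ hβ1 one_pos)
      (integrableOn_truncPow_cutoff hβ hβ1 one_pos)]
    refine setIntegral_congr_fun measurableSet_Ioi fun t _ => ?_
    ring
  have hcut : ∀ r : ℝ, gradCutoff (1 / 2) r = if r < 1 then 1 else 0 := by
    intro r
    rw [gradCutoff, if_neg (lt_irrefl _), if_pos rfl]
  rw [regOp, effDrift, if_pos rfl, integral_polar hK hint]
  have hdm : d ^ (β - 1) = d ^ β * d⁻¹ := by rw [Real.rpow_sub_one hx.ne', div_eq_mul_inv]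
  have inner : ∀ θ : Sph m, ∫ r in Ioi 0,
      increment (1 / 2) (fun x : Space m => posPow β (lastCoord x)) x (r • (θ : Space m)) *
        r ^ (-1 - 2 * (1 / 2) : ℝ) = d ^ (β - 1) *
        (posPow (2 * (1 / 2)) (lastCoord (θ : Space m)) * Jp 1
          + posPow (2 * (1 / 2)) (-lastCoord (θ : Space m)) * Jm 1 +
          (β * (lastCoord (θ : Space m) * Real.log |lastCoord (θ : Space m)|)
            - β * Real.log d * lastCoord (θ : Space m))) := by
    intro θ
    set q := lastCoord (θ : Space m)
    rcases lt_trichotomy q 0 with hq | hq | hq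
    · have hq' : 0 < -q := by linarith
      have e1 : ∫ r in Ioi 0,
          increment (1 / 2) (fun x : Space m => posPow β (lastCoord x)) x (r • (θ : Space m)) *
          r ^ (-1 - 2 * (1 / 2) : ℝ) = d ^ β * ((-q / d) ^ (2 * (1 / 2) : ℝ) * Jm (-q / d)) := by
        rw [hJm, ← integral_Ioi_scale (div_pos hq' hx) (fun t => 1 - truncPow β t -
          β * (if t < -q / d then t else 0)), ← integral_const_mul]
        refine setIntegral_congr_fun measurableSet_Ioi fun r (hr : 0 < r) => ?_
        rw [increment_profile_polar hβ hx θ hr, hcut, show d + r * q = d - r * (-q) by ring,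
          posPow_sub_mul hβ hx, hdm]
        have hiff : (-q / d * r < -q / d) ↔ r < 1 := by
          have := div_pos hq' hx
          constructor
          · intro h; by_contra h'; nlinarith
          · intro h; nlinarith
        simp only [hiff]
        split_ifs
        · field_simp
          ring
        · ring
      rw [e1, ← mul_assoc, rpow_mul_div_rpow hx hq', hJmc _ (div_pos hq' hx),
        Real.log_div hq'.ne' hx.ne', posPow_of_nonpos (by norm_num) hq.le, posPow_of_pos hq',
        abs_of_neg hq]
      rw [show (2 * (1 / 2) : ℝ) = 1 by norm_num, Real.rpow_one]
      ring
    · rw [hq, neg_zero, posPow_of_nonpos (by norm_num) le_rfl, zero_mul, zero_mul]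
      rw [setIntegral_congr_fun (g := fun _ => (0 : ℝ)) measurableSet_Ioi, integral_zero]
      · simp
      intro r (hr : 0 < r)
      beta_reduce
      rw [increment_profile_polar hβ hx θ hr, show lastCoord (θ : Space m) = 0 from hq, mul_zero,
        add_zero, posPow_of_pos hx]
      simp [hd]
    · have e1 : ∫ r in Ioi 0,
          increment (1 / 2) (fun x : Space m => posPow β (lastCoord x)) x (r • (θ : Space m)) *
          r ^ (-1 - 2 * (1 / 2) : ℝ) = d ^ β * ((q / d) ^ (2 * (1 / 2) : ℝ) * Jp (q / d)) := by
        rw [hJp, ← integral_Ioi_scale (div_pos hq hx) (fun t => 1 - (1 + t) ^ β +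
          β * (if t < q / d then t else 0)), ← integral_const_mul]
        refine setIntegral_congr_fun measurableSet_Ioi fun r (hr : 0 < r) => ?_
        rw [increment_profile_polar hβ hx θ hr, hcut, posPow_add_mul hx hr hq, hdm]
        have hiff : (q / d * r < q / d) ↔ r < 1 := by
          have := div_pos hq hx
          constructor
          · intro h; by_contra h'; nlinarith
          · intro h; nlinarith
        simp only [hiff]
        split_ifs
        · field_simp
          ring
        · ring
      rw [e1, ← mul_assoc, rpow_mul_div_rpow hx hq, hJpc _ (div_pos hq hx),
        Real.log_div hq.ne' hx.ne', posPow_of_nonpos (by norm_num) (by linarith : -q ≤ 0),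
        posPow_of_pos hq, abs_of_pos hq]
      rw [show (2 * (1 / 2) : ℝ) = 1 by norm_num, Real.rpow_one]
      ring
  simp_rw [inner]
  have i1 := integrable_fluxPlus hK (by norm_num : (0 : ℝ) < 1 / 2)
  have i2 := integrable_fluxMinus hK (by norm_num : (0 : ℝ) < 1 / 2)
  have i3 : Integrable (fun θ : Sph m => lastCoord (θ : Space m) *
      Real.log |lastCoord (θ : Space m)|) (spectralMeasure K) :=
    integrable_spectral_of_bound hK (by fun_prop) fun θ =>
      abs_mul_log_abs_le (abs_lastCoord_sphere_le θ)
  have i4 : Integrable (fun θ : Sph m => lastCoord (θ : Space m)) (spectralMeasure K) :=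
    integrable_spectral_of_bound hK (by fun_prop) abs_lastCoord_sphere_le
  obtain ⟨hk1, hk2⟩ := hm.half rfl
  -- This vanishing first moment removes the dependence on log d.
  have hzero : ∫ θ : Sph m, lastCoord (θ : Space m) ∂(spectralMeasure K) = 0 := by
    have : ∀ θ : Sph m, lastCoord (θ : Space m) =
        posPow (2 * (1 / 2)) (lastCoord (θ : Space m)) -
          posPow (2 * (1 / 2)) (-lastCoord (θ : Space m)) := by
      intro θ
      simp only [posPow]
      norm_num
    rw [integral_congr_ae (Eventually.of_forall this), integral_sub i1 i2]
    change fluxPlus (1 / 2) K - fluxMinus (1 / 2) K = 0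
    rw [hk1, sub_self]
  have j1 : Integrable (fun θ : Sph m => posPow (2 * (1 / 2)) (lastCoord (θ : Space m)) * Jp 1
      + posPow (2 * (1 / 2)) (-lastCoord (θ : Space m)) * Jm 1) (spectralMeasure K) :=
    (i1.mul_const _).add (i2.mul_const _)
  have j2 : Integrable (fun θ : Sph m => β * (lastCoord (θ : Space m) *
      Real.log |lastCoord (θ : Space m)|) - β * Real.log d * lastCoord (θ : Space m))
      (spectralMeasure K) := (i3.const_mul _).sub (i4.const_mul _)
  rw [integral_const_mul, integral_add j1 j2, integral_add (i1.mul_const _) (i2.mul_const _),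
    integral_sub (i3.const_mul _) (i4.const_mul _), integral_mul_const, integral_mul_const,
    integral_const_mul, integral_const_mul, hzero]
  change d ^ (β - 1) * (fluxPlus (1 / 2) K * Jp 1 + fluxMinus (1 / 2) K * Jm 1 + _) + _ = 0
  rw [hk1, (hasFDerivAt_posPow_lastCoord hβ hx.ne').fderiv]
  change _ + posPowDeriv β d * lastCoord b = 0
  rw [posPowDeriv, if_pos hx]
  have hsin : 0 < Real.sin (Real.pi * β) :=
    Real.sin_pos_of_pos_of_lt_pi (by positivity) (by nlinarith [Real.pi_pos])
  have e : fluxPlus (1 / 2) K * Jp 1 + fluxPlus (1 / 2) K * Jm 1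
      = fluxPlus (1 / 2) K * (Real.pi * β * (Real.cos (Real.pi * β) / Real.sin (Real.pi * β))) := by
    rw [← hJsum]; ring
  rw [e]
  set X := ∫ θ : Sph m, lastCoord (θ : Space m) * Real.log |lastCoord (θ : Space m)|
    ∂(spectralMeasure K)
  have hq : Real.cos (Real.pi * β) / Real.sin (Real.pi * β) * Real.sin (Real.pi * β)
      = Real.cos (Real.pi * β) := div_mul_cancel₀ _ hsin.ne'
  set q := Real.cos (Real.pi * β) / Real.sin (Real.pi * β)
  have hk3 : fluxPlus (1 / 2) K * Real.pi * q + X + lastCoord b = 0 := by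
    refine (mul_eq_zero.1 ?_).resolve_right hsin.ne'
    linear_combination hk2 + fluxPlus (1 / 2) K * Real.pi * hq
  linear_combination (d ^ (β - 1) * β) * hk3

lemma regOp_profile (hK : IsStableKernel s lam Lam K b) (hs0 : 0 < s) (hs1 : s < 1)
    {β : ℝ} (hβ : 0 < β) (hβs : β < 2 * s) (hm : IsMatched s K b β)
    {x : Space m} (hx : 0 < lastCoord x)
    (hint : Integrable (increment s (fun x : Space m => posPow β (lastCoord x)) x)
      (kernelMeasure K)) :
    regOp s K b (fun x : Space m => posPow β (lastCoord x)) x = 0 := by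
  by_cases hs : s = 1 / 2
  · subst hs
    exact regOp_profile_half hK hβ (by linarith) hm hx hint
  · exact regOp_profile_of_ne_half hK hs0 hs1 hs hβ hβs hm hx hint

end Profile

end

/-! ### Improved boundary bound for the matched exponent -/

section

variable {m : ℕ} {s lam Lam : ℝ} {K : Space m → ℝ} {b : Space m}

section BoundaryBound

/-- Interpolation between the Hölder and Lipschitz bounds: extra smallness |r|^a in the increment is
bought with a negative power of the distance. Use the derivative for |r| ≤ t/2 and the Hölder bound
beyond. -/
lemma exists_posPow_sub_le {β₀ R a : ℝ} (hβ₀ : 0 < β₀) (hR : 0 < R) (ha : min β₀ 1 ≤ a)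
    (ha1 : a ≤ 1) :
    ∃ D, 0 ≤ D ∧ ∀ t r : ℝ, 0 < t → t ≤ R → |r| ≤ 1 →
      |posPow β₀ t - posPow β₀ (t + r)| ≤ D * t ^ (min β₀ 1 - a) * |r| ^ a := by
  obtain ⟨C1, hC1, h1⟩ := exists_posPow_holder hβ₀ (by linarith : 0 < R + 1)
  obtain ⟨C2, hC2, h2⟩ := exists_posPow_taylor hβ₀
  set β := min β₀ 1 with hβdef
  have hβ : 0 < β := lt_min hβ₀ one_pos
  have hββ₀ : β ≤ β₀ := min_le_left _ _
  set A := (C2 + β₀) * R ^ (β₀ - β) with hA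
  have hA0 : 0 ≤ A := by positivity
  refine ⟨A + 2 * C1, by positivity, fun t r ht htR hr => ?_⟩
  rcases eq_or_ne r 0 with h0 | h0
  · rw [h0, add_zero, sub_self, abs_zero]
    positivity
  have hr0 : 0 < |r| := abs_pos.2 h0
  rcases le_or_gt |r| (t / 2) with h | h
  · have e1 := h2 t r ht.ne' (by rwa [abs_of_pos ht])
    rw [abs_of_pos ht] at e1
    have e2 : |posPowDeriv β₀ t * r| ≤ β₀ * t ^ (β₀ - 1) * |r| := by
      rw [abs_mul]
      have := abs_posPowDeriv_le (t := t) hβ₀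
      rw [abs_of_pos ht] at this
      gcongr
    have e3 : C2 * t ^ (β₀ - 2) * r ^ 2 ≤ C2 * t ^ (β₀ - 1) * |r| := by
      rw [← sq_abs, sq, ← mul_assoc, show β₀ - 1 = β₀ - 2 + 1 by ring, Real.rpow_add_one ht.ne',
        ← mul_assoc]
      gcongr
      linarith
    have e4 : t ^ (β₀ - 1) ≤ R ^ (β₀ - β) * t ^ (β - 1) := by
      have := rpow_le_const_mul_rpow ht htR (by linarith : β - 1 ≤ β₀ - 1)
      rwa [show β₀ - 1 - (β - 1) = β₀ - β by ring] at this
    have e5 : t ^ (β - 1) * |r| ≤ t ^ (β - a) * |r| ^ a := by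
      have e : t ^ (β - 1) * |r| = t ^ (β - a) * (t ^ (a - 1) * |r|) := by
        rw [← mul_assoc, ← Real.rpow_add ht]; ring_nf
      rw [e]
      gcongr
      have : t ^ (a - 1) ≤ |r| ^ (a - 1) :=
        Real.rpow_le_rpow_of_nonpos hr0 (by linarith) (by linarith)
      calc t ^ (a - 1) * |r| ≤ |r| ^ (a - 1) * |r| := by gcongr
        _ = |r| ^ a := by rw [← Real.rpow_add_one hr0.ne']; ring_nf
    calc |posPow β₀ t - posPow β₀ (t + r)|
        = |(posPow β₀ t - posPow β₀ (t + r) + posPowDeriv β₀ t * r) - posPowDeriv β₀ t * r| := by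
          ring_nf
      _ ≤ _ := abs_sub _ _
      _ ≤ C2 * t ^ (β₀ - 1) * |r| + β₀ * t ^ (β₀ - 1) * |r| := add_le_add (e1.trans e3) e2
      _ = (C2 + β₀) * t ^ (β₀ - 1) * |r| := by ring
      _ ≤ (C2 + β₀) * (R ^ (β₀ - β) * t ^ (β - 1)) * |r| := by gcongr
      _ = A * (t ^ (β - 1) * |r|) := by ring
      _ ≤ A * (t ^ (β - a) * |r| ^ a) := by gcongr
      _ ≤ (A + 2 * C1) * (t ^ (β - a) * |r| ^ a) := by gcongr; linarith
      _ = _ := by ring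
  · have e1 := h1 t (t + r) (by linarith) (by linarith [le_abs_self r])
    rw [sub_add_cancel_left, abs_neg] at e1
    have e2 : |r| ^ β ≤ 2 * t ^ (β - a) * |r| ^ a := by
      have e : |r| ^ β = |r| ^ (β - a) * |r| ^ a := by rw [← Real.rpow_add hr0]; ring_nf
      rw [e]
      gcongr
      have h3 : |r| ^ (β - a) ≤ (t / 2) ^ (β - a) :=
        Real.rpow_le_rpow_of_nonpos (by positivity) h.le (by linarith)
      refine h3.trans ?_
      rw [Real.div_rpow ht.le (by norm_num), div_eq_mul_inv, ← Real.rpow_neg (by norm_num), mul_comm]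
      gcongr
      calc (2 : ℝ) ^ (-(β - a)) ≤ 2 ^ (1 : ℝ) :=
            Real.rpow_le_rpow_of_exponent_le (by norm_num) (by linarith)
        _ = 2 := Real.rpow_one _
    calc _ ≤ C1 * |r| ^ β := e1
      _ ≤ C1 * (2 * t ^ (β - a) * |r| ^ a) := by gcongr
      _ = 2 * C1 * (t ^ (β - a) * |r| ^ a) := by ring
      _ ≤ (A + 2 * C1) * (t ^ (β - a) * |r| ^ a) := by gcongr; linarith
      _ = _ := by ring

/-- The part of the increment of `(x_n)_+^β τ` in which the increment falls on `τ`. -/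
def remainder (s β : ℝ) (τ : Space m → ℝ) (x y : Space m) : ℝ :=
  posPow β (lastCoord (x + y)) * (τ x - τ (x + y)) +
    gradCutoff s ‖y‖ * (posPow β (lastCoord x) * fderiv ℝ τ x y)

/-- Discrete product rule. The first term is the profile's increment, whose integral will vanish for
the matched exponent. Only the remainder then matters. -/
lemma increment_powMul {β : ℝ} (hβ : 0 < β) {τ : Space m → ℝ} (hτ : Differentiable ℝ τ)
    {x : Space m} (hx : lastCoord x ≠ 0) (y : Space m) :
    increment s (powMul β τ) x y =
      τ x * increment s (fun x : Space m => posPow β (lastCoord x)) x y + remainder s β τ x y := by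
  rw [increment, increment, remainder, (hasFDerivAt_powMul hβ (hτ x) hx).fderiv,
    (hasFDerivAt_posPow_lastCoord hβ hx).fderiv]
  simp only [powMul_eq, add_apply, smul_apply, smul_eq_mul]
  ring

/-- Every term carries a difference or a gradient of the smooth factor, which makes the remainder
less singular at the boundary than the full increment. The point is g < 2s - β: it makes the later
product with a derivative of order 2s - β - 1 integrable up to the boundary. -/
lemma exists_remainder_bound {β N ρ R : ℝ} {τ : Space m → ℝ} (hs0 : 0 < s) (hs1 : s < 1)
    (hβ : 0 < β) (hβs : β < 2 * s) (hτ : TestBounds N ρ τ) (hR : 0 < R) :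
    ∃ A i a g, 0 ≤ A ∧ 2 * s < i ∧ a < 2 * s ∧ 0 ≤ g ∧ g < 2 * s - β ∧ g < 1 ∧
      ∀ x, 0 < lastCoord x → lastCoord x ≤ R →
      (∀ y, ‖y‖ < 1 → |remainder s β τ x y| ≤ A * lastCoord x ^ (-g) * ‖y‖ ^ i) ∧
      (∀ y, 1 ≤ ‖y‖ → |remainder s β τ x y| ≤ A * ‖y‖ ^ a) := by
  have hN := hτ.nonneg
  have hp1 : ∀ x y : Space m, lastCoord x ≤ R → ‖y‖ ≤ 1 →
      posPow β (lastCoord (x + y)) ≤ (R + 1) ^ β := by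
    intro x y hx hy
    refine posPow_le hβ (by positivity) ?_
    rw [lastCoord_add]
    linarith [(le_abs_self _).trans (abs_lastCoord_le y)]
  have hp2 : ∀ x y : Space m, lastCoord x ≤ R → 1 ≤ ‖y‖ →
      posPow β (lastCoord (x + y)) ≤ (R + 1) ^ β * ‖y‖ ^ β := by
    intro x y hx hy
    rw [← Real.mul_rpow (by positivity) (norm_nonneg _)]
    refine posPow_le hβ (by positivity) ?_
    rw [lastCoord_add]
    nlinarith [(le_abs_self _).trans (abs_lastCoord_le y)]
  have hfar : ∀ x y : Space m, lastCoord x ≤ R → 1 ≤ ‖y‖ →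
      |posPow β (lastCoord (x + y)) * (τ x - τ (x + y))| ≤ (R + 1) ^ β * (2 * N) * ‖y‖ ^ β := by
    intro x y hx hy
    rw [abs_mul, abs_of_nonneg (posPow_nonneg _ _), mul_right_comm]
    gcongr
    · exact hp2 x y hx hy
    · refine (abs_sub _ _).trans ?_
      linarith [hτ.bound x, hτ.bound (x + y)]
  rcases lt_or_ge s (1 / 2) with hs | hs
  · have e : ∀ x y : Space m, remainder s β τ x y =
        posPow β (lastCoord (x + y)) * (τ x - τ (x + y)) := by
      intro x y
      rw [remainder, gradCutoff, if_pos hs, zero_mul, add_zero]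
    refine ⟨(R + 1) ^ β * (2 * N), 1, β, 0, by positivity, by linarith, hβs, le_rfl, by linarith,
      one_pos, fun x hx hxR => ⟨fun y hy => ?_, fun y hy => ?_⟩⟩
    · rw [e, neg_zero, Real.rpow_zero, mul_one, Real.rpow_one, abs_mul,
        abs_of_nonneg (posPow_nonneg _ _), mul_assoc]
      gcongr
      · exact hp1 x y hxR hy.le
      · refine (hτ.lip x y).trans ?_
        gcongr
        linarith
    · rw [e]
      exact hfar x y hxR hy
  · set β' := min β 1 with hβ'
    have hβ'0 : 0 < β' := lt_min hβ one_pos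
    have hβ'1 : β' ≤ 1 := min_le_right _ _
    -- The near-origin exponent is 1 + a: a > 2s - 1 gives integrability against K, and a - β' is
    -- the loss g at the boundary. For s > 1/2 take a = 1; for s = 1/2 take a = (1 + β)/2, since a =
    -- 1 would give g = 2s - β exactly.
    obtain ⟨a, haβ, ha1, has, hg1, hg2⟩ : ∃ a : ℝ, β' ≤ a ∧ a ≤ 1 ∧ 2 * s - 1 < a ∧
        a - β' < 2 * s - β ∧ a - β' < 1 := by
      rcases eq_or_lt_of_le hs with h | h
      · have hβ1 : β < 1 := by rw [← h] at hβs; linarith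
        have hb : β' = β := min_eq_left hβ1.le
        exact ⟨(1 + β) / 2, by linarith, by linarith, by linarith, by linarith, by linarith⟩
      · refine ⟨1, hβ'1, le_rfl, by linarith, ?_, by linarith⟩
        rcases le_total β 1 with h1 | h1
        · rw [hβ', min_eq_left h1]; linarith
        · rw [hβ', min_eq_right h1]; linarith
    obtain ⟨D, hD0, hD⟩ := exists_posPow_sub_le hβ hR haβ ha1
    -- The exponent at infinity has to dominate |y|^β, and also |y| when the gradient is not cut
    -- off, that is, for s > 1/2.
    obtain ⟨a₂, ha₂, ha₂β, ha₂1⟩ : ∃ a₂, a₂ < 2 * s ∧ β ≤ a₂ ∧ (s ≠ 1 / 2 → 1 ≤ a₂) := by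
      rcases eq_or_lt_of_le hs with h | h
      · exact ⟨β, hβs, le_rfl, fun h' => absurd h.symm h'⟩
      · exact ⟨max β 1, max_lt hβs (by linarith), le_max_left _ _, fun _ => le_max_right _ _⟩
    set A1 := (R + 1) ^ β * N * R ^ (a - β') + D * N with hA1
    set A2 := (R + 1) ^ β * (2 * N) + R ^ β * N with hA2
    have hA10 : 0 ≤ A1 := by positivity
    have hA20 : 0 ≤ A2 := by positivity
    refine ⟨A1 + A2, 1 + a, a₂, a - β', by positivity, by linarith, ha₂, by linarith, hg1, hg2,
      fun x hx hxR => ⟨fun y hy => ?_, fun y hy => ?_⟩⟩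
    · have hcut : gradCutoff s ‖y‖ = 1 := by
        rw [gradCutoff, if_neg (not_lt.2 hs)]
        split_ifs <;> rfl
      rcases (norm_nonneg y).eq_or_lt with h0 | h0
      · have : y = 0 := norm_eq_zero.1 h0.symm
        rw [remainder, this]
        simp only [add_zero, sub_self, mul_zero, map_zero, abs_zero]
        positivity
      have e : remainder s β τ x y = posPow β (lastCoord (x + y)) * (τ x - τ (x + y) + fderiv ℝ τ x y)
          + (posPow β (lastCoord x) - posPow β (lastCoord x + lastCoord y)) * fderiv ℝ τ x y := by
        rw [remainder, hcut, lastCoord_add]; ring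
      have hone : (1 : ℝ) ≤ R ^ (a - β') * lastCoord x ^ (-(a - β')) := by
        have := rpow_le_const_mul_rpow hx hxR (by linarith : -(a - β') ≤ 0)
        rwa [Real.rpow_zero, zero_sub, neg_neg] at this
      have hy2 : ‖y‖ ^ 2 ≤ ‖y‖ ^ (1 + a) := by
        rw [← Real.rpow_two]
        exact Real.rpow_le_rpow_of_exponent_ge h0 hy.le (by linarith)
      have b1 : |posPow β (lastCoord (x + y)) * (τ x - τ (x + y) + fderiv ℝ τ x y)| ≤
          (R + 1) ^ β * N * R ^ (a - β') * lastCoord x ^ (-(a - β')) * ‖y‖ ^ (1 + a) := by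
        rw [abs_mul, abs_of_nonneg (posPow_nonneg _ _)]
        calc _ ≤ (R + 1) ^ β * (N * ‖y‖ ^ (1 + a)) := by
              gcongr
              · exact hp1 x y hxR hy.le
              · exact (hτ.taylor x y).trans (by gcongr)
          _ ≤ (R + 1) ^ β * (N * ‖y‖ ^ (1 + a)) * (R ^ (a - β') * lastCoord x ^ (-(a - β'))) :=
              le_mul_of_one_le_right (by positivity) hone
          _ = _ := by ring
      have b2 : |(posPow β (lastCoord x) - posPow β (lastCoord x + lastCoord y)) * fderiv ℝ τ x y| ≤
          D * N * lastCoord x ^ (-(a - β')) * ‖y‖ ^ (1 + a) := by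
        rw [abs_mul]
        have hyn := abs_lastCoord_le y
        calc _ ≤ (D * lastCoord x ^ (β' - a) * |lastCoord y| ^ a) * (N * ‖y‖) := by
              gcongr
              · exact hD _ _ hx hxR (hyn.trans hy.le)
              · exact ((fderiv ℝ τ x).le_opNorm y).trans (by gcongr; exact hτ.grad x)
          _ ≤ (D * lastCoord x ^ (β' - a) * ‖y‖ ^ a) * (N * ‖y‖) := by
              have ha0 : 0 ≤ a := by linarith
              gcongr
          _ = _ := by
              rw [add_comm 1 a, Real.rpow_add_one h0.ne', neg_sub]; ring
      rw [e]
      refine (abs_add_le _ _).trans ((add_le_add b1 b2).trans ?_)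
      calc _ = A1 * lastCoord x ^ (-(a - β')) * ‖y‖ ^ (1 + a) := by ring
        _ ≤ _ := by gcongr; linarith
    · have hya : ‖y‖ ^ β ≤ ‖y‖ ^ a₂ := Real.rpow_le_rpow_of_exponent_le hy ha₂β
      have b1 : |posPow β (lastCoord (x + y)) * (τ x - τ (x + y))| ≤
          (R + 1) ^ β * (2 * N) * ‖y‖ ^ a₂ :=
        (hfar x y hxR hy).trans (by gcongr)
      have b2 : |gradCutoff s ‖y‖ * (posPow β (lastCoord x) * fderiv ℝ τ x y)| ≤
          R ^ β * N * ‖y‖ ^ a₂ := by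
        by_cases h : s = 1 / 2
        · rw [gradCutoff, if_neg (not_lt.2 hs), if_pos h, if_neg (not_lt.2 hy), zero_mul, abs_zero]
          positivity
        · have hya1 : ‖y‖ ≤ ‖y‖ ^ a₂ := by
            simpa using Real.rpow_le_rpow_of_exponent_le hy (ha₂1 h)
          rw [abs_mul, abs_mul, abs_of_nonneg (posPow_nonneg _ _), mul_assoc]
          refine (mul_le_of_le_one_left (mul_nonneg (posPow_nonneg _ _) (abs_nonneg _)) (abs_gradCutoff_le s _)).trans ?_
          gcongr
          · exact posPow_le hβ hR.le hxR
          · refine ((fderiv ℝ τ x).le_opNorm y).trans ?_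
            gcongr
            exact hτ.grad x
      rw [remainder]
      refine (abs_add_le _ _).trans ((add_le_add b1 b2).trans ?_)
      calc _ = A2 * ‖y‖ ^ a₂ := by ring
        _ ≤ _ := by gcongr; linarith

lemma measurable_remainder {β : ℝ} {τ : Space m → ℝ} (hτ : Continuous τ)
    (x : Space m) : Measurable (remainder s β τ x) := by
  unfold remainder
  refine Measurable.add (Measurable.mul ?_ ?_) (Measurable.mul ?_ ?_)
  · exact (measurable_posPow β).comp (by fun_prop)
  · exact Continuous.measurable (by fun_prop)
  · exact (measurable_gradCutoff s).comp (by fun_prop)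
  · exact ((fderiv ℝ τ x).continuous.measurable).const_mul _

/-- For the matched exponent the operator is less singular at the boundary than the scaling
suggests. -/
lemma exists_regOp_powMul_bound {β N ρ R : ℝ} {τ : Space m → ℝ}
    (hK : IsStableKernel s lam Lam K b) (hs0 : 0 < s) (hs1 : s < 1)
    (hβ : 0 < β) (hβs : β < 2 * s) (hm : IsMatched s K b β) (hτ : TestBounds N ρ τ) (hR : 0 < R) :
    ∃ M g, 0 ≤ M ∧ g < 2 * s - β ∧ g < 1 ∧ ∀ x, 0 < lastCoord x → lastCoord x ≤ R →
      |regOp s K b (powMul β τ) x| ≤ M * lastCoord x ^ (-g) := by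
  obtain ⟨A, i, a, g, hA, hi, ha, hg0, hg1, hg2, hrem⟩ :=
    exists_remainder_bound hs0 hs1 hβ hβs hτ hR
  obtain ⟨C, hC⟩ := exists_bdryRegular_powMul hβ hτ hR
  have hN := hτ.nonneg
  set S := (spectralMeasure K univ).toReal with hS
  have hS0 : 0 ≤ S := ENNReal.toReal_nonneg
  have hi' : 0 < i - 2 * s := by linarith
  have ha' : 0 < 2 * s - a := by linarith
  refine ⟨S * (A * (1 / (i - 2 * s)) + A * R ^ g * (1 / (2 * s - a))) +
    R ^ β * (N * ‖effDrift s b‖) * R ^ g, g, by positivity, hg1, hg2, fun x hx hxR => ?_⟩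
  obtain ⟨h1, h2⟩ := hrem x hx hxR
  have hβ'0 : 0 < min β 1 := lt_min hβ one_pos
  have hincr : Integrable (increment s (powMul β τ) x) (kernelMeasure K) :=
    integrable_increment hK hs1 hC hβ'0 (min_le_right _ _)
      ((min_le_left _ _).trans_lt hβs) hR hx.ne' (by rwa [abs_of_pos hx])
  have hremint : Integrable (remainder s β τ x) (kernelMeasure K) :=
    integrable_kernelMeasure_of_le hK
      (measurable_remainder hτ.differentiable.continuous x).aestronglyMeasurable one_pos hi ha
      (by positivity) hA h1 h2
  have hone : (1 : ℝ) ≤ R ^ g * lastCoord x ^ (-g) := by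
    have := rpow_le_const_mul_rpow hx hxR (by linarith : -g ≤ 0)
    rwa [Real.rpow_zero, zero_sub, neg_neg] at this
  have key : regOp s K b (powMul β τ) x = ∫ y, remainder s β τ x y ∂(kernelMeasure K) +
      posPow β (lastCoord x) * fderiv ℝ τ x (effDrift s b) := by
    have e := increment_powMul (s := s) hβ hτ.differentiable hx.ne'
    have hfd : fderiv ℝ (powMul β τ) x (effDrift s b) = posPow β (lastCoord x) *
        fderiv ℝ τ x (effDrift s b) + τ x *
        fderiv ℝ (fun x : Space m => posPow β (lastCoord x)) x (effDrift s b) := by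
      rw [(hasFDerivAt_powMul hβ (hτ.differentiable x) hx.ne').fderiv,
        (hasFDerivAt_posPow_lastCoord hβ hx.ne').fderiv]
      rfl
    rw [regOp, hfd]
    -- The profile is unbounded, so its increment is not covered by the bounds for compactly
    -- supported functions. Where τ(x) ≠ 0 its integrability follows by solving the product rule for
    -- it, and where τ(x) = 0 it does not enter.
    by_cases h0 : τ x = 0
    · simp_rw [e, h0, zero_mul, zero_add, add_zero]
    · have hprof : Integrable (increment s (fun x : Space m => posPow β (lastCoord x)) x)
          (kernelMeasure K) := by
        refine ((hincr.sub hremint).const_mul (τ x)⁻¹).congr (Eventually.of_forall fun y => ?_)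
        simp only [Pi.sub_apply]
        rw [e y, add_sub_cancel_right, inv_mul_cancel_left₀ h0]
      have hz := regOp_profile hK hs0 hs1 hβ hβs hm hx hprof
      rw [regOp] at hz
      simp_rw [e]
      rw [integral_add (hprof.const_mul _) hremint, integral_const_mul]
      linear_combination (τ x) * hz
  have hint : |∫ y, remainder s β τ x y ∂(kernelMeasure K)| ≤
      S * (A * lastCoord x ^ (-g) * (1 / (i - 2 * s)) + A * (1 / (2 * s - a))) := by
    have := lintegral_kernelMeasure_le hK one_pos hi ha (by positivity) hA h1 h2
    rw [Real.one_rpow, Real.one_rpow] at this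
    rw [← Real.norm_eq_abs]
    refine (norm_integral_le_lintegral_norm _).trans ?_
    exact ENNReal.toReal_le_of_le_ofReal (by positivity) this
  have hdr : |posPow β (lastCoord x) * fderiv ℝ τ x (effDrift s b)| ≤
      R ^ β * (N * ‖effDrift s b‖) := by
    rw [abs_mul, abs_of_nonneg (posPow_nonneg _ _)]
    gcongr
    · exact posPow_le hβ hR.le hxR
    · exact ((fderiv ℝ τ x).le_opNorm _).trans (by gcongr; exact hτ.grad x)
  rw [key]
  refine (abs_add_le _ _).trans ((add_le_add hint hdr).trans ?_)
  calc _ ≤ S * (A * lastCoord x ^ (-g) * (1 / (i - 2 * s)) +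
        A * (1 / (2 * s - a)) * (R ^ g * lastCoord x ^ (-g))) +
        R ^ β * (N * ‖effDrift s b‖) * (R ^ g * lastCoord x ^ (-g)) := by
        refine add_le_add (mul_le_mul_of_nonneg_left (add_le_add le_rfl
          (le_mul_of_one_le_right (by positivity) hone)) hS0)
          (le_mul_of_one_le_right (by positivity) hone)
    _ = _ := by ring

end BoundaryBound

end

/-! ### The adjoint kernel, the symbol at e_n and the fluxes -/

section

variable {m : ℕ} {s lam Lam : ℝ} {K : Space m → ℝ} {b : Space m}

section Adjoint

lemma adjKernel_apply (K : Space m → ℝ) (y : Space m) : adjKernel K y = K (-y) := by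
  rw [adjKernel, evenPart, oddPart]; ring

lemma adjKernel_adjKernel (K : Space m → ℝ) : adjKernel (adjKernel K) = K := by
  funext y; rw [adjKernel_apply, adjKernel_apply, neg_neg]

/-- The antipodal map of the sphere. -/
def antipode (m : ℕ) : Sph m ≃ᵐ Sph m where
  toFun θ := -θ
  invFun θ := -θ
  left_inv θ := neg_neg θ
  right_inv θ := neg_neg θ
  measurable_toFun := Continuous.measurable continuous_neg
  measurable_invFun := Continuous.measurable continuous_neg

lemma coe_antipode (θ : Sph m) : ((antipode m θ : Sph m) : Space m) = -(θ : Space m) := rfl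

-- The sphere measure of a set is computed from the volume of the cone over it, and volume is
-- invariant under y ↦ -y.
open scoped Pointwise in
lemma measurePreserving_antipode :
    MeasurePreserving (antipode m) (sphereMeasure m) (sphereMeasure m) := by
  refine ⟨(antipode m).measurable, Measure.ext fun A hA => ?_⟩
  rw [(antipode m).map_apply, sphereMeasure, Measure.toSphere_apply' _ hA,
    Measure.toSphere_apply' _ ((antipode m).measurable hA)]
  congr 1
  have : (Ioo (0 : ℝ) 1 • (Subtype.val '' (antipode m ⁻¹' A)) : Set (Space m)) =
      Neg.neg ⁻¹' (Ioo (0 : ℝ) 1 • (Subtype.val '' A) : Set (Space m)) := by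
    ext y
    simp only [Set.mem_smul, mem_image, mem_preimage]
    constructor
    · rintro ⟨r, hr, _, ⟨θ, hθ, rfl⟩, rfl⟩
      exact ⟨r, hr, _, ⟨_, hθ, rfl⟩, by rw [coe_antipode, smul_neg]⟩
    · rintro ⟨r, hr, _, ⟨θ, hθ, rfl⟩, h⟩
      refine ⟨r, hr, _, ⟨antipode m θ, ?_, rfl⟩, ?_⟩
      · rwa [show antipode m (antipode m θ) = θ from neg_neg θ]
      · rw [coe_antipode, smul_neg, h, neg_neg]
  rw [this]
  exact Measure.measure_preimage_neg _ _

lemma integral_sphere_neg {F : Type*} [NormedAddCommGroup F] [NormedSpace ℝ F] (g : Space m → F) :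
    ∫ θ : Sph m, g (-(θ : Space m)) ∂(sphereMeasure m) =
      ∫ θ : Sph m, g (θ : Space m) ∂(sphereMeasure m) :=
  measurePreserving_antipode.integral_comp (antipode m).measurableEmbedding
    (fun θ : Sph m => g (θ : Space m))

lemma IsStableKernel.adjoint (hK : IsStableKernel s lam Lam K b) :
    IsStableKernel s lam Lam (adjKernel K) (-b) where
  locallyIntegrable := by
    have hlc : IsLocallyClosed ({0}ᶜ : Set (Space m)) := isOpen_compl_singleton.isLocallyClosed
    have h := (locallyIntegrableOn_iff hlc).1 hK.locallyIntegrable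
    refine (locallyIntegrableOn_iff hlc).2 fun k hk hkc => ?_
    have h1 := h (-k) (fun y hy hy0 => hk hy (by simp_all)) hkc.neg
    have h2 := (Measure.measurePreserving_neg (volume : Measure (Space m))).integrableOn_comp_preimage
      (MeasurableEquiv.neg (Space m)).measurableEmbedding (f := K) (s := -k)
    have h3 := h2.2 h1
    rw [show (Neg.neg ⁻¹' (-k) : Set (Space m)) = k by ext; simp] at h3
    exact h3.congr_fun_ae (Eventually.of_forall fun y => (adjKernel_apply K y).symm)
  nonneg y hy := by
    rw [adjKernel_apply]; exact hK.nonneg _ (neg_ne_zero.2 hy)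
  homogeneous t y ht hy := by
    rw [adjKernel_apply, adjKernel_apply, ← smul_neg]
    exact hK.homogeneous t _ ht (neg_ne_zero.2 hy)
  cancellation hs := by
    have h := integral_sphere_neg (fun y : Space m => K (-y) • y)
    simp only [neg_neg, smul_neg] at h
    rw [integral_neg, hK.cancellation hs, neg_zero] at h
    simp_rw [adjKernel_apply]
    exact h.symm
  lam_pos := hK.lam_pos
  lam_le := hK.lam_le
  lower_bound ν hν := by
    refine (hK.lower_bound ν hν).trans_eq ?_
    rw [← integral_sphere_neg (fun y : Space m => |⟪ν, y⟫| ^ (2 * s) * K y)]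
    simp_rw [adjKernel_apply, inner_neg_right, abs_neg]
  upper_bound := by
    refine le_trans (le_of_eq ?_) hK.upper_bound
    rw [← integral_sphere_neg K]
    simp_rw [adjKernel_apply]
  drift_bound hs := by
    rw [norm_neg]; exact hK.drift_bound hs

lemma kernelMeasure_adjKernel (K : Space m → ℝ) :
    kernelMeasure (adjKernel K) = (kernelMeasure K).map (MeasurableEquiv.neg (Space m)) := by
  refine Measure.ext fun A hA => ?_
  rw [MeasurableEquiv.map_apply, kernelMeasure, kernelMeasure, withDensity_apply _ hA,
    withDensity_apply _ ((MeasurableEquiv.neg (Space m)).measurable hA)]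
  have h := (Measure.measurePreserving_neg (volume : Measure (Space m))).setLIntegral_comp_emb
    (MeasurableEquiv.neg (Space m)).measurableEmbedding (fun y => ENNReal.ofReal (K (-y)))
    (Neg.neg ⁻¹' A)
  simp only [neg_neg] at h
  rw [show Neg.neg '' (Neg.neg ⁻¹' A : Set (Space m)) = A from
    image_preimage_eq A neg_surjective] at h
  simp_rw [adjKernel_apply]
  exact h.symm

lemma integral_spectralMeasure (hK : IsStableKernel s lam Lam K b) (F : Sph m → ℝ) :
    ∫ θ, F θ ∂(spectralMeasure K) = ∫ θ : Sph m, F θ * K θ ∂(sphereMeasure m) := by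
  rw [spectralMeasure, integral_withDensity_eq_integral_toReal_smul₀ hK.aemeasurable_sphere
    (Eventually.of_forall fun _ => ENNReal.ofReal_lt_top)]
  refine integral_congr_ae (Eventually.of_forall fun θ => ?_)
  simp only [smul_eq_mul, ENNReal.toReal_ofReal (hK.nonneg_sphere θ), mul_comm]

lemma integrable_mul_kernel_sphere (hK : IsStableKernel s lam Lam K b) {F : Sph m → ℝ} {B : ℝ}
    (hF : Measurable F) (hB : ∀ θ, |F θ| ≤ B) :
    Integrable (fun θ : Sph m => F θ * K θ) (sphereMeasure m) :=
  hK.integrable_sphere.bdd_mul hF.aestronglyMeasurable (Eventually.of_forall hB)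

lemma integral_spectralMeasure_adjKernel (hK : IsStableKernel s lam Lam K b) (g : Space m → ℝ) :
    ∫ θ : Sph m, g θ ∂(spectralMeasure (adjKernel K)) =
      ∫ θ : Sph m, g (-(θ : Space m)) ∂(spectralMeasure K) := by
  rw [integral_spectralMeasure hK.adjoint, integral_spectralMeasure hK,
    ← integral_sphere_neg (fun y : Space m => g y * adjKernel K y)]
  simp_rw [adjKernel_apply, neg_neg]

lemma integral_evenPart (hK : IsStableKernel s lam Lam K b) {g : Space m → ℝ} {B : ℝ}
    (hg : Measurable g) (hB : ∀ θ : Sph m, |g θ| ≤ B) (he : ∀ y, g (-y) = g y) :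
    ∫ θ : Sph m, g θ * evenPart K θ ∂(sphereMeasure m) =
      ∫ θ : Sph m, g θ ∂(spectralMeasure K) := by
  have h1 := integral_spectralMeasure_adjKernel hK g
  simp_rw [he] at h1
  have hgm : Measurable fun θ : Sph m => g θ := hg.comp measurable_subtype_coe
  rw [← add_self_div_two (∫ θ : Sph m, g θ ∂(spectralMeasure K))]
  nth_rw 2 [← h1]
  rw [integral_spectralMeasure hK, integral_spectralMeasure hK.adjoint,
    ← integral_add (integrable_mul_kernel_sphere hK hgm hB)
      (integrable_mul_kernel_sphere hK.adjoint hgm hB), ← integral_div]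
  refine integral_congr_ae (Eventually.of_forall fun θ => ?_)
  simp only [adjKernel_apply, evenPart]
  ring

lemma integral_oddPart (hK : IsStableKernel s lam Lam K b) {g : Space m → ℝ} {B : ℝ}
    (hg : Measurable g) (hB : ∀ θ : Sph m, |g θ| ≤ B) (he : ∀ y, g (-y) = -g y) :
    ∫ θ : Sph m, g θ * oddPart K θ ∂(sphereMeasure m) =
      ∫ θ : Sph m, g θ ∂(spectralMeasure K) := by
  have h1 := integral_spectralMeasure_adjKernel hK g
  simp_rw [he] at h1
  rw [integral_neg] at h1
  have hgm : Measurable fun θ : Sph m => g θ := hg.comp measurable_subtype_coe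
  rw [← add_self_div_two (∫ θ : Sph m, g θ ∂(spectralMeasure K))]
  nth_rw 2 [← neg_eq_iff_eq_neg.2 h1]
  rw [← sub_eq_add_neg, integral_spectralMeasure hK, integral_spectralMeasure hK.adjoint,
    ← integral_sub (integrable_mul_kernel_sphere hK hgm hB)
      (integrable_mul_kernel_sphere hK.adjoint hgm hB), ← integral_div]
  refine integral_congr_ae (Eventually.of_forall fun θ => ?_)
  simp only [adjKernel_apply, oddPart]
  ring

lemma inner_eLast (y : Space m) : ⟪y, eLast m⟫ = lastCoord y := by
  simp [eLast, lastCoord, EuclideanSpace.inner_single_right]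

lemma norm_eLast : ‖eLast m‖ = 1 := by
  simp [eLast]

lemma abs_rpow_eq_posPow {p : ℝ} (hp : 0 < p) (t : ℝ) :
    |t| ^ p = posPow p t + posPow p (-t) := by
  rcases lt_trichotomy t 0 with h | h | h
  · rw [posPow_of_nonpos hp h.le, posPow_of_pos (neg_pos.2 h), abs_of_neg h, zero_add]
  · simp [h, posPow, Real.zero_rpow hp.ne']
  · rw [posPow_of_nonpos hp (neg_nonpos.2 h.le), posPow_of_pos h, abs_of_pos h, add_zero]

lemma abs_rpow_sub_one_mul {p : ℝ} (hp : 0 < p) (t : ℝ) :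
    |t| ^ (p - 1) * t = posPow p t - posPow p (-t) := by
  rcases lt_trichotomy t 0 with h | h | h
  · rw [posPow_of_nonpos hp h.le, posPow_of_pos (neg_pos.2 h), abs_of_neg h, zero_sub]
    have := Real.rpow_sub_one (neg_pos.2 h).ne' p
    rw [this]; field_simp [h.ne]
  · simp [h, posPow, Real.zero_rpow hp.ne']
  · rw [posPow_of_nonpos hp (neg_nonpos.2 h.le), posPow_of_pos h, abs_of_pos h, sub_zero,
      ← Real.rpow_add_one h.ne', sub_add_cancel]

lemma fluxPlus_add_fluxMinus (hK : IsStableKernel s lam Lam K b) (hs : 0 < s) :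
    fluxPlus s K + fluxMinus s K =
      ∫ θ : Sph m, |lastCoord (θ : Space m)| ^ (2 * s) ∂(spectralMeasure K) := by
  rw [fluxPlus, fluxMinus, ← integral_add (integrable_fluxPlus hK hs) (integrable_fluxMinus hK hs)]
  simp_rw [abs_rpow_eq_posPow (by linarith : 0 < 2 * s)]

lemma fluxPlus_sub_fluxMinus (hK : IsStableKernel s lam Lam K b) (hs : 0 < s) :
    fluxPlus s K - fluxMinus s K =
      ∫ θ : Sph m, |lastCoord (θ : Space m)| ^ (2 * s - 1) * lastCoord (θ : Space m)
        ∂(spectralMeasure K) := by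
  rw [fluxPlus, fluxMinus, ← integral_sub (integrable_fluxPlus hK hs) (integrable_fluxMinus hK hs)]
  simp_rw [abs_rpow_sub_one_mul (by linarith : 0 < 2 * s)]

/-- The lower ellipticity bound in the direction e_n. It keeps the real part of the symbol away from
zero. -/
lemma fluxPlus_add_fluxMinus_pos (hK : IsStableKernel s lam Lam K b) (hs : 0 < s) :
    0 < fluxPlus s K + fluxMinus s K := by
  rw [fluxPlus_add_fluxMinus hK hs, integral_spectralMeasure hK]
  refine hK.lam_pos.trans_le ((hK.lower_bound (eLast m) norm_eLast).trans_eq ?_)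
  simp_rw [real_inner_comm, inner_eLast]

/-- At s = 1/2 the difference of the fluxes is the last component of the vanishing first moment. -/
lemma fluxMinus_eq_fluxPlus_of_half (hK : IsStableKernel (1 / 2) lam Lam K b) :
    fluxMinus (1 / 2) K = fluxPlus (1 / 2) K := by
  have h := fluxPlus_sub_fluxMinus hK (by norm_num)
  have hc := hK.cancellation rfl
  have hint : Integrable (fun θ : Sph m => K θ • (θ : Space m)) (sphereMeasure m) := by
    refine (integrable_norm_iff ?_).1 ?_
    · exact hK.integrable_sphere.aestronglyMeasurable.smul
        continuous_subtype_val.aestronglyMeasurable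
    · refine hK.integrable_sphere.norm.congr (Eventually.of_forall fun θ => ?_)
      simp [norm_smul]
  have h2 := (lastCoordL m).integral_comp_comm hint
  rw [hc, map_zero] at h2
  have h3 : ∫ θ : Sph m, |lastCoord (θ : Space m)| ^ (2 * (1 / 2) - 1 : ℝ) * lastCoord (θ : Space m)
      ∂(spectralMeasure K) = 0 := by
    rw [integral_spectralMeasure hK, ← h2]
    refine integral_congr_ae (Eventually.of_forall fun θ => ?_)
    simp [lastCoordL_apply, mul_comm]
  linarith

lemma symbolA_eLast (hK : IsStableKernel s lam Lam K b) (hs : 0 < s) :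
    symbolA s K (eLast m) = (if s = 1 / 2 then Real.pi / 2 else
      -Real.Gamma (-2 * s) * Real.cos (Real.pi * s)) * (fluxPlus s K + fluxMinus s K) := by
  rw [symbolA, fluxPlus_add_fluxMinus hK hs]
  simp_rw [inner_eLast]
  rw [integral_evenPart hK (g := fun y => |lastCoord y| ^ (2 * s)) (B := 1)
    (by fun_prop) (fun θ => ?_) (fun y => by rw [lastCoord_neg, abs_neg])]
  rw [abs_of_nonneg (by positivity)]
  exact Real.rpow_le_one (abs_nonneg _) (abs_lastCoord_sphere_le θ) (by linarith)

lemma symbolB_eLast_of_ne (hK : IsStableKernel s lam Lam K b) (hs : 0 < s) (h : s ≠ 1 / 2) :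
    symbolB s K b (eLast m) = Real.Gamma (-2 * s) * Real.sin (Real.pi * s) *
      (fluxPlus s K - fluxMinus s K) := by
  rw [symbolB, if_neg h, fluxPlus_sub_fluxMinus hK hs]
  simp_rw [inner_eLast]
  rw [integral_oddPart hK (g := fun y => |lastCoord y| ^ (2 * s - 1) * lastCoord y) (B := 1)
    (by fun_prop) (fun θ => ?_) (fun y => by rw [lastCoord_neg, abs_neg]; ring)]
  have ht := abs_lastCoord_sphere_le θ
  rcases eq_or_ne (lastCoord (θ : Space m)) 0 with h0 | h0
  · simp [h0]
  · rw [abs_mul, abs_of_nonneg (by positivity : 0 ≤ |lastCoord (θ : Space m)| ^ (2 * s - 1)),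
      ← Real.rpow_add_one (abs_ne_zero.2 h0)]
    exact Real.rpow_le_one (abs_nonneg _) ht (by linarith)

lemma symbolB_eLast_half (hK : IsStableKernel (1 / 2) lam Lam K b) :
    symbolB (1 / 2) K b (eLast m) =
      ∫ θ : Sph m, lastCoord (θ : Space m) * Real.log |lastCoord (θ : Space m)|
        ∂(spectralMeasure K) + lastCoord b := by
  rw [symbolB, if_pos rfl]
  simp_rw [inner_eLast]
  rw [integral_oddPart hK (g := fun y => lastCoord y * Real.log |lastCoord y|) (B := 1)
    (by fun_prop) (fun θ => abs_mul_log_abs_le (abs_lastCoord_sphere_le θ))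
    (fun y => by rw [lastCoord_neg, abs_neg]; ring)]

lemma evenPart_adjKernel (K : Space m → ℝ) : evenPart (adjKernel K) = evenPart K := by
  funext y; simp only [evenPart, adjKernel_apply, neg_neg, add_comm]

lemma oddPart_adjKernel (K : Space m → ℝ) (y : Space m) :
    oddPart (adjKernel K) y = -oddPart K y := by
  simp only [oddPart, adjKernel_apply, neg_neg]; ring

lemma symbolA_adjKernel (ξ : Space m) : symbolA s (adjKernel K) ξ = symbolA s K ξ := by
  rw [symbolA, symbolA, evenPart_adjKernel]

lemma symbolB_adjKernel (ξ : Space m) :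
    symbolB s (adjKernel K) (-b) ξ = -symbolB s K b ξ := by
  simp only [symbolB, oddPart_adjKernel, mul_neg, integral_neg, inner_neg_left]
  split_ifs <;> ring

lemma bdryExponent_adjKernel (ξ : Space m) :
    bdryExponent s (adjKernel K) (-b) ξ = 2 * s - bdryExponent s K b ξ := by
  simp only [bdryExponent, symbolA_adjKernel, symbolB_adjKernel, neg_div, Real.arctan_neg]
  ring

lemma Gamma_neg_mul_Gamma_one_add_or (p : ℝ) :
    Real.Gamma (-p) * Real.Gamma (1 + p) * Real.sin (Real.pi * p) = -Real.pi ∨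
      Real.sin (Real.pi * p) = 0 := by
  by_cases h : Real.sin (Real.pi * p) = 0
  · exact Or.inr h
  · left
    have := Real.Gamma_mul_Gamma_one_sub (-p)
    rw [sub_neg_eq_add, mul_neg, Real.sin_neg] at this
    rw [this]; field_simp

/-- The reflection formula at 2s together with the double-angle formula for the sine. The case s =
1/2 is a pole of Γ(-2s) and has to be excluded. -/
lemma Gamma_mul_sin_two_mul {s : ℝ} (hs0 : 0 < s) (hs1 : s < 1) (h : s ≠ 1 / 2) :
    Real.Gamma (-2 * s) * Real.Gamma (1 + 2 * s) *
      (2 * Real.sin (Real.pi * s) * Real.cos (Real.pi * s)) = -Real.pi := by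
  have hsin : Real.sin (Real.pi * (2 * s)) =
      2 * Real.sin (Real.pi * s) * Real.cos (Real.pi * s) := by
    rw [← Real.sin_two_mul]; ring_nf
  rcases Gamma_neg_mul_Gamma_one_add_or (2 * s) with h1 | h1
  · rw [← hsin, neg_mul]; exact h1
  · exfalso
    rw [hsin] at h1
    have hpi := Real.pi_pos
    have h2 : 0 < Real.sin (Real.pi * s) :=
      Real.sin_pos_of_pos_of_lt_pi (by positivity) (by nlinarith)
    have h3 : Real.cos (Real.pi * s) = 0 := by
      rcases mul_eq_zero.1 h1 with h4 | h4
      · linarith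
      · exact h4
    have h4 : Real.cos (Real.pi * s) = Real.cos (Real.pi / 2) := by rw [h3, Real.cos_pi_div_two]
    have := Real.injOn_cos ⟨by positivity, by nlinarith⟩ ⟨by positivity, by linarith⟩ h4
    exact h (by field_simp at this; linarith)

lemma symbolA_eLast_pos (hK : IsStableKernel s lam Lam K b) (hs0 : 0 < s) (hs1 : s < 1) :
    0 < symbolA s K (eLast m) := by
  rw [symbolA_eLast hK hs0]
  refine mul_pos ?_ (fluxPlus_add_fluxMinus_pos hK hs0)
  have hpi := Real.pi_pos
  split_ifs with h
  · positivity
  · have h1 := Gamma_mul_sin_two_mul hs0 hs1 h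
    have h2 : 0 < Real.sin (Real.pi * s) :=
      Real.sin_pos_of_pos_of_lt_pi (by positivity) (by nlinarith)
    have h3 : 0 < Real.Gamma (1 + 2 * s) := Real.Gamma_pos_of_pos (by linarith)
    by_contra hcon
    have : 0 ≤ Real.Gamma (-2 * s) * Real.cos (Real.pi * s) := by linarith
    nlinarith [mul_nonneg (mul_nonneg this h3.le) h2.le]

/-- Polar form of A + iB. Since A > 0, the arctangent is its argument. -/
lemma sqrt_mul_cos_arctan {A : ℝ} (hA : 0 < A) (B : ℝ) :
    √(A ^ 2 + B ^ 2) * Real.cos (Real.arctan (B / A)) = A ∧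
    √(A ^ 2 + B ^ 2) * Real.sin (Real.arctan (B / A)) = B := by
  have h : √(A ^ 2 + B ^ 2) = A * √(1 + (B / A) ^ 2) := by
    rw [← Real.sqrt_sq hA.le, ← Real.sqrt_mul (by positivity), Real.sqrt_sq hA.le]
    congr 1; field_simp
  have h0 : √(1 + (B / A) ^ 2) ≠ 0 := by positivity
  rw [h, Real.cos_arctan, Real.sin_arctan]
  constructor <;> field_simp

/-- By definition πγ is πs plus the argument of A + iB, so these are the imaginary and real parts of
(A + iB) e^(iπs). -/
lemma sqrt_mul_sin_cos_bdryExponent (hK : IsStableKernel s lam Lam K b) (hs0 : 0 < s)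
    (hs1 : s < 1) :
    √(symbolA s K (eLast m) ^ 2 + symbolB s K b (eLast m) ^ 2) *
        Real.sin (Real.pi * bdryExponent s K b (eLast m)) =
      symbolA s K (eLast m) * Real.sin (Real.pi * s) +
        symbolB s K b (eLast m) * Real.cos (Real.pi * s) ∧
    √(symbolA s K (eLast m) ^ 2 + symbolB s K b (eLast m) ^ 2) *
        Real.cos (Real.pi * bdryExponent s K b (eLast m)) =
      symbolA s K (eLast m) * Real.cos (Real.pi * s) -
        symbolB s K b (eLast m) * Real.sin (Real.pi * s) := by
  obtain ⟨h1, h2⟩ := sqrt_mul_cos_arctan (symbolA_eLast_pos hK hs0 hs1) (symbolB s K b (eLast m))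
  have e : Real.pi * bdryExponent s K b (eLast m) = Real.pi * s +
      Real.arctan (symbolB s K b (eLast m) / symbolA s K (eLast m)) := by
    rw [bdryExponent, mul_add, ← mul_assoc, mul_one_div_cancel Real.pi_ne_zero, one_mul]
  rw [e, Real.sin_add, Real.cos_add]
  constructor
  · linear_combination Real.sin (Real.pi * s) * h1 + Real.cos (Real.pi * s) * h2
  · linear_combination Real.cos (Real.pi * s) * h1 - Real.sin (Real.pi * s) * h2

/-- The relation between the modulus of the symbol and the flux. -/
lemma sqrt_mul_sin_mul_Gamma (hK : IsStableKernel s lam Lam K b) (hs0 : 0 < s) (hs1 : s < 1) :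
    √(symbolA s K (eLast m) ^ 2 + symbolB s K b (eLast m) ^ 2) *
        Real.sin (Real.pi * bdryExponent s K b (eLast m)) * Real.Gamma (1 + 2 * s) =
      Real.pi * fluxMinus s K := by
  rw [(sqrt_mul_sin_cos_bdryExponent hK hs0 hs1).1, symbolA_eLast hK hs0]
  by_cases h : s = 1 / 2
  -- At s = 1/2 the claim is A = π F₋, because sin(πs) = 1, cos(πs) = 0 and Γ(2) = 1.
  · subst h
    rw [if_pos rfl, ← fluxMinus_eq_fluxPlus_of_half hK]
    have e : Real.pi * (1 / 2) = Real.pi / 2 := by ring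
    rw [e, Real.sin_pi_div_two, Real.cos_pi_div_two, show (1 + 2 * (1 / 2) : ℝ) = 2 by norm_num,
      Real.Gamma_two]
    ring
  -- In A sin(πs) + B cos(πs) the terms with F₊ cancel and those with F₋ double, leaving -2 Γ(-2s)
  -- sin(πs) cos(πs) F₋.
  · rw [if_neg h, symbolB_eLast_of_ne hK hs0 h]
    linear_combination -(fluxMinus s K) * Gamma_mul_sin_two_mul hs0 hs1 h

lemma fluxMinus_adjKernel (hK : IsStableKernel s lam Lam K b) :
    fluxMinus s (adjKernel K) = fluxPlus s K := by
  rw [fluxMinus, integral_spectralMeasure_adjKernel hK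
    (fun y => posPow (2 * s) (-lastCoord y)), fluxPlus]
  simp_rw [lastCoord_neg, neg_neg]

/-- For s ≠ 1/2, the modulus identity says that F₋ is proportional to sin(πγ). Applied to the
adjoint, with exponent 2s - γ, it says that F₊ is proportional to sin(π(2s-γ)) with the same factor.
Cross-multiplication gives the matching. For s = 1/2 it is A cos(πγ) + B sin(πγ) = 0 with A = π F₊.
-/
lemma isMatched_bdryExponent (hK : IsStableKernel s lam Lam K b) (hs0 : 0 < s) (hs1 : s < 1) :
    IsMatched s K b (bdryExponent s K b (eLast m)) := by
  have hA := symbolA_eLast_pos hK hs0 hs1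
  have hpos : √(symbolA s K (eLast m) ^ 2 + symbolB s K b (eLast m) ^ 2) ≠ 0 := by positivity
  refine ⟨fun _ => ?_, fun h => ?_⟩
  · have h1 := sqrt_mul_sin_mul_Gamma hK hs0 hs1
    have h2 := sqrt_mul_sin_mul_Gamma hK.adjoint hs0 hs1
    rw [symbolA_adjKernel, symbolB_adjKernel, neg_sq, bdryExponent_adjKernel,
      fluxMinus_adjKernel hK] at h2
    have h3 : √(symbolA s K (eLast m) ^ 2 + symbolB s K b (eLast m) ^ 2) *
        Real.Gamma (1 + 2 * s) ≠ 0 := mul_ne_zero hpos (Real.Gamma_pos_of_pos (by linarith)).ne'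
    refine mul_left_cancel₀ (mul_ne_zero h3 Real.pi_ne_zero) ?_
    linear_combination (√(symbolA s K (eLast m) ^ 2 + symbolB s K b (eLast m) ^ 2) *
      Real.Gamma (1 + 2 * s)) * (-Real.sin (Real.pi * bdryExponent s K b (eLast m)) * h2 +
      Real.sin (Real.pi * (2 * s - bdryExponent s K b (eLast m))) * h1)
  · subst h
    refine ⟨fluxMinus_eq_fluxPlus_of_half hK, ?_⟩
    obtain ⟨h1, h2⟩ := sqrt_mul_sin_cos_bdryExponent hK hs0 hs1
    have hAe := symbolA_eLast hK hs0
    rw [if_pos rfl, fluxMinus_eq_fluxPlus_of_half hK] at hAe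
    rw [← symbolB_eLast_half hK]
    have e : Real.pi * (1 / 2) = Real.pi / 2 := by ring
    rw [e, Real.sin_pi_div_two, Real.cos_pi_div_two] at h1 h2
    refine mul_left_cancel₀ hpos ?_
    linear_combination (fluxPlus (1 / 2) K * Real.pi) * h2 + symbolB (1 / 2) K b (eLast m) * h1 +
      symbolB (1 / 2) K b (eLast m) * hAe

end Adjoint

end

/-! ### Tangential and normal coordinates -/

section

variable {m : ℕ} {s lam Lam : ℝ} {K : Space m → ℝ} {b : Space m}

section Splitting

/-- The point `(x', t)`. -/
def slabPoint (p : EuclideanSpace ℝ (Fin m) × ℝ) : Space m := bdryPoint p.1 + p.2 • eLast m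

/-- The splitting of a point into its tangential and its normal coordinates. -/
def slabEquiv (m : ℕ) : EuclideanSpace ℝ (Fin m) × ℝ ≃ᵐ Space m :=
  (((MeasurableEquiv.toLp 2 (Fin m → ℝ)).symm.prodCongr (MeasurableEquiv.refl ℝ)).trans
    MeasurableEquiv.prodComm).trans
    ((MeasurableEquiv.piFinSuccAbove (fun _ : Fin (m + 1) => ℝ) (Fin.last m)).symm.trans
      (MeasurableEquiv.toLp 2 (Fin (m + 1) → ℝ)))

lemma slabEquiv_eq (p : EuclideanSpace ℝ (Fin m) × ℝ) :
    slabEquiv m p = WithLp.toLp 2 (Fin.snoc (α := fun _ => ℝ) (fun i => p.1 i) p.2) := by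
  rw [← Fin.insertNth_last']
  rfl

lemma slabPoint_eq (p : EuclideanSpace ℝ (Fin m) × ℝ) :
    slabPoint p = WithLp.toLp 2 (Fin.snoc (α := fun _ => ℝ) (fun i => p.1 i) p.2) := by
  ext i
  refine Fin.lastCases ?_ (fun j => ?_) i
  · simp [slabPoint, bdryPoint, eLast]
  · simp [slabPoint, bdryPoint, eLast, Fin.castSucc_ne_last]

lemma coe_slabEquiv : (slabEquiv m : EuclideanSpace ℝ (Fin m) × ℝ → Space m) = slabPoint := by
  funext p; rw [slabEquiv_eq, slabPoint_eq]

lemma measurePreserving_slabPoint :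
    MeasurePreserving (slabPoint : EuclideanSpace ℝ (Fin m) × ℝ → Space m) := by
  rw [← coe_slabEquiv]
  exact (PiLp.volume_preserving_toLp (Fin (m + 1))).comp
    (((volume_preserving_piFinSuccAbove (fun _ : Fin (m + 1) => ℝ) (Fin.last m)).symm _).comp
      (Measure.measurePreserving_swap.comp
        ((PiLp.volume_preserving_ofLp (Fin m)).prod (MeasurePreserving.id _))))

lemma measurableEmbedding_slabPoint :
    MeasurableEmbedding (slabPoint : EuclideanSpace ℝ (Fin m) × ℝ → Space m) := by
  rw [← coe_slabEquiv]; exact (slabEquiv m).measurableEmbedding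

lemma lastCoord_slabPoint (p : EuclideanSpace ℝ (Fin m) × ℝ) : lastCoord (slabPoint p) = p.2 := by
  rw [slabPoint_eq]; simp [lastCoord]

lemma norm_sq_slabPoint (p : EuclideanSpace ℝ (Fin m) × ℝ) :
    ‖slabPoint p‖ ^ 2 = ‖p.1‖ ^ 2 + p.2 ^ 2 := by
  rw [slabPoint_eq, EuclideanSpace.norm_sq_eq, EuclideanSpace.norm_sq_eq, Fin.sum_univ_castSucc]
  simp

lemma norm_fst_le_slabPoint (p : EuclideanSpace ℝ (Fin m) × ℝ) : ‖p.1‖ ≤ ‖slabPoint p‖ := by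
  refine (sq_le_sq₀ (norm_nonneg _) (norm_nonneg _)).1 ?_
  rw [norm_sq_slabPoint]; nlinarith

lemma lastCoord_eLast : lastCoord (eLast m) = 1 := by
  simp [lastCoord, eLast]

lemma ae_lastCoord_ne (c : ℝ) : ∀ᵐ x : Space m, lastCoord x ≠ c := by
  have h : volume ((lastCoordL m).ker : Set (Space m)) = 0 := by
    refine Measure.addHaar_submodule _ _ fun h => ?_
    have : eLast m ∈ (lastCoordL m).ker := h ▸ Submodule.mem_top
    rw [LinearMap.mem_ker] at this
    have h1 : lastCoord (eLast m) = 0 := this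
    rw [lastCoord_eLast] at h1
    exact one_ne_zero h1
  have h0 : ∀ᵐ x : Space m, lastCoord x ≠ 0 := by
    rw [ae_iff]
    convert h using 2
    ext x
    simp [← lastCoordL_apply]
  have := (measurePreserving_add_right (volume : Measure (Space m)) (-(c • eLast m))).quasiMeasurePreserving.ae h0
  filter_upwards [this] with x hx hc
  refine hx ?_
  rw [lastCoord_add, lastCoord_neg, lastCoord_smul, lastCoord_eLast, hc]; ring

lemma integrableOn_abs_rpow {e ρ : ℝ} (he : -1 < e) :
    IntegrableOn (fun t : ℝ => |t| ^ e) (Icc (-ρ) ρ) := by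
  rcases lt_or_ge ρ 0 with h | h
  · rw [Icc_eq_empty (by linarith)]; exact integrableOn_empty
  have h1 : IntegrableOn (fun t : ℝ => |t| ^ e) (Ioc 0 ρ) := by
    refine IntegrableOn.congr_fun ((intervalIntegrable_iff_integrableOn_Ioc_of_le h).1
      (intervalIntegral.intervalIntegrable_rpow' he)) (fun t ht => ?_) measurableSet_Ioc
    rw [abs_of_pos ht.1]
  have h2 : IntegrableOn (fun t : ℝ => |t| ^ e) (Ico (-ρ) 0) := by
    have := (Measure.measurePreserving_neg (volume : Measure ℝ)).integrableOn_comp_preimage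
      (MeasurableEquiv.neg ℝ).measurableEmbedding (f := fun t : ℝ => |t| ^ e) (s := Ioc 0 ρ)
    have h3 := this.2 h1
    simpa [Function.comp_def] using h3
  have h3 : IntegrableOn (fun t : ℝ => |t| ^ e) {0} := integrableOn_singleton (hx := by simp)
  refine (h2.union (h3.union h1)).mono_set fun t ht => ?_
  rcases lt_trichotomy t 0 with h | h | h
  · exact Or.inl ⟨ht.1, h⟩
  · exact Or.inr (Or.inl h)
  · exact Or.inr (Or.inr ⟨h, ht.2⟩)

/-- Fubini in (x', x_n). All majorants near the hyperplane below are of this form. -/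
lemma integrableOn_abs_lastCoord_rpow {e : ℝ} (he : -1 < e) (a : Space m) (ρ : ℝ) :
    IntegrableOn (fun x : Space m => |lastCoord (x + a)| ^ e) (Metric.closedBall 0 ρ) := by
  have key : ∀ ρ : ℝ, IntegrableOn (fun x : Space m => |lastCoord x| ^ e) (Metric.closedBall 0 ρ) := by
    intro ρ
    have h0 := measurePreserving_slabPoint.integrableOn_comp_preimage
      measurableEmbedding_slabPoint (f := fun x : Space m => |lastCoord x| ^ e)
      (s := Metric.closedBall 0 ρ)
    rw [← h0]
    have h1 : IntegrableOn (fun p : EuclideanSpace ℝ (Fin m) × ℝ => (1 : ℝ) * |p.2| ^ e)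
        (Metric.closedBall 0 ρ ×ˢ Icc (-ρ) ρ) := by
      have hc : IntegrableOn (fun _ : EuclideanSpace ℝ (Fin m) => (1 : ℝ)) (Metric.closedBall 0 ρ) :=
        integrableOn_const measure_closedBall_lt_top.ne
      have := Integrable.mul_prod hc (integrableOn_abs_rpow (ρ := ρ) he)
      rwa [Measure.prod_restrict] at this
    refine (h1.mono_set ?_).congr_fun (fun p _ => ?_)
      (measurePreserving_slabPoint.measurable Metric.isClosed_closedBall.measurableSet)
    · intro p hp
      rw [mem_preimage, mem_closedBall_zero_iff] at hp
      refine ⟨mem_closedBall_zero_iff.2 ((norm_fst_le_slabPoint p).trans hp), abs_le.1 ?_⟩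
      rw [← lastCoord_slabPoint p]
      exact (abs_lastCoord_le _).trans hp
    · simp only [Function.comp, lastCoord_slabPoint, one_mul]
  have h2 := (measurePreserving_add_right (volume : Measure (Space m)) a).integrableOn_comp_preimage
    (measurableEmbedding_addRight a) (f := fun x : Space m => |lastCoord x| ^ e)
    (s := Metric.closedBall 0 (ρ + ‖a‖))
  refine (h2.2 (key _)).mono_set fun x hx => ?_
  rw [mem_closedBall_zero_iff] at hx
  rw [mem_preimage, mem_closedBall_zero_iff]
  exact (norm_add_le _ _).trans (by gcongr)

lemma integrable_of_bound_of_support {f : Space m → ℝ} (hf : AEStronglyMeasurable f) {B ρ : ℝ}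
    (hB : ∀ x, |f x| ≤ B) (hρ : ∀ x, ρ < ‖x‖ → f x = 0) : Integrable f := by
  have h : IntegrableOn f (Metric.closedBall 0 ρ) :=
    IntegrableOn.of_bound measure_closedBall_lt_top hf.restrict B (Eventually.of_forall hB)
  refine h.integrable_of_forall_notMem_eq_zero fun x hx => hρ x ?_
  rwa [mem_closedBall_zero_iff, not_le] at hx

end Splitting

/-! ### Integration by parts across the hyperplane -/

section IntegrationByParts

/-- A bounded function with bounded support which is regular of order `β` up to the hyperplane
`x_n = 0`. -/
structure BdryFun (β B ρ : ℝ) (f : Space m → ℝ) : Prop where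
  pos : 0 < β
  le_one : β ≤ 1
  continuous : Continuous f
  bound : ∀ x, |f x| ≤ B
  radius_pos : 0 < ρ
  support : ∀ x, ρ < ‖x‖ → f x = 0
  regular : ∀ R, 0 < R → ∃ C, BdryRegular β R C f

lemma BdryFun.bound_nonneg {β B ρ : ℝ} {f : Space m → ℝ} (hf : BdryFun β B ρ f) : 0 ≤ B :=
  (abs_nonneg _).trans (hf.bound 0)

lemma bdryFun_powMul {β N ρ : ℝ} {η : Space m → ℝ} (hη : TestBounds N ρ η) (hβ : 0 < β) :
    BdryFun (min β 1) (ρ ^ β * N) ρ (powMul β η) where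
  pos := lt_min hβ one_pos
  le_one := min_le_right _ _
  continuous := (exists_bdryRegular_powMul hβ hη one_pos).choose_spec.continuous
  bound := abs_powMul_le_of_testBounds hη hβ
  radius_pos := hη.pos
  support x hx := by rw [powMul_eq, hη.support x hx, mul_zero]
  regular R hR := exists_bdryRegular_powMul hβ hη hR

/-- Difference quotients of f are dominated by a multiple of |x_n|^(β-1), which is locally
integrable as β > 0. Pointwise convergence holds off the hyperplane. -/
lemma tendsto_integral_mul_slope {β B ρ B' ρ' : ℝ} {f g : Space m → ℝ} (hf : BdryFun β B ρ f)
    (hg : Measurable g) (hg1 : ∀ x, |g x| ≤ B') (hg2 : ∀ x, ρ' < ‖x‖ → g x = 0) (a y : Space m) :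
    Integrable (fun x => g x * fderiv ℝ f (x + a) y) ∧
    Tendsto (fun t : ℝ => ∫ x, g x * (t⁻¹ * (f (x + a + t • y) - f (x + a)))) (𝓝[>] 0)
      (𝓝 (∫ x, g x * fderiv ℝ f (x + a) y)) := by
  have hB' : 0 ≤ B' := (abs_nonneg _).trans (hg1 0)
  set R := |ρ'| + ‖a‖ + 1 with hR
  have hR0 : 0 < R := by positivity
  obtain ⟨C, hC⟩ := hf.regular R hR0
  have hC0 := hC.nonneg
  set bd : Space m → ℝ := (Metric.closedBall (0 : Space m) ρ').indicator
    fun x => B' * (2 * C * ‖y‖) * |lastCoord (x + a)| ^ (β - 1) with hbd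
  have hbdi : Integrable bd := by
    rw [hbd, integrable_indicator_iff Metric.isClosed_closedBall.measurableSet]
    exact (integrableOn_abs_lastCoord_rpow (by linarith [hf.pos]) a ρ').const_mul _
  have hae : ∀ᵐ x : Space m, lastCoord (x + a) ≠ 0 :=
    (measurePreserving_add_right (volume : Measure (Space m)) a).quasiMeasurePreserving.ae
      (ae_lastCoord_ne 0)
  have hxR : ∀ x : Space m, ‖x‖ ≤ ρ' → |lastCoord (x + a)| ≤ R := fun x hx =>
    (abs_lastCoord_le _).trans ((norm_add_le _ _).trans (by
      rw [hR]; linarith [hx.trans (le_abs_self ρ')]))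
  have hfd : Measurable fun x => fderiv ℝ f (x + a) y :=
    (measurable_fderiv_apply_const ℝ f y).comp (measurable_add_const a)
  have bound_of : ∀ x : Space m, ∀ q : ℝ, lastCoord (x + a) ≠ 0 →
      (‖x‖ ≤ ρ' → |q| ≤ 2 * C * |lastCoord (x + a)| ^ (β - 1) * ‖y‖) → |g x * q| ≤ bd x := by
    intro x q hx hq
    by_cases h : ‖x‖ ≤ ρ'
    · rw [hbd, indicator_of_mem (mem_closedBall_zero_iff.2 h), abs_mul]
      calc |g x| * |q| ≤ B' * (2 * C * |lastCoord (x + a)| ^ (β - 1) * ‖y‖) :=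
            mul_le_mul (hg1 x) (hq h) (abs_nonneg _) hB'
        _ = _ := by ring
    · rw [hbd, indicator_of_notMem (by rwa [mem_closedBall_zero_iff]), hg2 x (not_le.1 h), zero_mul,
        abs_zero]
  constructor
  · refine hbdi.mono' (hg.mul hfd).aestronglyMeasurable ?_
    filter_upwards [hae] with x hx
    refine bound_of x _ hx fun h => ?_
    refine ((fderiv ℝ f (x + a)).le_opNorm y).trans ?_
    gcongr
    refine (hC.grad _ hx (hxR x h)).trans ?_
    gcongr
    linarith
  · refine tendsto_integral_filter_of_dominated_convergence bd ?_ ?_ hbdi ?_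
    · refine Eventually.of_forall fun t => ?_
      have := hf.continuous
      exact (hg.mul (Continuous.measurable (by fun_prop))).aestronglyMeasurable
    · filter_upwards [self_mem_nhdsWithin] with t ht
      filter_upwards [hae] with x hx
      refine bound_of x _ hx fun h => ?_
      have ht0 : 0 < t := ht
      have h1 := hC.lip hf.pos hf.le_one hx (hxR x h) (t • y)
      rw [norm_smul, Real.norm_of_nonneg ht0.le] at h1
      rw [abs_mul, abs_inv, abs_of_pos ht0, abs_sub_comm, inv_mul_le_iff₀ ht0]
      linarith
    · filter_upwards [hae] with x hx
      exact ((hC.differentiableAt _ hx).hasFDerivAt.hasLineDerivAt y).tendsto_slope_zero_right.const_mul _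

/-- Translation invariance moves a difference quotient from v to f, and the step is then sent to 0.
No boundary term arises on x_n = 0 because both functions are continuous there and their gradients
are locally integrable. -/
lemma integral_mul_fderiv_eq {β B ρ β' B' ρ' : ℝ} {f v : Space m → ℝ} (hf : BdryFun β B ρ f)
    (hv : BdryFun β' B' ρ' v) (a y : Space m) :
    Integrable (fun x => f (x + a) * fderiv ℝ v x y) ∧
    Integrable (fun x => v x * fderiv ℝ f (x + a) y) ∧
    ∫ x, f (x + a) * fderiv ℝ v x y = -∫ x, v x * fderiv ℝ f (x + a) y := by
  have hfc := hf.continuous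
  have hvc := hv.continuous
  have hfs : ∀ x, ρ + ‖a‖ < ‖x‖ → f (x + a) = 0 := fun x hx => hf.support _ (by
    have := norm_sub_norm_le x (-a)
    rw [norm_neg, sub_neg_eq_add] at this; linarith)
  obtain ⟨i1, t1⟩ := tendsto_integral_mul_slope (g := fun x => f (x + a)) hv
    (Continuous.measurable (by fun_prop)) (fun x => hf.bound _) hfs 0 y
  -- The direction is reversed because a forward difference of v becomes a backward difference of f,
  -- while limits are taken only over t > 0.
  obtain ⟨i2, t2⟩ := tendsto_integral_mul_slope hf hvc.measurable hv.bound hv.support a (-y)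
  simp only [add_zero] at i1 t1
  simp only [map_neg, mul_neg, integral_neg] at i2 t2
  refine ⟨i1, by simpa using i2.neg, tendsto_nhds_unique t1 (t2.congr fun t => ?_)⟩
  have hint : ∀ c : Space m, Integrable fun x => f (x + a + c) * v x := fun c => by
    refine integrable_of_bound_of_support (Continuous.aestronglyMeasurable (by fun_prop))
      (B := B * B') (ρ := ρ') (fun x => ?_) fun x hx => by rw [hv.support x hx, mul_zero]
    rw [abs_mul]
    exact mul_le_mul (hf.bound _) (hv.bound _) (abs_nonneg _) hf.bound_nonneg
  have htr : ∫ x, f (x + a) * v (x + t • y) = ∫ x, f (x + a + t • (-y)) * v x := by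
    rw [← integral_add_right_eq_self (fun x => f (x + a + t • (-y)) * v x) (t • y)]
    refine integral_congr_ae (Eventually.of_forall fun x => ?_)
    beta_reduce
    congr 2
    rw [smul_neg]; abel
  have hint' : Integrable fun x => f (x + a) * v (x + t • y) := by
    have := (hint (t • (-y))).comp_add_right (t • y)
    refine this.congr (Eventually.of_forall fun x => ?_)
    beta_reduce
    congr 2
    rw [smul_neg]; abel
  have e1 : ∀ x, v x * (t⁻¹ * (f (x + a + t • (-y)) - f (x + a))) =
      t⁻¹ * (f (x + a + t • (-y)) * v x - f (x + a) * v x) := fun x => by ring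
  have e2 : ∀ x, f (x + a) * (t⁻¹ * (v (x + t • y) - v x)) =
      t⁻¹ * (f (x + a) * v (x + t • y) - f (x + a) * v x) := fun x => by ring
  have hint0 : Integrable fun x => f (x + a) * v x := by simpa using hint 0
  simp_rw [e1, e2, integral_const_mul]
  rw [integral_sub (hint _) hint0, integral_sub hint' hint0, htr]

end IntegrationByParts

end

/-! ### Duality of L and L* on the whole space -/

section

variable {m : ℕ} {s lam Lam : ℝ} {K : Space m → ℝ} {b : Space m}

section WeakIdentity

lemma effDrift_neg (s : ℝ) (b : Space m) : effDrift s (-b) = -effDrift s b := by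
  unfold effDrift; split_ifs <;> simp

lemma regOp_adjKernel (f : Space m → ℝ) (x : Space m) :
    regOp s (adjKernel K) (-b) f x =
      ∫ y, increment s f x (-y) ∂(kernelMeasure K) - fderiv ℝ f x (effDrift s b) := by
  rw [regOp, kernelMeasure_adjKernel, integral_map_equiv, effDrift_neg, map_neg, sub_eq_add_neg]
  rfl

/-- Duality for one fixed y: translation invariance handles the differences, integration by parts
the gradient corrections. Integration against K in y is left to Fubini. -/
lemma integral_mul_increment_eq {β B ρ β' B' ρ' : ℝ} {f v : Space m → ℝ} (hf : BdryFun β B ρ f)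
    (hv : BdryFun β' B' ρ' v) (a y : Space m) :
    ∫ x, f (x + a) * increment s v x (-y) = ∫ x, v x * increment s f (x + a) y := by
  obtain ⟨i1, i2, h12⟩ := integral_mul_fderiv_eq hf hv a y
  have hfc := hf.continuous
  have hvc := hv.continuous
  have hint : ∀ c, Integrable fun x => v x * f (x + c) := fun c => by
    refine integrable_of_bound_of_support (Continuous.aestronglyMeasurable (by fun_prop))
      (B := B' * B) (ρ := ρ') (fun x => ?_) fun x hx => by rw [hv.support x hx, zero_mul]
    rw [abs_mul]
    exact mul_le_mul (hv.bound _) (hf.bound _) (abs_nonneg _) hv.bound_nonneg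
  have hint' : Integrable fun x => f (x + a) * v (x - y) := by
    have := (hint (a + y)).comp_sub_right y
    refine this.congr (Eventually.of_forall fun x => ?_)
    beta_reduce
    rw [mul_comm]; congr 2; abel
  have htr : ∫ x, f (x + a) * v (x - y) = ∫ x, v x * f (x + a + y) := by
    rw [← integral_sub_right_eq_self (fun x => v x * f (x + a + y)) y]
    refine integral_congr_ae (Eventually.of_forall fun x => ?_)
    beta_reduce
    rw [mul_comm]; congr 2; abel
  have hint0 : Integrable fun x => f (x + a) * v x := by simpa [mul_comm] using hint a
  have hint2 : Integrable fun x => v x * f (x + a + y) := by simpa [add_assoc] using hint (a + y)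
  have e1 : ∀ x, f (x + a) * increment s v x (-y) = (f (x + a) * v x - f (x + a) * v (x - y)) -
      gradCutoff s ‖y‖ * (f (x + a) * fderiv ℝ v x y) := fun x => by
    rw [increment, norm_neg, map_neg, ← sub_eq_add_neg]; ring
  have e2 : ∀ x, v x * increment s f (x + a) y = (v x * f (x + a) - v x * f (x + a + y)) +
      gradCutoff s ‖y‖ * (v x * fderiv ℝ f (x + a) y) := fun x => by
    rw [increment]; ring
  simp_rw [e1, e2]
  have k1 : Integrable fun x => f (x + a) * v x - f (x + a) * v (x - y) := hint0.sub hint'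
  have k2 : Integrable fun x => v x * f (x + a) - v x * f (x + a + y) := (hint a).sub hint2
  rw [integral_sub k1 (i1.const_mul _), integral_sub hint0 hint',
    integral_add k2 (i2.const_mul _), integral_sub (hint a) hint2, htr,
    integral_const_mul, integral_const_mul, h12]
  simp_rw [mul_comm (f _) (v _)]
  ring

lemma integral_mul_regOp_of_integrable {β B ρ β' B' ρ' : ℝ} {f v : Space m → ℝ}
    (hf : BdryFun β B ρ f) (hv : BdryFun β' B' ρ' v) (a : Space m)
    (H1 : Integrable (fun p : Space m × Space m => f (p.1 + a) * increment s v p.1 (-p.2))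
      (volume.prod (kernelMeasure K)))
    (H2 : Integrable (fun p : Space m × Space m => v p.1 * increment s f (p.1 + a) p.2)
      (volume.prod (kernelMeasure K))) :
    Integrable (fun x => f (x + a) * regOp s (adjKernel K) (-b) v x) ∧
    Integrable (fun x => v x * regOp s K b f (x + a)) ∧
    ∫ x, f (x + a) * regOp s (adjKernel K) (-b) v x = ∫ x, v x * regOp s K b f (x + a) := by
  obtain ⟨i1, i2, h12⟩ := integral_mul_fderiv_eq hf hv a (effDrift s b)
  have j1 := H1.integral_prod_left
  have j2 := H2.integral_prod_left
  have e1 : ∀ x, f (x + a) * regOp s (adjKernel K) (-b) v x =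
      (∫ y, f (x + a) * increment s v x (-y) ∂(kernelMeasure K)) -
        f (x + a) * fderiv ℝ v x (effDrift s b) := fun x => by
    rw [regOp_adjKernel, mul_sub, integral_const_mul]
  have e2 : ∀ x, v x * regOp s K b f (x + a) =
      (∫ y, v x * increment s f (x + a) y ∂(kernelMeasure K)) +
        v x * fderiv ℝ f (x + a) (effDrift s b) := fun x => by
    rw [regOp, mul_add, integral_const_mul]
  simp_rw [e1, e2]
  refine ⟨j1.sub i1, j2.add i2, ?_⟩
  rw [integral_sub j1 i1, integral_add j2 i2, h12, sub_neg_eq_add]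
  congr 1
  have p1 := integral_prod _ H1
  have p2 := integral_prod_symm _ H1
  have q1 := integral_prod _ H2
  have q2 := integral_prod_symm _ H2
  rw [← p1, p2, ← q1, q2]
  exact integral_congr_ae (Eventually.of_forall fun y => integral_mul_increment_eq hf hv a y)

lemma integrable_prod_of_lintegral_le {κ : Measure (Space m)} [SFinite κ]
    {g : Space m × Space m → ℝ} (hg : Measurable g) {φ : Space m → ℝ} (hφ : Integrable φ)
    (h : ∀ᵐ x, ∫⁻ y, ENNReal.ofReal |g (x, y)| ∂κ ≤ ENNReal.ofReal (φ x)) :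
    Integrable g (volume.prod κ) := by
  refine ⟨hg.aestronglyMeasurable, ?_⟩
  rw [HasFiniteIntegral, lintegral_prod _ hg.enorm.aemeasurable]
  refine (lintegral_mono_ae ?_).trans_lt hφ.lintegral_lt_top
  filter_upwards [h] with x hx
  simpa only [Real.enorm_eq_ofReal_abs] using hx

lemma exists_small_exponent {s β c : ℝ} (hβs : β < 2 * s) (hc : 0 < c) :
    ∃ ε, 0 < ε ∧ ε < c ∧ (s = 1 / 2 → ε ≤ 1 - β) := by
  by_cases h : s = 1 / 2
  · refine ⟨min (c / 2) (1 - β), lt_min (by linarith) (by rw [h] at hβs; linarith),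
      (min_le_left _ _).trans_lt (by linarith), fun _ => min_le_right _ _⟩
  · exact ⟨c / 2, by linarith, by linarith, fun h' => absurd h' h⟩

/-- The inner integral is O(|x_n|^(β-2s-ε)), which is locally integrable for small ε exactly when β
> 2s - 1. -/
lemma integrable_mul_increment {β B ρ B' ρ' : ℝ} {f g : Space m → ℝ}
    (hK : IsStableKernel s lam Lam K b) (hs1 : s < 1) (hf : BdryFun β B ρ f) (hβs : β < 2 * s)
    (hβ1 : 2 * s - 1 < β) (hg : Measurable g) (hg1 : ∀ x, |g x| ≤ B')
    (hg2 : ∀ x, ρ' < ‖x‖ → g x = 0) :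
    Integrable (fun p : Space m × Space m => g p.1 * increment s f p.1 p.2)
      (volume.prod (kernelMeasure K)) := by
  obtain ⟨ε, hε, hε1, hε2⟩ := exists_small_exponent hβs (by linarith : 0 < 1 + β - 2 * s)
  have hR : 0 < |ρ'| + 1 := by positivity
  obtain ⟨C, hC⟩ := hf.regular _ hR
  obtain ⟨M, hM, hM1⟩ := exists_lintegral_increment_le hK hs1 hC hf.pos hf.le_one hβs hR hε hε2
  have hB' : 0 ≤ B' := (abs_nonneg _).trans (hg1 0)
  refine integrable_prod_of_lintegral_le (φ := (Metric.closedBall (0 : Space m) ρ').indicator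
    fun x => B' * M * |lastCoord (x + 0)| ^ (β - 2 * s - ε))
    ((hg.comp measurable_fst).mul (measurable_increment hf.continuous)) ?_ ?_
  · rw [integrable_indicator_iff Metric.isClosed_closedBall.measurableSet]
    exact (integrableOn_abs_lastCoord_rpow (by linarith) 0 ρ').const_mul _
  · filter_upwards [ae_lastCoord_ne 0] with x hx
    by_cases h : ‖x‖ ≤ ρ'
    · rw [indicator_of_mem (mem_closedBall_zero_iff.2 h), add_zero, mul_assoc,
        ENNReal.ofReal_mul hB']
      simp_rw [abs_mul, ENNReal.ofReal_mul (abs_nonneg _)]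
      rw [lintegral_const_mul' _ _ ENNReal.ofReal_ne_top]
      gcongr
      · exact hg1 x
      · exact hM1 x hx ((abs_lastCoord_le x).trans (by linarith [h.trans (le_abs_self ρ')]))
    · simp [hg2 x (not_le.1 h)]

/-- The decay x_n^p of g at the boundary compensates the singularity of the increment, so β > 2s - 1
weakens to p + β > 2s - 1. This covers f of low regularity. -/
lemma integrable_mul_increment_shift {β B ρ ρ' D p h : ℝ} {f g : Space m → ℝ}
    (hK : IsStableKernel s lam Lam K b) (hs1 : s < 1) (hf : BdryFun β B ρ f) (hβs : β < 2 * s)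
    (hg : Measurable g) (hg2 : ∀ x, ρ' < ‖x‖ → g x = 0)
    (hp : 0 < p) (hpβ : 2 * s - 1 < p + β) (hD : ∀ x, |g x| ≤ D * posPow p (lastCoord x))
    (hh : 0 ≤ h) :
    Integrable (fun q : Space m × Space m => g q.1 * increment s f (q.1 + h • eLast m) q.2)
      (volume.prod (kernelMeasure K)) := by
  obtain ⟨ε, hε, hε1, hε2⟩ := exists_small_exponent hβs (by linarith : 0 < 1 + p + β - 2 * s)
  have hR : 0 < |ρ'| + h + 1 := by positivity
  obtain ⟨C, hC⟩ := hf.regular _ hR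
  obtain ⟨M, hM, hM1⟩ := exists_lintegral_increment_le hK hs1 hC hf.pos hf.le_one hβs hR hε hε2
  have hD0 : 0 ≤ D := by
    have := (abs_nonneg _).trans (hD (eLast m))
    rw [lastCoord_eLast, posPow_of_pos one_pos, Real.one_rpow, mul_one] at this
    exact this
  have hm : Measurable fun q : Space m × Space m => g q.1 * increment s f (q.1 + h • eLast m) q.2 :=
    (hg.comp measurable_fst).mul ((measurable_increment hf.continuous).comp
      ((measurable_fst.add_const _).prodMk measurable_snd))
  refine integrable_prod_of_lintegral_le (φ := (Metric.closedBall (0 : Space m) ρ').indicator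
    fun x => D * M * |lastCoord (x + 0)| ^ (p + β - 2 * s - ε)) hm ?_ ?_
  · rw [integrable_indicator_iff Metric.isClosed_closedBall.measurableSet]
    exact (integrableOn_abs_lastCoord_rpow (by linarith) 0 ρ').const_mul _
  · filter_upwards with x
    by_cases hx : ‖x‖ ≤ ρ'
    · rcases le_or_gt (lastCoord x) 0 with h0 | h0
      · have : g x = 0 := by
          have := hD x
          rw [posPow_of_nonpos hp h0, mul_zero] at this
          exact abs_nonpos_iff.1 this
        simp [this]
      · have hxh : lastCoord (x + h • eLast m) = lastCoord x + h := by
          rw [lastCoord_add, lastCoord_smul, lastCoord_eLast, mul_one]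
        have hpos : 0 < lastCoord x + h := by linarith
        rw [indicator_of_mem (mem_closedBall_zero_iff.2 hx), add_zero]
        simp_rw [abs_mul, ENNReal.ofReal_mul (abs_nonneg _)]
        rw [lintegral_const_mul' _ _ ENNReal.ofReal_ne_top]
        have hM2 := hM1 (x + h • eLast m) (by rw [hxh]; exact hpos.ne') (by
          rw [hxh]
          refine (abs_add_le _ _).trans ?_
          rw [abs_of_nonneg hh]
          linarith [abs_lastCoord_le x, hx.trans (le_abs_self ρ')])
        rw [hxh, abs_of_pos hpos] at hM2
        -- The shift only moves points away from the hyperplane, and the exponent is negative. This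
        -- is where h ≥ 0 enters.
        have hmono : (lastCoord x + h) ^ (β - 2 * s - ε) ≤ lastCoord x ^ (β - 2 * s - ε) :=
          Real.rpow_le_rpow_of_nonpos h0 (by linarith) (by linarith)
        have hg3 := hD x
        rw [posPow_of_pos h0] at hg3
        calc _ ≤ ENNReal.ofReal (D * lastCoord x ^ p) *
              ENNReal.ofReal (M * lastCoord x ^ (β - 2 * s - ε)) := by
              gcongr
              exact hM2.trans (by gcongr)
          _ = _ := by
              rw [← ENNReal.ofReal_mul (by positivity), abs_of_pos h0,
                show p + β - 2 * s - ε = p + (β - 2 * s - ε) by ring, Real.rpow_add h0]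
              congr 1; ring
    · simp [hg2 x (not_le.1 hx)]

/-- The operator and its adjoint are in duality, also after a shift into the half space. -/
lemma integral_mul_regOp_adjoint {β B ρ β' B' ρ' D p h : ℝ} {f v : Space m → ℝ}
    (hK : IsStableKernel s lam Lam K b) (hs1 : s < 1) (hf : BdryFun β B ρ f) (hβs : β < 2 * s)
    (hv : BdryFun β' B' ρ' v) (hβ's : β' < 2 * s) (hβ' : 2 * s - 1 < β') (hp : 0 < p)
    (hpβ : 2 * s - 1 < p + β) (hD : ∀ x, |v x| ≤ D * posPow p (lastCoord x)) (hh : 0 ≤ h) :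
    Integrable (fun x => f (x + h • eLast m) * regOp s (adjKernel K) (-b) v x) ∧
    Integrable (fun x => v x * regOp s K b f (x + h • eLast m)) ∧
    ∫ x, f (x + h • eLast m) * regOp s (adjKernel K) (-b) v x =
      ∫ x, v x * regOp s K b f (x + h • eLast m) := by
  have hfc := hf.continuous
  refine integral_mul_regOp_of_integrable hf hv _ ?_
    (integrable_mul_increment_shift hK hs1 hf hβs hv.continuous.measurable hv.support hp
      hpβ hD hh)
  have h1 := integrable_mul_increment (g := fun x => f (x + h • eLast m)) (ρ' := ρ + h)
    hK.adjoint hs1 hv hβ's hβ'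
    (Continuous.measurable (by fun_prop)) (fun x => hf.bound _) (fun x hx => hf.support _ ?_)
  -- The adjoint's kernel measure is the reflection of K(y) dy, so the reflection y ↦ -y returns the
  -- integrability statement to K itself.
  · rw [kernelMeasure_adjKernel] at h1
    have hmp : MeasurePreserving (Prod.map id (MeasurableEquiv.neg (Space m)))
        ((volume : Measure (Space m)).prod (kernelMeasure K))
        (volume.prod ((kernelMeasure K).map (MeasurableEquiv.neg (Space m)))) :=
      (MeasurePreserving.id _).prod ((MeasurableEquiv.neg (Space m)).measurable.measurePreserving _)
    exact hmp.integrable_comp_of_integrable h1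
  · have := norm_sub_norm_le x (-(h • eLast m))
    rw [norm_neg, sub_neg_eq_add, norm_smul, norm_eLast, mul_one, Real.norm_of_nonneg hh] at this
    linarith

end WeakIdentity

end

/-! ### The shifted identity on the half space and the exterior values -/

section

variable {m : ℕ} {s lam Lam : ℝ} {K : Space m → ℝ} {b : Space m}

section BoundaryLayer

lemma measurableSet_halfSpace : MeasurableSet (halfSpace m) :=
  measurableSet_lt measurable_const measurable_lastCoord

lemma lastCoord_add_smul_eLast (x : Space m) (h : ℝ) :
    lastCoord (x + h • eLast m) = lastCoord x + h := by
  rw [lastCoord_add, lastCoord_smul, lastCoord_eLast, mul_one]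

/-- The shifted duality identity, restricted to the half space. -/
lemma setIntegral_halfSpace_shift {β B ρ β' B' ρ' D p h : ℝ} {f v : Space m → ℝ}
    (hK : IsStableKernel s lam Lam K b) (hs1 : s < 1) (hf : BdryFun β B ρ f) (hβs : β < 2 * s)
    (hf0 : ∀ x, lastCoord x ≤ 0 → f x = 0)
    (hv : BdryFun β' B' ρ' v) (hβ's : β' < 2 * s) (hβ' : 2 * s - 1 < β') (hp : 0 < p)
    (hpβ : 2 * s - 1 < p + β) (hD : ∀ x, |v x| ≤ D * posPow p (lastCoord x)) (hh : 0 ≤ h) :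
    (∫ x in halfSpace m, (f (x + h • eLast m) - f x) * regOp s (adjKernel K) (-b) v x) -
      ∫ x in halfSpace m, (v (x + h • (-eLast m)) - v x) * regOp s K b f x =
    -∫ x in (halfSpace m)ᶜ, f (x + h • eLast m) * regOp s (adjKernel K) (-b) v x := by
  -- The duality is used with shift h and with shift 0, and the two are subtracted.
  obtain ⟨i1, j1, e1⟩ := integral_mul_regOp_adjoint hK hs1 hf hβs hv hβ's hβ' hp hpβ hD hh
  obtain ⟨i0, j0, e0⟩ := integral_mul_regOp_adjoint hK hs1 hf hβs hv hβ's hβ' hp hpβ hD le_rfl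
  simp only [zero_smul, add_zero] at i0 j0 e0
  have hv0 : ∀ x, lastCoord x ≤ 0 → v x = 0 := fun x hx => by
    have := hD x
    rw [posPow_of_nonpos hp hx, mul_zero] at this
    exact abs_nonpos_iff.1 this
  have hj : ∀ x, v (x - h • eLast m) * regOp s K b f x =
      (fun x => v x * regOp s K b f (x + h • eLast m)) (x - h • eLast m) := fun x => by
    beta_reduce; rw [sub_add_cancel]
  have j2 : Integrable fun x => v (x - h • eLast m) * regOp s K b f x := by
    simp_rw [hj]; exact j1.comp_sub_right _
  have e2 : ∫ x, v (x - h • eLast m) * regOp s K b f x =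
      ∫ x, v x * regOp s K b f (x + h • eLast m) := by
    simp_rw [hj]
    exact integral_sub_right_eq_self (fun x => v x * regOp s K b f (x + h • eLast m)) _
  have s0 : ∫ x in halfSpace m, f x * regOp s (adjKernel K) (-b) v x =
      ∫ x, f x * regOp s (adjKernel K) (-b) v x :=
    setIntegral_eq_integral_of_forall_compl_eq_zero fun x hx => by
      rw [hf0 x (not_lt.1 hx), zero_mul]
  have s1 : ∫ x in halfSpace m, v x * regOp s K b f x = ∫ x, v x * regOp s K b f x :=
    setIntegral_eq_integral_of_forall_compl_eq_zero fun x hx => by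
      rw [hv0 x (not_lt.1 hx), zero_mul]
  -- Translating v by +h e_n keeps its support in the half space, and the unshifted terms live there
  -- as well. The only integrand that leaves the half space is u(· + h e_n) L*v.
  have s2 : ∫ x in halfSpace m, v (x - h • eLast m) * regOp s K b f x =
      ∫ x, v (x - h • eLast m) * regOp s K b f x :=
    setIntegral_eq_integral_of_forall_compl_eq_zero fun x hx => by
      have hx' : lastCoord x ≤ 0 := not_lt.1 hx
      rw [hv0 _ (by
        rw [sub_eq_add_neg, ← neg_smul, lastCoord_add_smul_eLast]; linarith), zero_mul]
  have s3 := integral_add_compl measurableSet_halfSpace i1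
  simp_rw [sub_mul, smul_neg, ← sub_eq_add_neg]
  rw [integral_sub i1.integrableOn i0.integrableOn, integral_sub j2.integrableOn j0.integrableOn,
    s0, s1, s2, e0, e2, ← e1, ← s3]
  ring

/-- The majorant is x_n^(β-1-g), integrable on bounded sets because g < β. This is where the
improved boundary bound is spent. The ball of radius ρ + 1 contains the supports of all translates
by |ty| ≤ 1. -/
lemma tendsto_setIntegral_slope {β B ρ M g : ℝ} {f G : Space m → ℝ} (hf : BdryFun β B ρ f)
    (hG : Measurable G)
    (hGM : ∀ x, 0 < lastCoord x → lastCoord x ≤ ρ + 1 → |G x| ≤ M * lastCoord x ^ (-g))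
    (hg : g < β) {y : Space m} (hy : ‖y‖ ≤ 1) :
    IntegrableOn (fun x => fderiv ℝ f x y * G x) (halfSpace m) ∧
    Tendsto (fun t : ℝ => t⁻¹ * ∫ x in halfSpace m, (f (x + t • y) - f x) * G x) (𝓝[>] 0)
      (𝓝 (∫ x in halfSpace m, fderiv ℝ f x y * G x)) := by
  have hρ := hf.radius_pos
  obtain ⟨C, hC⟩ := hf.regular (ρ + 1) (by positivity)
  have hC0 := hC.nonneg
  set bd : Space m → ℝ := (Metric.closedBall (0 : Space m) (ρ + 1)).indicator
    fun x => 2 * C * M * |lastCoord (x + 0)| ^ (β - 1 - g) with hbd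
  have hbdi : Integrable bd := by
    rw [hbd, integrable_indicator_iff Metric.isClosed_closedBall.measurableSet]
    exact (integrableOn_abs_lastCoord_rpow (by linarith) 0 _).const_mul _
  have hfd : Measurable fun x => fderiv ℝ f x y := measurable_fderiv_apply_const ℝ f y
  have bound_of : ∀ x : Space m, ∀ q : ℝ, 0 < lastCoord x → (ρ + 1 < ‖x‖ → q = 0) →
      (‖x‖ ≤ ρ + 1 → |q| ≤ 2 * C * |lastCoord x| ^ (β - 1)) → |q * G x| ≤ bd x := by
    intro x q hx h0 hq
    by_cases h : ‖x‖ ≤ ρ + 1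
    · rw [hbd, indicator_of_mem (mem_closedBall_zero_iff.2 h), abs_mul, add_zero]
      calc |q| * |G x| ≤ (2 * C * |lastCoord x| ^ (β - 1)) * (M * lastCoord x ^ (-g)) :=
            mul_le_mul (hq h) (hGM x hx ((le_abs_self _).trans ((abs_lastCoord_le x).trans h)))
              (abs_nonneg _) (by positivity)
        _ = _ := by
            rw [abs_of_pos hx, show β - 1 - g = (β - 1) + -g by ring, Real.rpow_add hx]; ring
    · rw [hbd, indicator_of_notMem (by rwa [mem_closedBall_zero_iff]), h0 (not_le.1 h), zero_mul,
        abs_zero]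
  have hpos : ∀ᵐ x ∂(volume.restrict (halfSpace m)), 0 < lastCoord x :=
    ae_restrict_mem measurableSet_halfSpace
  have hxR : ∀ x : Space m, ‖x‖ ≤ ρ + 1 → |lastCoord x| ≤ ρ + 1 := fun x hx =>
    (abs_lastCoord_le x).trans hx
  constructor
  · refine hbdi.integrableOn.mono' (hfd.mul hG).aestronglyMeasurable ?_
    filter_upwards [hpos] with x hx
    refine bound_of x _ hx (fun h => ?_) fun h => ?_
    · have : f =ᶠ[𝓝 x] fun _ => 0 := by
        filter_upwards [(isOpen_lt continuous_const continuous_norm).mem_nhds h] with z hz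
        exact hf.support z (by have : ρ + 1 < ‖z‖ := hz; linarith)
      rw [this.fderiv_eq]; simp
    · refine ((fderiv ℝ f x).le_opNorm y).trans ?_
      calc ‖fderiv ℝ f x‖ * ‖y‖ ≤ C * |lastCoord x| ^ (β - 1) * 1 :=
            mul_le_mul (hC.grad _ hx.ne' (hxR x h)) hy (norm_nonneg _) (by positivity)
        _ ≤ _ := by
            have : 0 ≤ C * |lastCoord x| ^ (β - 1) := by positivity
            linarith
  · simp_rw [← integral_const_mul]
    refine tendsto_integral_filter_of_dominated_convergence bd ?_ ?_ hbdi.integrableOn ?_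
    · refine Eventually.of_forall fun t => ?_
      have := hf.continuous
      exact (((Continuous.measurable (by fun_prop)).mul hG).const_mul _).aestronglyMeasurable
    · filter_upwards [Ioo_mem_nhdsGT (one_pos : (0 : ℝ) < 1)] with t ht
      filter_upwards [hpos] with x hx
      have hty : ‖t • y‖ ≤ t := by
        rw [norm_smul, Real.norm_of_nonneg ht.1.le]
        exact mul_le_of_le_one_right ht.1.le hy
      rw [← mul_assoc]
      refine bound_of x _ hx (fun h => ?_) fun h => ?_
      · rw [hf.support x (by linarith), hf.support (x + t • y) ?_, sub_zero, mul_zero]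
        have := norm_sub_norm_le x (-(t • y))
        rw [norm_neg, sub_neg_eq_add] at this
        linarith [ht.2]
      · have h1 := hC.lip hf.pos hf.le_one hx.ne' (hxR x h) (t • y)
        rw [abs_mul, abs_inv, abs_of_pos ht.1, abs_sub_comm, inv_mul_le_iff₀ ht.1]
        refine h1.trans ?_
        rw [mul_comm t]
        gcongr
    · filter_upwards [hpos] with x hx
      have := ((hC.differentiableAt x hx.ne').hasFDerivAt.hasLineDerivAt y).tendsto_slope_zero_right
      refine (this.mul_const (G x)).congr fun t => ?_
      rw [smul_eq_mul, mul_assoc]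

/-- The operator outside the half space, for a function vanishing there. -/
lemma regOp_adjKernel_of_neg {v : Space m → ℝ} (hv0 : ∀ x, lastCoord x ≤ 0 → v x = 0) {x : Space m}
    (hx : lastCoord x < 0) :
    regOp s (adjKernel K) (-b) v x = -∫ y, v (x - y) ∂(kernelMeasure K) := by
  have h : v =ᶠ[𝓝 x] fun _ => 0 := by
    filter_upwards [(isOpen_lt continuous_lastCoord continuous_const).mem_nhds hx] with z hz
    exact hv0 z (le_of_lt hz)
  have hfd : fderiv ℝ v x = 0 := by rw [h.fderiv_eq]; simp
  rw [regOp_adjKernel, hfd, ← integral_neg]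
  simp [increment, hfd, hv0 x hx.le, sub_eq_add_neg]

lemma integral_kernelMeasure_smul (hK : IsStableKernel s lam Lam K b) {h : ℝ} (hh : 0 < h)
    (F : Space m → ℝ) :
    ∫ y, F (h • y) ∂(kernelMeasure K) = h ^ (2 * s) * ∫ y, F y ∂(kernelMeasure K) := by
  rw [integral_kernelMeasure hK, integral_kernelMeasure hK]
  have h1 := Measure.integral_comp_smul_of_nonneg (volume : Measure (Space m))
    (fun y => F y * K y) h (hR := hh.le)
  have h2 : ∫ y, F (h • y) * K (h • y) =
      h ^ (-((m : ℝ) + 1) - 2 * s) * ∫ y, F (h • y) * K y := by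
    rw [← integral_const_mul]
    refine integral_congr_ae ?_
    filter_upwards [ae_lastCoord_ne 0] with y hy
    rw [hK.homogeneous h y hh (fun h0 => hy (by rw [h0]; rfl))]
    ring
  rw [h2, finrank_euclideanSpace_fin, smul_eq_mul] at h1
  have h3 : h ^ (-((m : ℝ) + 1) - 2 * s) * h ^ (m + 1) * h ^ (2 * s) = 1 := by
    rw [← Real.rpow_natCast, ← Real.rpow_add hh, ← Real.rpow_add hh]
    push_cast
    rw [show -((m : ℝ) + 1) - 2 * s + (m + 1) + 2 * s = 0 by ring, Real.rpow_zero]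
  have h4 : (h ^ (m + 1))⁻¹ * h ^ (m + 1) = 1 := inv_mul_cancel₀ (by positivity)
  calc ∫ y, F (h • y) * K y
      = (h ^ (-((m : ℝ) + 1) - 2 * s) * h ^ (m + 1) * h ^ (2 * s)) * ∫ y, F (h • y) * K y := by
        rw [h3, one_mul]
    _ = h ^ (m + 1) * h ^ (2 * s) * (h ^ (-((m : ℝ) + 1) - 2 * s) * ∫ y, F (h • y) * K y) := by ring
    _ = ((h ^ (m + 1))⁻¹ * h ^ (m + 1)) * (h ^ (2 * s) * ∫ y, F y * K y) := by rw [h1]; ring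
    _ = _ := by rw [h4, one_mul]

lemma posPow_mul {β c : ℝ} (hc : 0 ≤ c) (t : ℝ) : posPow β (c * t) = c ^ β * posPow β t := by
  rw [posPow, posPow, ← Real.mul_rpow hc (le_max_right _ _), mul_max_of_nonneg _ _ hc, mul_zero]

/-- Scale to r = 1, then shift t by 1 to reach a Beta integral of the second kind. -/
lemma integral_posPow_sub_mul_rpow {σ p : ℝ} (hp : 0 < p) (hps : p < 2 * σ) {r : ℝ} (hr : 0 < r) :
    ∫ t in Ioi (0 : ℝ), posPow p (t - r) * t ^ (-1 - 2 * σ) =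
      r ^ (p - 2 * σ) * ProbabilityTheory.beta (p + 1) (2 * σ - p) := by
  have h1 := integral_Ioi_scale (s := σ) (inv_pos.2 hr) (fun t => r ^ p * posPow p (t - 1))
  have e1 : ∀ t, r ^ p * posPow p (r⁻¹ * t - 1) = posPow p (t - r) := fun t => by
    rw [← posPow_mul hr.le]; congr 1; field_simp
  simp_rw [e1] at h1
  rw [h1]
  have h2 : ∫ t in Ioi (0 : ℝ), r ^ p * posPow p (t - 1) * t ^ (-1 - 2 * σ) =
      r ^ p * ∫ t in Ioi (1 : ℝ), (t - 1) ^ p * t ^ (-1 - 2 * σ) := by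
    rw [← integral_const_mul, ← integral_indicator measurableSet_Ioi,
      ← integral_indicator measurableSet_Ioi]
    congr 1
    funext t
    by_cases ht : 1 < t
    · rw [indicator_of_mem (show t ∈ Ioi (0 : ℝ) from one_pos.trans ht),
        indicator_of_mem (show t ∈ Ioi (1 : ℝ) from ht), posPow_of_pos (by linarith)]
      ring
    · rw [indicator_of_notMem (show t ∉ Ioi (1 : ℝ) from ht)]
      apply indicator_apply_eq_zero.2
      intro _
      rw [posPow_of_nonpos hp (by linarith)]; ring
  have h3 : ∫ t in Ioi (1 : ℝ), (t - 1) ^ p * t ^ (-1 - 2 * σ) =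
      ProbabilityTheory.beta (p + 1) (2 * σ - p) := by
    have h4 := (integrableOn_and_integral_beta_second (by linarith : 0 < p + 1)
      (by linarith : 0 < 2 * σ - p)).2
    rw [← h4]
    have h5 := (measurePreserving_add_left (volume : Measure ℝ) 1).setIntegral_preimage_emb
      (measurableEmbedding_addLeft 1) (fun t : ℝ => (t - 1) ^ p * t ^ (-1 - 2 * σ)) (Ioi 1)
    rw [← h5, show (fun t : ℝ => 1 + t) ⁻¹' Ioi 1 = Ioi 0 by ext; simp]
    refine setIntegral_congr_fun measurableSet_Ioi fun t _ => ?_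
    congr 2 <;> ring
  rw [h2, h3, ← mul_assoc, Real.inv_rpow hr.le, ← Real.rpow_neg hr.le, ← Real.rpow_add hr]
  congr 2; ring

lemma integrable_posPow_exterior (hK : IsStableKernel s lam Lam K b) {p : ℝ} (hp : 0 < p)
    (hps : p < 2 * s) {r : ℝ} (hr : 0 < r) :
    Integrable (fun z => posPow p (-r - lastCoord z)) (kernelMeasure K) := by
  have hm : Measurable fun z : Space m => posPow p (-r - lastCoord z) :=
    (measurable_posPow p).comp (by fun_prop)
  refine integrable_kernelMeasure_of_le hK hm.aestronglyMeasurable (A₁ := 0) (A₂ := 1)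
    (i := 2 * s + 1) hr (by linarith) hps le_rfl zero_le_one (fun z hz => ?_) fun z hz => ?_
  · rw [posPow_of_nonpos hp (by linarith [neg_le_abs (lastCoord z), abs_lastCoord_le z])]
    simp
  · rw [abs_of_nonneg (posPow_nonneg _ _), one_mul]
    exact posPow_le hp (norm_nonneg _) (by linarith [neg_le_abs (lastCoord z), abs_lastCoord_le z])

/-- Up to sign this is the adjoint applied to (x_n)_+^p at depth r below the hyperplane. Only rays
with θ_n < 0 contribute, which is why `fluxMinus` appears. -/
lemma integral_posPow_exterior (hK : IsStableKernel s lam Lam K b) (hs : 0 < s) {p : ℝ} (hp : 0 < p)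
    (hps : p < 2 * s) {r : ℝ} (hr : 0 < r) :
    ∫ z, posPow p (-r - lastCoord z) ∂(kernelMeasure K) =
      fluxMinus s K * (r ^ (p - 2 * s) * ProbabilityTheory.beta (p + 1) (2 * s - p)) := by
  rw [integral_polar hK (integrable_posPow_exterior hK hp hps hr), fluxMinus, ← integral_mul_const]
  refine integral_congr_ae (Eventually.of_forall fun θ => ?_)
  beta_reduce
  rcases le_or_gt 0 (lastCoord (θ : Space m)) with h | h
  · rw [posPow_of_nonpos (by linarith) (by linarith), zero_mul]
    refine setIntegral_eq_zero_of_forall_eq_zero fun t ht => ?_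
    have ht0 : (0 : ℝ) < t := ht
    rw [lastCoord_smul, posPow_of_nonpos hp (by nlinarith), zero_mul]
  · rw [posPow_of_pos (by linarith), ← integral_posPow_sub_mul_rpow hp hps hr,
      ← integral_Ioi_scale (neg_pos.2 h)]
    refine setIntegral_congr_fun measurableSet_Ioi fun t _ => ?_
    beta_reduce
    rw [lastCoord_smul]
    congr 2; ring

end BoundaryLayer

end

/-! ### Limit of the boundary layer -/

section

variable {m : ℕ} {s lam Lam : ℝ} {K : Space m → ℝ} {b : Space m}

section LayerLimit

/-- The rescaled exterior values of the adjoint operator in the boundary layer of thickness `h`. -/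
def layer (K : Space m → ℝ) (p : ℝ) (τ : Space m → ℝ) (h : ℝ) (x' : EuclideanSpace ℝ (Fin m))
    (r : ℝ) : ℝ :=
  ∫ z, posPow p (-r - lastCoord z) * τ (slabPoint (x', -(h * r)) - h • z) ∂(kernelMeasure K)

lemma slabPoint_add_smul (x' : EuclideanSpace ℝ (Fin m)) (t h : ℝ) :
    slabPoint (x', t) + h • eLast m = slabPoint (x', t + h) := by
  simp only [slabPoint, add_smul, add_assoc]

lemma lastCoord_sub (x y : Space m) : lastCoord (x - y) = lastCoord x - lastCoord y := rfl

lemma measurable_slabPoint :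
    Measurable (slabPoint : EuclideanSpace ℝ (Fin m) × ℝ → Space m) :=
  measurePreserving_slabPoint.measurable

/-- Scaling produces h^α from u, h^p from v and h^(-2s) from the kernel. They cancel because α + p =
2s, so the layer contributes at exactly the order of its thickness. -/
lemma powMul_mul_integral_eq_layer (hK : IsStableKernel s lam Lam K b) {α p h : ℝ}
    (hαp : α + p = 2 * s) (hh : 0 < h) (η τ : Space m → ℝ) (x' : EuclideanSpace ℝ (Fin m)) (r : ℝ) :
    powMul α η (slabPoint (x', -(h * r)) + h • eLast m) *
      ∫ y, powMul p τ (slabPoint (x', -(h * r)) - y) ∂(kernelMeasure K) =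
    posPow α (1 - r) * η (slabPoint (x', h * (1 - r))) * layer K p τ h x' r := by
  have h1 := integral_kernelMeasure_smul hK hh (fun y => powMul p τ (slabPoint (x', -(h * r)) - y))
  have h2 : ∀ z, powMul p τ (slabPoint (x', -(h * r)) - h • z) =
      h ^ p * (posPow p (-r - lastCoord z) * τ (slabPoint (x', -(h * r)) - h • z)) := fun z => by
    rw [powMul_eq, lastCoord_sub, lastCoord_slabPoint, lastCoord_smul, ← mul_assoc,
      ← posPow_mul hh.le]
    congr 2; ring
  simp_rw [h2] at h1
  rw [integral_const_mul, ← layer, ← hαp, Real.rpow_add hh] at h1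
  have h3 : -(h * r) + h = h * (1 - r) := by ring
  rw [slabPoint_add_smul, powMul_eq, lastCoord_slabPoint, h3, posPow_mul hh.le]
  have hp0 : h ^ p ≠ 0 := by positivity
  have h4 : h ^ α * ∫ y, powMul p τ (slabPoint (x', -(h * r)) - y) ∂(kernelMeasure K) =
      layer K p τ h x' r := by
    refine mul_left_cancel₀ hp0 ?_
    linear_combination -h1
  linear_combination (posPow α (1 - r) * η (slabPoint (x', h * (1 - r)))) * h4

lemma measurable_layer {p h : ℝ} {τ : Space m → ℝ} (hτ : Continuous τ) :
    StronglyMeasurable fun q : EuclideanSpace ℝ (Fin m) × ℝ => layer K p τ h q.1 q.2 := by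
  unfold layer
  have h1 : Measurable fun w : (EuclideanSpace ℝ (Fin m) × ℝ) × Space m =>
      posPow p (-w.1.2 - lastCoord w.2) * τ (slabPoint (w.1.1, -(h * w.1.2)) - h • w.2) := by
    refine ((measurable_posPow p).comp (by fun_prop)).mul (hτ.measurable.comp ?_)
    refine (measurable_slabPoint.comp ?_).sub (by fun_prop)
    fun_prop
  exact h1.stronglyMeasurable.integral_prod_right'

lemma abs_layer_le (hK : IsStableKernel s lam Lam K b) (hs : 0 < s) {p N h : ℝ} (hp : 0 < p)
    (hps : p < 2 * s) {τ : Space m → ℝ} (hτ : ∀ x, |τ x| ≤ N) (x' : EuclideanSpace ℝ (Fin m))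
    {r : ℝ} (hr : 0 < r) :
    |layer K p τ h x' r| ≤
      fluxMinus s K * (r ^ (p - 2 * s) * ProbabilityTheory.beta (p + 1) (2 * s - p)) * N := by
  rw [← integral_posPow_exterior hK hs hp hps hr, ← integral_mul_const, ← Real.norm_eq_abs]
  refine norm_integral_le_of_norm_le ((integrable_posPow_exterior hK hp hps hr).mul_const N)
    (Eventually.of_forall fun z => ?_)
  rw [norm_mul, Real.norm_of_nonneg (posPow_nonneg _ _)]
  exact mul_le_mul_of_nonneg_left (hτ _) (posPow_nonneg _ _)

lemma tendsto_layer (hK : IsStableKernel s lam Lam K b) (hs : 0 < s) {p N : ℝ} (hp : 0 < p)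
    (hps : p < 2 * s) {τ : Space m → ℝ} (hτc : Continuous τ) (hτ : ∀ x, |τ x| ≤ N)
    (x' : EuclideanSpace ℝ (Fin m)) {r : ℝ} (hr : 0 < r) :
    Tendsto (fun h => layer K p τ h x' r) (𝓝[>] 0) (𝓝 (fluxMinus s K *
      (r ^ (p - 2 * s) * ProbabilityTheory.beta (p + 1) (2 * s - p)) * τ (bdryPoint x'))) := by
  rw [← integral_posPow_exterior hK hs hp hps hr, ← integral_mul_const]
  have hc : ∀ z : Space m, Continuous fun h : ℝ => τ (slabPoint (x', -(h * r)) - h • z) := fun z => by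
    simp only [slabPoint]; fun_prop
  refine tendsto_integral_filter_of_dominated_convergence
    (fun z => posPow p (-r - lastCoord z) * N) (Eventually.of_forall fun h => ?_)
    (Eventually.of_forall fun h => Eventually.of_forall fun z => ?_)
    ((integrable_posPow_exterior hK hp hps hr).mul_const N) (Eventually.of_forall fun z => ?_)
  · exact (((measurable_posPow p).comp (by fun_prop)).mul
      (Continuous.measurable (by fun_prop))).aestronglyMeasurable
  · rw [norm_mul, Real.norm_of_nonneg (posPow_nonneg _ _)]
    exact mul_le_mul_of_nonneg_left (hτ _) (posPow_nonneg _ _)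
  · refine Tendsto.const_mul _ ?_
    exact ((hc z).tendsto' 0 _ (by simp [slabPoint])).mono_left nhdsWithin_le_nhds

/-- The profile of the layer in the normal variable. Integrability at r = 0 is the reason for the
restriction α < 1. -/
lemma integrableOn_and_integral_posPow_one_sub {α : ℝ} (hα : 0 < α) (hα1 : α < 1) :
    IntegrableOn (fun r : ℝ => posPow α (1 - r) * r ^ (-α)) (Ioi 0) ∧
    ∫ r in Ioi (0 : ℝ), posPow α (1 - r) * r ^ (-α) = ProbabilityTheory.beta (1 - α) (α + 1) := by
  obtain ⟨h1, h2⟩ := integrableOn_and_integral_beta (by linarith : 0 < 1 - α)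
    (by linarith : 0 < α + 1)
  have h3 : ∀ r ∈ Ioo (0 : ℝ) 1, r ^ (1 - α - 1) * (1 - r) ^ (α + 1 - 1) =
      posPow α (1 - r) * r ^ (-α) := fun r hr => by
    rw [posPow_of_pos (by linarith [hr.2]), mul_comm]; ring_nf
  have h4 := h1.congr_fun h3 measurableSet_Ioo
  rw [setIntegral_congr_fun measurableSet_Ioo h3] at h2
  have h5 : ∀ r ∈ Ioi (0 : ℝ) \ Ioo 0 1, posPow α (1 - r) * r ^ (-α) = 0 := fun r hr => by
    have : 1 ≤ r := by
      by_contra hcon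
      exact hr.2 ⟨hr.1, not_le.1 hcon⟩
    rw [posPow_of_nonpos hα (by linarith), zero_mul]
  refine ⟨h4.of_forall_sdiff_eq_zero measurableSet_Ioi h5, ?_⟩
  rw [← h2]
  exact (setIntegral_eq_of_subset_of_forall_sdiff_eq_zero measurableSet_Ioi Ioo_subset_Ioi_self h5)

/-- The integrand over the boundary layer is dominated by an integrable profile. -/
lemma norm_layer_integrand_le (hK : IsStableKernel s lam Lam K b) (hs : 0 < s) {α p N N' h : ℝ}
    (hα : 0 < α) (hp : 0 < p) (hαp : α + p = 2 * s) {η τ : Space m → ℝ} (hη : ∀ x, |η x| ≤ N)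
    (hτ : ∀ x, |τ x| ≤ N') (x' : EuclideanSpace ℝ (Fin m)) {r : ℝ} (hr : 0 < r) :
    ‖posPow α (1 - r) * η (slabPoint (x', h * (1 - r))) * layer K p τ h x' r‖ ≤
      N * N' * (fluxMinus s K * ProbabilityTheory.beta (p + 1) α) *
        (posPow α (1 - r) * r ^ (-α)) := by
  have h1 := abs_layer_le (h := h) hK hs hp (by linarith) hτ x' hr
  rw [show p - 2 * s = -α by linarith, show 2 * s - p = α by linarith] at h1
  have hN : 0 ≤ N := (abs_nonneg _).trans (hη 0)
  rw [norm_mul, norm_mul, Real.norm_of_nonneg (posPow_nonneg _ _), Real.norm_eq_abs,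
    Real.norm_eq_abs]
  calc posPow α (1 - r) * |η (slabPoint (x', h * (1 - r)))| * |layer K p τ h x' r|
      ≤ posPow α (1 - r) * N *
        (fluxMinus s K * (r ^ (-α) * ProbabilityTheory.beta (p + 1) α) * N') :=
        mul_le_mul (mul_le_mul_of_nonneg_left (hη _) (posPow_nonneg _ _)) h1 (abs_nonneg _)
          (mul_nonneg (posPow_nonneg _ _) hN)
    _ = _ := by ring

lemma measurable_layer_integrand {α p h : ℝ} {η τ : Space m → ℝ} (hη : Continuous η)
    (hτ : Continuous τ) :
    StronglyMeasurable fun q : EuclideanSpace ℝ (Fin m) × ℝ =>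
      posPow α (1 - q.2) * η (slabPoint (q.1, h * (1 - q.2))) * layer K p τ h q.1 q.2 := by
  refine StronglyMeasurable.mul (Measurable.stronglyMeasurable ?_) (measurable_layer hτ)
  exact ((measurable_posPow α).comp (by fun_prop)).mul
    (hη.measurable.comp (measurable_slabPoint.comp (by fun_prop)))

lemma tendsto_integral_layer (hK : IsStableKernel s lam Lam K b) (hs : 0 < s) {α p N N' : ℝ}
    (hα : 0 < α) (hα1 : α < 1) (hp : 0 < p) (hαp : α + p = 2 * s) {η τ : Space m → ℝ}
    (hηc : Continuous η) (hτc : Continuous τ) (hη : ∀ x, |η x| ≤ N) (hτ : ∀ x, |τ x| ≤ N')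
    (x' : EuclideanSpace ℝ (Fin m)) :
    Tendsto (fun h => ∫ r in Ioi (0 : ℝ),
      posPow α (1 - r) * η (slabPoint (x', h * (1 - r))) * layer K p τ h x' r) (𝓝[>] 0)
      (𝓝 (η (bdryPoint x') * τ (bdryPoint x') * (fluxMinus s K *
        ProbabilityTheory.beta (p + 1) α * ProbabilityTheory.beta (1 - α) (α + 1)))) := by
  obtain ⟨j1, j2⟩ := integrableOn_and_integral_posPow_one_sub hα hα1
  have e : η (bdryPoint x') * τ (bdryPoint x') * (fluxMinus s K *
      ProbabilityTheory.beta (p + 1) α * ProbabilityTheory.beta (1 - α) (α + 1)) =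
      ∫ r in Ioi (0 : ℝ), (η (bdryPoint x') * τ (bdryPoint x') * (fluxMinus s K *
      ProbabilityTheory.beta (p + 1) α)) * (posPow α (1 - r) * r ^ (-α)) := by
    rw [integral_const_mul, j2]; ring
  rw [e]
  have hpos : ∀ᵐ r ∂((volume : Measure ℝ).restrict (Ioi 0)), 0 < r :=
    ae_restrict_mem measurableSet_Ioi
  refine tendsto_integral_filter_of_dominated_convergence
    (fun r => N * N' * (fluxMinus s K * ProbabilityTheory.beta (p + 1) α) *
        (posPow α (1 - r) * r ^ (-α))) (Eventually.of_forall fun h => ?_)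
    (Eventually.of_forall fun h => ?_) (j1.const_mul _) ?_
  · exact ((measurable_layer_integrand hηc hτc).comp_measurable
      (measurable_prodMk_left (x := x'))).aestronglyMeasurable
  · filter_upwards [hpos] with r hr
    exact norm_layer_integrand_le hK hs hα hp hαp hη hτ x' hr
  · filter_upwards [hpos] with r hr
    have h1 := tendsto_layer hK hs hp (by linarith) hτc hτ x' hr
    rw [show p - 2 * s = -α by linarith, show 2 * s - p = α by linarith] at h1
    have h2 : Tendsto (fun h : ℝ => η (slabPoint (x', h * (1 - r)))) (𝓝[>] 0)
        (𝓝 (η (bdryPoint x'))) := by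
      have hc : Continuous fun h : ℝ => η (slabPoint (x', h * (1 - r))) := by
        simp only [slabPoint]; fun_prop
      exact (hc.tendsto' 0 _ (by simp [slabPoint])).mono_left nhdsWithin_le_nhds
    have h3 := (h2.const_mul (posPow α (1 - r))).mul h1
    convert h3 using 2
    ring

/-- The inner integrals are bounded uniformly in h and vanish for |x'| > ρ, because the tangential
part of a point is no longer than the point. Dominated convergence applies in x'. -/
lemma tendsto_integral_integral_layer (hK : IsStableKernel s lam Lam K b) (hs : 0 < s)
    {α p N N' ρ : ℝ}
    (hα : 0 < α) (hα1 : α < 1) (hp : 0 < p) (hαp : α + p = 2 * s) {η τ : Space m → ℝ}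
    (hηc : Continuous η) (hτc : Continuous τ) (hη : ∀ x, |η x| ≤ N) (hτ : ∀ x, |τ x| ≤ N')
    (hηs : ∀ x, ρ < ‖x‖ → η x = 0) :
    Tendsto (fun h => ∫ x' : EuclideanSpace ℝ (Fin m), ∫ r in Ioi (0 : ℝ),
      posPow α (1 - r) * η (slabPoint (x', h * (1 - r))) * layer K p τ h x' r) (𝓝[>] 0)
      (𝓝 ((∫ x' : EuclideanSpace ℝ (Fin m), η (bdryPoint x') * τ (bdryPoint x')) *
        (fluxMinus s K * ProbabilityTheory.beta (p + 1) α *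
          ProbabilityTheory.beta (1 - α) (α + 1)))) := by
  obtain ⟨j1, j2⟩ := integrableOn_and_integral_posPow_one_sub hα hα1
  rw [← integral_mul_const]
  set c := N * N' * (fluxMinus s K * ProbabilityTheory.beta (p + 1) α) *
    ProbabilityTheory.beta (1 - α) (α + 1) with hc
  refine tendsto_integral_filter_of_dominated_convergence
    ((Metric.closedBall (0 : EuclideanSpace ℝ (Fin m)) ρ).indicator fun _ => c)
    (Eventually.of_forall fun h => ?_) (Eventually.of_forall fun h => Eventually.of_forall fun x' => ?_)
    ?_ (Eventually.of_forall fun x' => tendsto_integral_layer hK hs hα hα1 hp hαp hηc hτc hη hτ x')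
  · exact (measurable_layer_integrand hηc hτc).integral_prod_right'.aestronglyMeasurable
  · by_cases hx : ‖x'‖ ≤ ρ
    · rw [indicator_of_mem (mem_closedBall_zero_iff.2 hx), hc, ← j2, ← integral_const_mul]
      refine norm_integral_le_of_norm_le (j1.const_mul _) ?_
      filter_upwards [ae_restrict_mem measurableSet_Ioi] with r hr
      exact norm_layer_integrand_le hK hs hα hp hαp hη hτ x' hr
    · rw [indicator_of_notMem (by rwa [mem_closedBall_zero_iff])]
      have h0 : ∀ r, η (slabPoint (x', h * (1 - r))) = 0 := fun r =>
        hηs _ ((not_le.1 hx).trans_le (norm_fst_le_slabPoint (x', h * (1 - r))))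
      simp [h0]
  · rw [integrable_indicator_iff Metric.isClosed_closedBall.measurableSet]
    exact integrableOn_const measure_closedBall_lt_top.ne

/-- The exterior integral, rescaled to the boundary layer. -/
lemma setIntegral_compl_halfSpace_eq_layer (hK : IsStableKernel s lam Lam K b) {α p h : ℝ}
    (hp : 0 < p) (hαp : α + p = 2 * s) (hh : 0 < h) {η τ : Space m → ℝ}
    (hint : Integrable fun x => powMul α η (x + h • eLast m) *
      regOp s (adjKernel K) (-b) (powMul p τ) x) :
    ∫ x in (halfSpace m)ᶜ, powMul α η (x + h • eLast m) *
      regOp s (adjKernel K) (-b) (powMul p τ) x =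
    -(h * ∫ x' : EuclideanSpace ℝ (Fin m), ∫ r in Ioi (0 : ℝ),
      posPow α (1 - r) * η (slabPoint (x', h * (1 - r))) * layer K p τ h x' r) := by
  have hv0 : ∀ x : Space m, lastCoord x ≤ 0 → powMul p τ x = 0 := fun x hx => by
    rw [powMul_eq, posPow_of_nonpos hp hx, zero_mul]
  set F : Space m → ℝ := fun x => powMul α η (x + h • eLast m) *
    ∫ y, powMul p τ (x - y) ∂(kernelMeasure K) with hF
  have hm : MeasurableSet (halfSpace m)ᶜ := measurableSet_halfSpace.compl
  have e1 : ∀ᵐ x ∂(volume.restrict (halfSpace m)ᶜ), powMul α η (x + h • eLast m) *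
      regOp s (adjKernel K) (-b) (powMul p τ) x = -F x := by
    filter_upwards [ae_restrict_mem hm, ae_restrict_of_ae (ae_lastCoord_ne 0)] with x hx hx0
    rw [regOp_adjKernel_of_neg hv0 (lt_of_le_of_ne (not_lt.1 hx) hx0), mul_neg]
  have hFi : IntegrableOn F (halfSpace m)ᶜ := by
    refine (hint.integrableOn.neg (s := (halfSpace m)ᶜ)).congr ?_
    filter_upwards [e1] with x hx
    rw [Pi.neg_apply, hx, neg_neg]
  rw [integral_congr_ae e1, integral_neg, ← integral_indicator hm,
    ← measurePreserving_slabPoint.integral_comp measurableEmbedding_slabPoint]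
  have hi := (measurePreserving_slabPoint (m := m)).integrable_comp_of_integrable
    ((integrable_indicator_iff hm).2 hFi)
  rw [Measure.volume_eq_prod] at hi ⊢
  have hi2 := integral_prod _ hi
  rw [Function.comp_def] at hi2
  rw [hi2, ← integral_const_mul]
  congr 1
  refine integral_congr_ae (Eventually.of_forall fun x' => ?_)
  beta_reduce
  -- Substitution t = -h r in the normal variable. Its Jacobian h is the factor that division by h
  -- will remove.
  have h2 := Measure.integral_comp_mul_left
    (fun t : ℝ => (halfSpace m)ᶜ.indicator F (slabPoint (x', t))) (-h)
  rw [abs_inv, abs_neg, abs_of_pos hh, smul_eq_mul] at h2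
  have h3 : ∀ r, (halfSpace m)ᶜ.indicator F (slabPoint (x', -h * r)) =
      (Ici (0 : ℝ)).indicator (fun r => posPow α (1 - r) * η (slabPoint (x', h * (1 - r))) *
        layer K p τ h x' r) r := fun r => by
    by_cases hr : 0 ≤ r
    · rw [indicator_of_mem (show r ∈ Ici (0 : ℝ) from hr), indicator_of_mem, hF,
        ← powMul_mul_integral_eq_layer hK hαp hh, neg_mul]
      show ¬ (0 < lastCoord _)
      rw [lastCoord_slabPoint]; nlinarith
    · rw [indicator_of_notMem (show r ∉ Ici (0 : ℝ) from hr), indicator_of_notMem]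
      show ¬ ¬ (0 < lastCoord _)
      rw [lastCoord_slabPoint, not_not]; nlinarith
  simp_rw [h3] at h2
  rw [integral_indicator measurableSet_Ici, integral_Ici_eq_integral_Ioi] at h2
  rw [h2, mul_inv_cancel_left₀ hh.ne']

end LayerLimit

end

/-! ### The identity on the half space -/

section

variable {m : ℕ} {s lam Lam : ℝ} {K : Space m → ℝ} {b : Space m}

section HalfSpaceIdentity

lemma abs_powMul_le {N ρ β : ℝ} {η : Space m → ℝ} (hη : TestBounds N ρ η) (x : Space m) :
    |powMul β η x| ≤ N * posPow β (lastCoord x) := by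
  rw [powMul_eq, abs_mul, abs_of_nonneg (posPow_nonneg _ _), mul_comm]
  exact mul_le_mul_of_nonneg_right (hη.bound x) (posPow_nonneg _ _)

/-- Divide the shifted identity by h and compare limits as h ↓ 0. The left side tends to the two
half-space integrals, the right side to the limit of the boundary layer. -/
lemma integral_halfSpace_regOp {α p N ρ N' ρ' : ℝ} {η τ : Space m → ℝ}
    (hK : IsStableKernel s lam Lam K b) (hs0 : 0 < s) (hs1 : s < 1)
    (hα : 0 < α) (hα1 : α < 1) (hp : 0 < p) (hαp : α + p = 2 * s)
    (hmα : IsMatched s K b α) (hmp : IsMatched s (adjKernel K) (-b) p)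
    (hη : TestBounds N ρ η) (hτ : TestBounds N' ρ' τ) :
    IntegrableOn (fun x => fderiv ℝ (powMul α η) x (eLast m) *
      regOp s (adjKernel K) (-b) (powMul p τ) x) (halfSpace m) ∧
    IntegrableOn (fun x => fderiv ℝ (powMul p τ) x (eLast m) * regOp s K b (powMul α η) x)
      (halfSpace m) ∧
    (∫ x in halfSpace m, fderiv ℝ (powMul α η) x (eLast m) *
      regOp s (adjKernel K) (-b) (powMul p τ) x) +
      (∫ x in halfSpace m, fderiv ℝ (powMul p τ) x (eLast m) * regOp s K b (powMul α η) x) =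
    (∫ x' : EuclideanSpace ℝ (Fin m), η (bdryPoint x') * τ (bdryPoint x')) *
      (fluxMinus s K * ProbabilityTheory.beta (p + 1) α *
        ProbabilityTheory.beta (1 - α) (α + 1)) := by
  have hu := bdryFun_powMul hη hα
  have hv := bdryFun_powMul hτ hp
  have hρ := hη.pos
  have hρ' := hτ.pos
  have hminα : min α 1 = α := min_eq_left hα1.le
  obtain ⟨M₁, g₁, -, hg₁, hg₁1, hb₁⟩ := exists_regOp_powMul_bound hK.adjoint hs0 hs1 hp
    (by linarith) hmp hτ (by linarith : 0 < ρ + 1)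
  obtain ⟨M₂, g₂, -, hg₂, hg₂1, hb₂⟩ := exists_regOp_powMul_bound hK hs0 hs1 hα
    (by linarith) hmα hη (by linarith : 0 < ρ' + 1)
  obtain ⟨i1, t1⟩ := tendsto_setIntegral_slope hu (measurable_regOp hv.continuous).measurable hb₁
    (by rw [hminα]; linarith) norm_eLast.le
  -- In this term v is translated backwards, so its limit is -∂_n v and the difference of the two
  -- limits is a sum. The regularity of v is min p 1, hence g₂ must be below both 2s - α = p and 1.
  obtain ⟨i2, t2⟩ := tendsto_setIntegral_slope hv (measurable_regOp hu.continuous).measurable hb₂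
    (lt_min (by linarith) hg₂1) (y := -eLast m) (by rw [norm_neg]; exact norm_eLast.le)
  have t3 := tendsto_integral_integral_layer hK hs0 hα hα1 hp hαp hη.differentiable.continuous
    hτ.differentiable.continuous hη.bound hτ.bound hη.support
  simp only [map_neg, neg_mul, integral_neg] at i2 t2
  have i2' : IntegrableOn (fun x => fderiv ℝ (powMul p τ) x (eLast m) *
      regOp s K b (powMul α η) x) (halfSpace m) := by simpa using i2.neg
  refine ⟨i1, i2', ?_⟩
  have t12 := t1.sub t2
  rw [sub_neg_eq_add] at t12
  refine tendsto_nhds_unique t12 (t3.congr' ?_)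
  filter_upwards [self_mem_nhdsWithin] with h hh
  have hh0 : 0 < h := hh
  have hβ's : min p 1 < 2 * s := (min_le_left _ _).trans_lt (by linarith)
  have hβ' : 2 * s - 1 < min p 1 := lt_min (by linarith) (by linarith)
  have hβs : min α 1 < 2 * s := (min_le_left _ _).trans_lt (by linarith)
  have hpβ : 2 * s - 1 < p + min α 1 := by rw [hminα]; linarith
  have e1 := setIntegral_halfSpace_shift hK hs1 hu hβs
    (fun x hx => by rw [powMul_eq, posPow_of_nonpos hα hx, zero_mul]) hv hβ's hβ' hp hpβ
    (abs_powMul_le hτ) hh0.le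
  have e2 := setIntegral_compl_halfSpace_eq_layer hK hp hαp hh0
    (integral_mul_regOp_adjoint hK hs1 hu hβs hv hβ's hβ' hp hpβ (abs_powMul_le hτ) hh0.le).1
  rw [e2, neg_neg] at e1
  rw [← mul_sub, e1, inv_mul_cancel_left₀ hh0.ne']

lemma stableOp_powMul {β N ρ : ℝ} {η : Space m → ℝ} (hK : IsStableKernel s lam Lam K b)
    (hs1 : s < 1) (hβ : 0 < β) (hβs : β < 2 * s) (hη : TestBounds N ρ η) {x : Space m}
    (hx : x ∈ halfSpace m) :
    StableOpDefinedAt s K (powMul β η) x ∧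
      stableOp s K b (powMul β η) x = regOp s K b (powMul β η) x := by
  have hx0 : 0 < lastCoord x := hx
  have hf := bdryFun_powMul hη hβ
  obtain ⟨C, hC⟩ := hf.regular _ hx0
  exact stableOp_eq_regOp hK hf.continuous hf.bound (hC.differentiableAt x hx0.ne')
    (integrable_increment hK hs1 hC hf.pos hf.le_one ((min_le_left _ _).trans_lt hβs) hx0 hx0.ne'
      (abs_of_pos hx0).le)

/-- The product of Beta values is Γ(p+1) Γ(α) Γ(1-α) Γ(α+1) / Γ(1+2s). Reflection gives Γ(α) Γ(1-α)
= π / sin(πα), which cancels the sine in the relation between flux and modulus. -/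
lemma flux_constant {α p k S : ℝ} (hα : 0 < α) (hα1 : α < 1) (hαp : α + p = 2 * s)
    (hk : S * Real.sin (Real.pi * α) * Real.Gamma (1 + 2 * s) = Real.pi * k) (hs0 : 0 < s) :
    k * ProbabilityTheory.beta (p + 1) α * ProbabilityTheory.beta (1 - α) (α + 1) =
      Real.Gamma (α + 1) * Real.Gamma (p + 1) * S := by
  have h1 := Real.Gamma_mul_Gamma_one_sub α
  have hsin : Real.sin (Real.pi * α) ≠ 0 :=
    (Real.sin_pos_of_pos_of_lt_pi (by positivity) (by nlinarith [Real.pi_pos])).ne'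
  have hG : Real.Gamma (1 + 2 * s) ≠ 0 := (Real.Gamma_pos_of_pos (by linarith)).ne'
  rw [eq_div_iff hsin] at h1
  rw [ProbabilityTheory.beta, ProbabilityTheory.beta, show p + 1 + α = 1 + 2 * s by linarith,
    show 1 - α + (α + 1) = 2 by ring, Real.Gamma_two]
  have hpi := Real.pi_ne_zero
  field_simp
  refine mul_left_cancel₀ hpi ?_
  linear_combination (-(Real.Gamma (p + 1) * Real.Gamma α * Real.Gamma (1 - α))) * hk +
    (Real.Gamma (p + 1) * S * Real.Gamma (1 + 2 * s)) * h1

lemma integral_halfSpace_stableOp_of_lt_one {p N ρ N' ρ' : ℝ} {η τ : Space m → ℝ}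
    (hK : IsStableKernel s lam Lam K b) (hs0 : 0 < s) (hs1 : s < 1)
    (hα : 0 < bdryExponent s K b (eLast m)) (hα1 : bdryExponent s K b (eLast m) < 1) (hp : 0 < p)
    (hαp : bdryExponent s K b (eLast m) + p = 2 * s)
    (hη : TestBounds N ρ η) (hτ : TestBounds N' ρ' τ) :
    IntegrableOn (fun x => partialLast (powMul (bdryExponent s K b (eLast m)) η) x *
        adjointOp s K b (powMul p τ) x +
        stableOp s K b (powMul (bdryExponent s K b (eLast m)) η) x * partialLast (powMul p τ) x)
      (halfSpace m) ∧
    ∫ x in halfSpace m, (partialLast (powMul (bdryExponent s K b (eLast m)) η) x *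
        adjointOp s K b (powMul p τ) x +
        stableOp s K b (powMul (bdryExponent s K b (eLast m)) η) x * partialLast (powMul p τ) x) =
      Real.Gamma (bdryExponent s K b (eLast m) + 1) * Real.Gamma (p + 1) *
        √(symbolA s K (eLast m) ^ 2 + symbolB s K b (eLast m) ^ 2) *
        ∫ x' : EuclideanSpace ℝ (Fin m), η (bdryPoint x') * τ (bdryPoint x') := by
  have hmp : IsMatched s (adjKernel K) (-b) p := by
    rw [show p = bdryExponent s (adjKernel K) (-b) (eLast m) by
      rw [bdryExponent_adjKernel]; linarith]
    exact isMatched_bdryExponent hK.adjoint hs0 hs1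
  have hmα := isMatched_bdryExponent hK hs0 hs1
  have hflux := sqrt_mul_sin_mul_Gamma hK hs0 hs1
  set α := bdryExponent s K b (eLast m) with hαdef
  obtain ⟨i1, i2, h12⟩ := integral_halfSpace_regOp hK hs0 hs1 hα hα1 hp hαp hmα hmp hη hτ
  have e : ∀ x ∈ halfSpace m, fderiv ℝ (powMul α η) x (eLast m) *
      regOp s (adjKernel K) (-b) (powMul p τ) x +
      fderiv ℝ (powMul p τ) x (eLast m) * regOp s K b (powMul α η) x =
      partialLast (powMul α η) x * adjointOp s K b (powMul p τ) x +
        stableOp s K b (powMul α η) x * partialLast (powMul p τ) x := fun x hx => by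
    rw [adjointOp, (stableOp_powMul hK.adjoint hs1 hp (by linarith) hτ hx).2,
      (stableOp_powMul hK hs1 hα (by linarith) hη hx).2, partialLast, partialLast]
    ring
  refine ⟨IntegrableOn.congr_fun (i1.add i2) e measurableSet_halfSpace, ?_⟩
  rw [← setIntegral_congr_fun measurableSet_halfSpace e, integral_add i1 i2, h12,
    flux_constant hα hα1 hαp hflux hs0, mul_comm]

end HalfSpaceIdentity

end

end Stable

end

theorem proposition1p4 (m : ℕ) (s lam Lam : ℝ) (hs : s ∈ Set.Ioo (0 : ℝ) 1)
    (K : Stable.Space m → ℝ) (b : Stable.Space m)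
    (hK : Stable.IsStableKernel s lam Lam K b)
    (η τ : Stable.Space m → ℝ)
    (hη : ContDiff ℝ ∞ η) (hη_supp : HasCompactSupport η)
    (hτ : ContDiff ℝ ∞ τ) (hτ_supp : HasCompactSupport τ)
    (γ γs : ℝ) (hγ : γ = Stable.bdryExponent s K b (Stable.eLast m))
    (hγs : γs ∈ Set.Ioo (0 : ℝ) (2 * s)) (hsum : γ + γs = 2 * s)
    (u v : Stable.Space m → ℝ)
    (hu : u = Stable.powMul γ η) (hv : v = Stable.powMul γs τ) :
    (∀ x ∈ Stable.halfSpace m, Stable.StableOpDefinedAt s K u x) ∧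
    (∀ x ∈ Stable.halfSpace m, Stable.StableOpDefinedAt s (Stable.adjKernel K) v x) ∧
    IntegrableOn
      (fun x => Stable.partialLast u x * Stable.adjointOp s K b v x
        + Stable.stableOp s K b u x * Stable.partialLast v x)
      (Stable.halfSpace m) volume ∧
    ∫ x in Stable.halfSpace m,
        (Stable.partialLast u x * Stable.adjointOp s K b v x
          + Stable.stableOp s K b u x * Stable.partialLast v x)
      = Real.Gamma (γ + 1) * Real.Gamma (γs + 1)
          * Real.sqrt (Stable.symbolA s K (Stable.eLast m) ^ 2
              + Stable.symbolB s K b (Stable.eLast m) ^ 2)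
          * ∫ x' : EuclideanSpace ℝ (Fin m),
              η (Stable.bdryPoint x') * τ (Stable.bdryPoint x') := by
  have hs0 : 0 < s := hs.1
  have hs1 : s < 1 := hs.2
  obtain ⟨N, ρ, hηb⟩ := Stable.exists_testBounds hη hη_supp
  obtain ⟨N', ρ', hτb⟩ := Stable.exists_testBounds hτ hτ_supp
  -- Positivity of γ is read off from γ* < 2s, so no bound on the arctangent is needed.
  have hγ0 : 0 < γ := by linarith [hγs.2]
  have hγs0 : 0 < γs := hγs.1
  subst hu hv
  refine ⟨fun x hx => (Stable.stableOp_powMul hK hs1 hγ0 (by linarith) hηb hx).1,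
    fun x hx => (Stable.stableOp_powMul hK.adjoint hs1 hγs0 hγs.2 hτb hx).1, ?_⟩
  -- The layer limit needs an exponent below 1. If γ ≥ 1 then γ* = 2s - γ < 1 is the exponent of the
  -- adjoint. Exchanging (L, u) with (L*, v) leaves both sides of the identity unchanged, since L**
  -- = L and the modulus of the symbol is the same.
  rcases lt_or_ge γ 1 with h1 | h1
  · subst hγ
    exact Stable.integral_halfSpace_stableOp_of_lt_one hK hs0 hs1 hγ0 h1 hγs0 hsum hηb hτb
  · have hγs' : γs = Stable.bdryExponent s (Stable.adjKernel K) (-b) (Stable.eLast m) := by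
      rw [Stable.bdryExponent_adjKernel, ← hγ]; linarith
    have hγs1 : γs < 1 := by linarith
    have key := Stable.integral_halfSpace_stableOp_of_lt_one (p := γ) (η := τ) (τ := η) hK.adjoint
      hs0 hs1 (by rw [← hγs']; exact hγs0) (by rw [← hγs']; exact hγs1) hγ0
      (by rw [← hγs']; linarith) hτb hηb
    rw [← hγs', Stable.symbolA_adjKernel, Stable.symbolB_adjKernel, neg_sq] at key
    have e : ∀ x, Stable.partialLast (Stable.powMul γs τ) x *
        Stable.adjointOp s (Stable.adjKernel K) (-b) (Stable.powMul γ η) x +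
        Stable.stableOp s (Stable.adjKernel K) (-b) (Stable.powMul γs τ) x *
          Stable.partialLast (Stable.powMul γ η) x =
        Stable.partialLast (Stable.powMul γ η) x *
          Stable.adjointOp s K b (Stable.powMul γs τ) x +
        Stable.stableOp s K b (Stable.powMul γ η) x *
          Stable.partialLast (Stable.powMul γs τ) x := fun x => by
      rw [Stable.adjointOp, Stable.adjKernel_adjKernel, neg_neg, Stable.adjointOp]; ring
    simp_rw [e] at key
    refine ⟨key.1, key.2.trans ?_⟩
    simp_rw [mul_comm (τ _) (η _)]
    ring
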